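/- There exists a compact, $3$-connected, bad $4$-orbifold. More precisely, there is a continuous irreducible unitary representation $\rho$ of $\mathrm{SU}(2)$ on $\mathbb{C}^4$ such that the induced action of $\mathrm{SU}(2)$ on the unit sphere $S^7\subset\mathbb{C}^4$ is almost free (all isotropy groups are finite) but not free, and the quotient $\mathcal{O}=S^7/\mathrm{SU}(2)$ (a weighted quaternionic projective space) is a smooth effective $4$-dimensional orbifold, whose charts are given by the slices of the action, with the following properties: $\mathcal{O}$ is compact; $\mathcal{O}$ is $3$-connected as an orbifold, i.e. its classifying space, the Borel construction $B\mathcal{O}=S^7\times_{\mathrm{SU}(2)}E\mathrm{SU}(2)$, is $3$-connected (nonempty, with trivial homotopy groups in degrees $0,\dots,3$ for every base point); and $\mathcal{O}$ is bad, i.e. there is no orbifold covering (in the sense of Thurston) of $\mathcal{O}$ by a manifold, that is, by an orbifold all of whose local groups are trivial. -/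

import Mathlib

open scoped Manifold ContDiff

/-! ### Orbifolds -/

/-- `Γ`, a finite group of smooth diffeomorphisms of the connected open set `U ⊆ ℝⁿ`, together with
`φ : U → X`, is an orbifold chart of `X`: the map `φ` induces a homeomorphism of `U / Γ` onto an
open subset of `X`. The action is effective because `Γ` is a group of transformations. -/
structure IsOrbifoldChart {n : ℕ} {X : Type} [TopologicalSpace X]
    (U : TopologicalSpace.Opens (EuclideanSpace ℝ (Fin n))) (Γ : Subgroup (U ≃ₜ U))
    (φ : U → X) : Prop where
  connected : IsConnected (U : Set (EuclideanSpace ℝ (Fin n)))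
  finite : Finite Γ
  smooth : ∀ γ ∈ Γ, ContMDiff (𝓡 n) (𝓡 n) ∞ (γ : U → U)
  continuous : Continuous φ
  isOpenMap : IsOpenMap φ
  fibers : ∀ u v : U, φ u = φ v ↔ ∃ γ ∈ Γ, γ u = v

/-- An `n`-dimensional smooth (effective) orbifold chart of the space `X`. -/
structure OrbifoldChart (n : ℕ) (X : Type) [TopologicalSpace X] where
  dom : TopologicalSpace.Opens (EuclideanSpace ℝ (Fin n))
  group : Subgroup (dom ≃ₜ dom)
  toFun : dom → X
  isChart : IsOrbifoldChart dom group toFun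

/-- Two orbifold charts are compatible if any two points of their domains with the same image in
`X` are related by a local diffeomorphism that commutes with the projections to `X`. -/
def OrbifoldChart.Compatible {n : ℕ} {X : Type} [TopologicalSpace X]
    (c c' : OrbifoldChart n X) : Prop :=
  ∀ (u : c.dom) (v : c'.dom), c.toFun u = c'.toFun v →
    ∃ h : PartialDiffeomorph (𝓡 n) (𝓡 n) c.dom c'.dom ∞,
      u ∈ h.source ∧ h.toFun u = v ∧ ∀ w ∈ h.source, c'.toFun (h.toFun w) = c.toFun w

/-- The isotropy group of a point of the domain of a chart; it represents the local group of the
orbifold at the image point. -/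
def OrbifoldChart.isotropy {n : ℕ} {X : Type} [TopologicalSpace X]
    (c : OrbifoldChart n X) (u : c.dom) : Subgroup (c.dom ≃ₜ c.dom) where
  carrier := {γ | γ ∈ c.group ∧ γ u = u}
  mul_mem' {γ δ} hγ hδ := ⟨mul_mem hγ.1 hδ.1, by
    change γ (δ u) = u
    rw [hδ.2, hγ.2]⟩
  one_mem' := ⟨one_mem _, rfl⟩
  inv_mem' {γ} hγ := ⟨inv_mem hγ.1, by
    change γ.symm u = u
    rw [Homeomorph.symm_apply_eq, hγ.2]⟩

/-- A smooth (effective) `n`-dimensional orbifold: a second countable Hausdorff space with an atlas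
of pairwise compatible orbifold charts. -/
structure Orbifold (n : ℕ) where
  carrier : Type
  [top : TopologicalSpace carrier]
  [t2 : T2Space carrier]
  [secondCountable : SecondCountableTopology carrier]
  atlas : Set (OrbifoldChart n carrier)
  covers : ∀ x : carrier, ∃ c ∈ atlas, x ∈ Set.range c.toFun
  compatible : ∀ c ∈ atlas, ∀ c' ∈ atlas, c.Compatible c'

instance {n : ℕ} : CoeSort (Orbifold n) Type := ⟨Orbifold.carrier⟩

instance {n : ℕ} (O : Orbifold n) : TopologicalSpace O := O.top

namespace Orbifold

/-- The charts of the orbifold structure, that is, the members of the maximal atlas. -/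
def IsChart {n : ℕ} (O : Orbifold n) (c : OrbifoldChart n O) : Prop :=
  ∀ c' ∈ O.atlas, c.Compatible c'

/-- An orbifold is a manifold if all its local groups are trivial. -/
def IsManifold {n : ℕ} (O : Orbifold n) : Prop :=
  ∀ c : OrbifoldChart n O, O.IsChart c → ∀ u : c.dom, c.isotropy u = ⊥

/-- Thurston's notion of an orbifold covering: every point of `O` lies in the image `φ(U) ≅ U / Γ`
of a chart such that every component of `p⁻¹(φ(U))` is, compatibly with the projections, isomorphic
to `U / Γ'` for some subgroup `Γ' ≤ Γ`. -/
def IsCovering {n : ℕ} {O' O : Orbifold n} (p : O' → O) : Prop :=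
  Continuous p ∧ Function.Surjective p ∧
    ∀ x : O, ∃ c : OrbifoldChart n O, O.IsChart c ∧ x ∈ Set.range c.toFun ∧
      ∀ y : O', p y ∈ Set.range c.toFun →
        ∃ (Γ' : Subgroup (c.dom ≃ₜ c.dom)) (ψ : c.dom → O') (h : IsOrbifoldChart c.dom Γ' ψ),
          Γ' ≤ c.group ∧ O'.IsChart ⟨c.dom, Γ', ψ, h⟩ ∧
          Set.range ψ = connectedComponentIn (p ⁻¹' Set.range c.toFun) y ∧
          ∀ u, p (ψ u) = c.toFun u

/-- An orbifold is good if it is covered by a manifold. -/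
def IsGood {n : ℕ} (O : Orbifold n) : Prop :=
  ∃ (O' : Orbifold n) (p : O' → O), O'.IsManifold ∧ IsCovering p

/-- An orbifold is bad if it is not covered by a manifold. -/
def IsBad {n : ℕ} (O : Orbifold n) : Prop := ¬ O.IsGood

end Orbifold

/-! ### The Borel construction -/

/-- Points `t₀g₀ ⊕ t₁g₁ ⊕ ⋯` of the infinite join `G * G * ⋯`: finitely many `tᵢ` are nonzero, they
sum to one, and `gᵢ ∈ G` is given exactly when `tᵢ ≠ 0`. This is Milnor's model of `EG`. -/
@[ext]
structure MilnorJoin (G : Type) where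
  weight : ℕ →₀ NNReal
  label : ℕ → Option G
  sum_weight : (weight.sum fun _ t => t) = 1
  label_isSome : ∀ i, (label i).isSome ↔ weight i ≠ 0

namespace MilnorJoin

/-- Milnor's topology: the coarsest one for which all `tᵢ : EG → [0, 1]` and all
`gᵢ : tᵢ⁻¹((0, 1]) → G` are continuous. -/
instance (G : Type) [TopologicalSpace G] : TopologicalSpace (MilnorJoin G) :=
  TopologicalSpace.generateFrom
    ({s | ∃ (i : ℕ) (V : Set NNReal), IsOpen V ∧ s = {x | x.weight i ∈ V}} ∪
      {s | ∃ (i : ℕ) (V : Set G), IsOpen V ∧ s = {x | ∃ g ∈ V, x.label i = some g}})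

/-- The free action of `G` on `EG` by left multiplication of the labels. -/
instance (G : Type) [Group G] : MulAction G (MilnorJoin G) where
  smul g x :=
    { weight := x.weight
      label := fun i => (x.label i).map (g * ·)
      sum_weight := x.sum_weight
      label_isSome := fun i => by simpa using x.label_isSome i }
  one_smul x := by
    apply MilnorJoin.ext
    · rfl
    · funext i
      change (x.label i).map (fun a => 1 * a) = x.label i
      simp
  mul_smul g h x := by
    apply MilnorJoin.ext
    · rfl
    · funext i
      change (x.label i).map (fun a => g * h * a) =
        ((x.label i).map (fun a => h * a)).map (fun a => g * a)
      simp [Function.comp_def, mul_assoc]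

end MilnorJoin

/-- The Borel construction `M ×_G EG`, the quotient of `M × EG` by the diagonal action of `G`. -/
abbrev BorelConstruction (G M : Type) [Group G] [TopologicalSpace G] [TopologicalSpace M]
    [MulAction G M] : Type :=
  MulAction.orbitRel.Quotient G (M × MilnorJoin G)

/-- A topological space is `k`-connected if it is nonempty and its homotopy groups (sets) in degrees
`0, …, k` are trivial for all base points. -/
def IsKConnectedSpace (k : ℕ) (X : Type) [TopologicalSpace X] : Prop :=
  Nonempty X ∧ ∀ x : X, ∀ i ≤ k, Subsingleton (HomotopyGroup.Pi i X x)

/-! ### Orbifolds as quotients by almost free actions -/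

/-- The orbifold `O` is the quotient of the smooth manifold `M` by a smooth almost free action of
the compact Lie group `G`, with projection `q : M → O`. The orbifold charts of `M / G` are given by
slices: a slice through a point of the orbit of `x`, with the finite isotropy group acting on it, is
here parametrized by a map `s : U → M` from the domain of a chart, and the field `slice` says that
`G ×_Γ U → M`, `[g, u] ↦ g • s u`, is an equivariant diffeomorphism onto an open subset. -/
structure IsAlmostFreeQuotient (d m : ℕ) {n : ℕ} (G M : Type) [Group G] [TopologicalSpace G]
    [ChartedSpace (EuclideanSpace ℝ (Fin d)) G] [TopologicalSpace M]
    [ChartedSpace (EuclideanSpace ℝ (Fin m)) M] [MulAction G M] (O : Orbifold n) (q : M → O) :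
    Prop where
  lieGroup : LieGroup (𝓡 d) ∞ G
  compactGroup : CompactSpace G
  isManifold : IsManifold (𝓡 m) ∞ M
  t2 : T2Space M
  secondCountable : SecondCountableTopology M
  smooth_smul : ContMDiff ((𝓡 d).prod (𝓡 m)) (𝓡 m) ∞ fun z : G × M => z.1 • z.2
  almostFree : ∀ x : M, Finite (MulAction.stabilizer G x)
  isQuotientMap : Topology.IsQuotientMap q
  orbits : ∀ x y : M, q x = q y ↔ ∃ g : G, g • x = y
  slice : ∀ x : M, ∃ c : OrbifoldChart n O, O.IsChart c ∧ q x ∈ Set.range c.toFun ∧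
    ∃ (j : c.group →* G) (s : c.dom → M),
      Function.Injective j ∧
      (∀ u, q (s u) = c.toFun u) ∧
      (∀ (γ : c.group) (u : c.dom), s (γ.1 u) = j γ • s u) ∧
      (∀ (g : G) (u v : c.dom), g • s u = s v → ∃ γ : c.group, j γ = g ∧ γ.1 u = v) ∧
      IsLocalDiffeomorph ((𝓡 d).prod (𝓡 n)) (𝓡 m) ∞ fun z : G × c.dom => z.1 • s z.2

/-- An orbifold `O` is `k`-connected if its classifying space `BO` is, where `BO = M ×_G EG` for a
presentation `O = M / G` as the quotient of a manifold by an almost free action of a compact Lie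
group. (The homotopy type of `BO` does not depend on the presentation.) -/
def Orbifold.IsKConnected {n : ℕ} (k : ℕ) (O : Orbifold n) : Prop :=
  ∃ (d m : ℕ) (G M : Type) (_ : Group G) (_ : TopologicalSpace G)
    (_ : ChartedSpace (EuclideanSpace ℝ (Fin d)) G) (_ : TopologicalSpace M)
    (_ : ChartedSpace (EuclideanSpace ℝ (Fin m)) M) (_ : MulAction G M) (q : M → O),
    IsAlmostFreeQuotient d m G M O q ∧ IsKConnectedSpace k (BorelConstruction G M)

/-! ### The group `SU(2)` and the unit sphere of a unitary representation -/

/-- The group `SU(2)`. -/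
abbrev SU2 : Type := Matrix.specialUnitaryGroup (Fin 2) ℂ

/-- Complex Euclidean space `ℂ^k` with its standard Hermitian norm. -/
abbrev Cn (k : ℕ) : Type := EuclideanSpace ℂ (Fin k)

instance finrank_real_C2 : Fact (Module.finrank ℝ (Cn 2) = 3 + 1) :=
  ⟨by rw [← Module.finrank_mul_finrank ℝ ℂ (Cn 2)]; simp⟩

instance finrank_real_C4 : Fact (Module.finrank ℝ (Cn 4) = 7 + 1) :=
  ⟨by rw [← Module.finrank_mul_finrank ℝ ℂ (Cn 4)]; simp⟩

theorem SU2.entries (g : SU2) :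
    g.1 0 1 = -star (g.1 1 0) ∧ g.1 1 1 = star (g.1 0 0) := by
  obtain ⟨A, hA⟩ := g
  obtain ⟨hU, hdet⟩ := Matrix.mem_specialUnitaryGroup_iff.1 hA
  have h1 : A.adjugate = star A := by
    have h2 : A * star A = 1 := Matrix.mem_unitaryGroup_iff.1 hU
    have h3 : A.adjugate * A = 1 := by rw [Matrix.adjugate_mul, hdet, one_smul]
    exact left_inv_eq_right_inv h3 h2
  rw [Matrix.adjugate_fin_two] at h1
  have h00 := congrFun (congrFun h1 0) 0
  have h01 := congrFun (congrFun h1 0) 1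
  simp [Matrix.star_apply] at h00 h01
  exact ⟨by simpa using congrArg (fun z => -z) h01, by simpa using h00⟩

theorem SU2.norm_first_column (g : SU2) : ‖(!₂[g.1 0 0, g.1 1 0] : Cn 2)‖ = 1 := by
  have h := g.2.2
  have hd : g.1.det = 1 := h
  rw [Matrix.det_fin_two, (SU2.entries g).1, (SU2.entries g).2] at hd
  have h1 : ((‖g.1 0 0‖ ^ 2 + ‖g.1 1 0‖ ^ 2 : ℝ) : ℂ) = 1 := by
    push_cast
    rw [← Complex.mul_conj', ← Complex.mul_conj', ← hd]
    simp only [RCLike.star_def]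
    ring
  rw [EuclideanSpace.norm_eq]
  simp only [Fin.sum_univ_two]
  simpa using (by exact_mod_cast h1 : ‖g.1 0 0‖ ^ 2 + ‖g.1 1 0‖ ^ 2 = 1)

theorem SU2.ofSphere_mem (x : Metric.sphere (0 : Cn 2) 1) :
    !![x.1 0, -star (x.1 1); x.1 1, star (x.1 0)] ∈ Matrix.specialUnitaryGroup (Fin 2) ℂ := by
  have hx : ‖x.1‖ = 1 := mem_sphere_zero_iff_norm.1 x.2
  rw [EuclideanSpace.norm_eq, Real.sqrt_eq_one, Fin.sum_univ_two] at hx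
  have h1 : x.1 0 * star (x.1 0) + x.1 1 * star (x.1 1) = 1 := by
    simp only [RCLike.star_def]
    rw [Complex.mul_conj', Complex.mul_conj']
    exact_mod_cast hx
  rw [Matrix.mem_specialUnitaryGroup_iff, Matrix.mem_unitaryGroup_iff, Matrix.det_fin_two]
  refine ⟨?_, ?_⟩
  · ext i j
    fin_cases i <;> fin_cases j <;>
      simp [Matrix.mul_apply, Fin.sum_univ_two, Matrix.star_apply] <;>
      first
        | (simp only [RCLike.star_def] at h1; linear_combination h1)
        | ring
  · simp
    simp only [RCLike.star_def] at h1
    linear_combination h1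

/-- The homeomorphism `SU(2) ≅ S³ ⊆ ℂ²` that sends a matrix to its first column. -/
noncomputable def SU2.homeoSphere : SU2 ≃ₜ Metric.sphere (0 : Cn 2) 1 where
  toFun g := ⟨!₂[g.1 0 0, g.1 1 0], mem_sphere_zero_iff_norm.2 (SU2.norm_first_column g)⟩
  invFun x := ⟨!![x.1 0, -star (x.1 1); x.1 1, star (x.1 0)], SU2.ofSphere_mem x⟩
  left_inv g := by
    apply Subtype.ext
    ext i j
    have h := SU2.entries g
    fin_cases i <;> fin_cases j <;> simp [h.1, h.2]
  right_inv x := by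
    apply Subtype.ext
    ext i
    fin_cases i <;> simp
  continuous_toFun := by
    refine Continuous.subtype_mk ?_ _
    refine (PiLp.continuous_toLp 2 _).comp (continuous_pi fun i => ?_)
    fin_cases i
    · exact continuous_subtype_val.matrix_elem 0 0
    · exact continuous_subtype_val.matrix_elem 1 0
  continuous_invFun := by
    refine Continuous.subtype_mk (continuous_matrix fun i j => ?_) _
    fin_cases i <;> fin_cases j <;> simp <;> fun_prop

/-- The manifold structure of `SU(2)`, transported from `S³`. -/
noncomputable instance : ChartedSpace (EuclideanSpace ℝ (Fin 3)) SU2 :=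
  letI : ChartedSpace (Metric.sphere (0 : Cn 2) 1) SU2 :=
    SU2.homeoSphere.toOpenPartialHomeomorph.singletonChartedSpace rfl
  ChartedSpace.comp (EuclideanSpace ℝ (Fin 3)) (Metric.sphere (0 : Cn 2) 1) SU2

/-- The unit sphere `S⁷ ⊆ ℂ⁴`, as the space on which `SU(2)` acts through the unitary
representation `ρ`. -/
def RepSphere (_ρ : SU2 →* (Cn 4 ≃ₗᵢ[ℂ] Cn 4)) : Type := Metric.sphere (0 : Cn 4) 1

namespace RepSphere

variable (ρ : SU2 →* (Cn 4 ≃ₗᵢ[ℂ] Cn 4))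

instance : TopologicalSpace (RepSphere ρ) :=
  inferInstanceAs (TopologicalSpace (Metric.sphere (0 : Cn 4) 1))

noncomputable instance : ChartedSpace (EuclideanSpace ℝ (Fin 7)) (RepSphere ρ) :=
  inferInstanceAs (ChartedSpace (EuclideanSpace ℝ (Fin 7)) (Metric.sphere (0 : Cn 4) 1))

noncomputable instance : MulAction SU2 (RepSphere ρ) where
  smul g x := ⟨ρ g x.1, by simpa using x.2⟩
  one_smul x := Subtype.ext (by change ρ 1 x.1 = x.1; simp)
  mul_smul g h x := Subtype.ext (by change ρ (g * h) x.1 = ρ g (ρ h x.1); simp)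

end RepSphere

/-!
The representation is `ρ = Sym³ ℂ²`, the action of `SU(2)` on binary cubic forms, written in an
orthonormal basis (`cubicMatrix`, `cubicRep`). The torus of `SU(2)` acts with the weights
`3, 1, -1, -3`, so the cube of a linear form (`cusp`) has isotropy group `ℤ/3`, and the forms
with coordinates `(x₀, x₁, 0, 0)`, `x₁ ≠ 0`, which have a root of multiplicity exactly two, have
trivial isotropy (`cubicRep_fixed_regular`).

*Orbifold structure.* The polynomial map `cubicMatrix` extends the action of `SU(2)` to an action of
the quaternions, `quatAct`, which is homogeneous of degree three. The derivative `orbitDeriv x` of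
the orbit map of a form `x ≠ 0` at the quaternion `1` is injective, because a determinant is a
positive sum of squares (`det_cubicDeriv_ne_zero`). The orthogonal complement `normalSpace x` of its
image is therefore a four-dimensional real space, and the inverse function theorem on
`ℍ × normalSpace x` (`exists_tubeMap_inverse`), followed by radial projection to the spheres, shows that
`(g, v) ↦ g • slice x v` is a local diffeomorphism `SU(2) × ℝ⁴ → S⁷` at `(1, 0)`
(`exists_tube_inverse`). It follows that the isotropy groups are finite. The isotropy group of `x`
acts linearly on the normal space (`normalMap`), and faithfully since a nontrivial element of `SU(2)`
fixes at most a complex plane (`eq_one_of_finrank_fixed`). Compactness of `SU(2)` gives slices of a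
uniform size (`exists_sliceRadius`), whose coordinate changes are read off from the local inverses
of the tube maps (`compatible_sliceChart`).

*Connectedness.* The projection `S⁷ × EG → S⁷ ×_G EG` is a principal bundle, with local sections given
by Milnor's labels (`isPrincipal_borelConstruction`). Maps of cubes of dimension at most three into
the base lift to the total space, the boundary goes to one orbit, a copy of `S³ ≅ SU(2)`, and the lift
can be corrected to be constant on the boundary, because a map from a closed subset of
`ℝᵏ`, `k ≤ n`, to `Sⁿ` extends to `ℝᵏ` (`extendsFrom_sphere`). The total space is as highly connected as `S⁷`, since
`EG` is contractible. This gives `IsPrincipal.subsingleton_homotopyGroup`.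

*Badness.* The line of forms `(z, 1, 0, 0)`, `z ∈ ℂ`, maps to a teardrop minus its cone point: all its
points are regular, and it closes up at the cusp, where the isotropy group `ℤ/3` rotates a small disc
`t ↦ (1, t, 0, 0)` by the third roots of unity. An orbifold covering `p` by a manifold would be an
honest covering over the regular points (`isCoveringMapOn_regularSet`), so the line would lift
(`exists_lift_line`). Near the cusp, uniqueness of lifts identifies the lift with the
disc in a chart of the covering. The parameters `t` and `ω t`, with `ω³ = 1`, give the same point
of the line, hence the same point of the lift, but the chart is injective on the disc near its centre,
as the local groups of a manifold are trivial: contradiction (`isBad_cubicOrbifold`).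
-/

/-! ### Milnor's model of `EG` -/

namespace MilnorJoin

open Topology Set unitInterval

section Coordinates

variable {G : Type}

/-- The open set of points whose `i`-th weight is nonzero. -/
def support (G : Type) (i : ℕ) : Set (MilnorJoin G) := {x | x.weight i ≠ 0}

theorem exists_mem_support (x : MilnorJoin G) : ∃ i, x ∈ support G i := by
  by_contra! h
  have h0 : x.weight = 0 := by
    ext i
    have := h i
    simp only [support, mem_ofPred_eq, not_not] at this
    simp [this]
  have := x.sum_weight
  simp [h0] at this

/-- The label `gᵢ` of a point with `tᵢ ≠ 0`. -/
def coord (i : ℕ) (x : support G i) : G :=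
  (x.1.label i).get ((x.1.label_isSome i).2 x.2)

theorem label_eq_some_coord (i : ℕ) (x : support G i) : x.1.label i = some (coord i x) := by
  simp [coord]

theorem hasSum_weight (x : MilnorJoin G) : HasSum x.weight 1 := by
  have h := x.sum_weight
  rw [Finsupp.sum] at h
  rw [← h]
  exact hasSum_sum_of_ne_finset_zero fun i hi => by simpa using hi

theorem sum_ofSupportFinite {w : ℕ → NNReal} (hw : (Function.support w).Finite)
    (h : HasSum w 1) : ((Finsupp.ofSupportFinite w hw).sum fun _ t => t) = 1 := by
  have h1 : HasSum w (∑ i ∈ (Finsupp.ofSupportFinite w hw).support, w i) :=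
    hasSum_sum_of_ne_finset_zero fun i hi => by simpa [Finsupp.ofSupportFinite_coe] using hi
  exact h1.unique h

/-- The moving weights of the homotopy that shifts all coordinates of `EG` by one: the `i`-th
coordinate moves back from position `i + 1` to position `i` as `s` runs through
`[i / (i + 1), (i + 1) / (i + 2)]`. -/
noncomputable def shiftWeight (i : ℕ) (s : I) : NNReal :=
  Real.toNNReal (min 1 ((s : ℝ) * ((i + 1) * (i + 2)) - i * (i + 2)))

theorem continuous_shiftWeight (i : ℕ) : Continuous (shiftWeight i) := by
  unfold shiftWeight; fun_prop

theorem shiftWeight_le_one (i : ℕ) (s : I) : shiftWeight i s ≤ 1 := by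
  simp [shiftWeight, Real.toNNReal_le_iff_le_coe]

theorem shiftWeight_zero (i : ℕ) : shiftWeight i 0 = 0 := by
  simp only [shiftWeight, Real.toNNReal_eq_zero]
  refine min_le_of_right_le ?_
  have : (0 : ℝ) ≤ i * (i + 2) := by positivity
  simpa using this

theorem shiftWeight_one (i : ℕ) : shiftWeight i 1 = 1 := by
  simp only [shiftWeight, Real.toNNReal_eq_one, min_eq_left_iff]
  have : (0 : ℝ) ≤ i := by positivity
  simp only [Icc.coe_one]
  nlinarith

theorem shiftWeight_eq_one {i : ℕ} {s : I} (h : shiftWeight (i + 1) s ≠ 0) :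
    shiftWeight i s = 1 := by
  simp only [shiftWeight, ne_eq, Real.toNNReal_eq_zero, not_le, lt_min_iff] at h
  simp only [shiftWeight, Real.toNNReal_eq_one, min_eq_left_iff]
  have h2 := h.2
  push_cast at h2
  have h3 : (0:ℝ) < (s : ℝ) * (i + 2) - (i + 1) := by
    by_contra! h4
    have : (0 : ℝ) ≤ i := by positivity
    nlinarith
  have : (0 : ℝ) ≤ i := by positivity
  nlinarith

/-- The weights of the shift homotopy. -/
noncomputable def shiftW (x : MilnorJoin G) (s : I) : ℕ → NNReal
  | 0 => shiftWeight 0 s * x.weight 0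
  | i + 1 => shiftWeight (i + 1) s * x.weight (i + 1) + (1 - shiftWeight i s) * x.weight i

/-- The labels of the shift homotopy. -/
noncomputable def shiftL (x : MilnorJoin G) (s : I) : ℕ → Option G
  | 0 => if shiftWeight 0 s = 0 then none else x.label 0
  | i + 1 =>
    if shiftWeight i s = 1 then (if shiftWeight (i + 1) s = 0 then none else x.label (i + 1))
    else x.label i

theorem shiftL_isSome (x : MilnorJoin G) (s : I) (i : ℕ) :
    (shiftL x s i).isSome ↔ shiftW x s i ≠ 0 := by
  cases i with
  | zero =>
    by_cases h : shiftWeight 0 s = 0 <;> simp [shiftL, shiftW, h, x.label_isSome]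
  | succ i =>
    by_cases h : shiftWeight i s = 1
    · by_cases h' : shiftWeight (i + 1) s = 0 <;> simp [shiftL, shiftW, h, h', x.label_isSome]
    · have h' : shiftWeight (i + 1) s = 0 := by
        by_contra h'
        exact h (shiftWeight_eq_one h')
      have h'' : 1 - shiftWeight i s ≠ 0 := by
        rw [ne_eq, tsub_eq_zero_iff_le]
        exact fun h2 => h (le_antisymm (shiftWeight_le_one i s) h2)
      simp [shiftL, shiftW, h, h', h'', x.label_isSome]

theorem hasSum_nat_cons {f : ℕ → NNReal} {a : NNReal} (h : HasSum f a) :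
    HasSum (fun i : ℕ => if i = 0 then 0 else f (i - 1)) a := by
  have h1 : HasSum (fun i : ℕ => if i = 0 then 0 else f (i - 1)) _ :=
    HasSum.zero_add (m := a) (by simpa using h)
  simpa using h1

theorem hasSum_shiftW (x : MilnorJoin G) (s : I) : HasSum (shiftW x s) 1 := by
  have h1 : HasSum (fun i => (shiftWeight i s) * x.weight i + (1 - shiftWeight i s) * x.weight i)
      1 := by
    convert x.hasSum_weight using 2 with i
    rw [← add_mul, add_tsub_cancel_of_le (shiftWeight_le_one i s), one_mul]
  have ha : Summable fun i => shiftWeight i s * x.weight i :=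
    NNReal.summable_of_le (fun i => by
      have := mul_le_mul_left (shiftWeight_le_one i s) (x.weight i)
      simpa using this) x.hasSum_weight.summable
  have hb : Summable fun i => (1 - shiftWeight i s) * x.weight i :=
    NNReal.summable_of_le (fun i => by
      have := mul_le_mul_left (tsub_le_self : 1 - shiftWeight i s ≤ 1) (x.weight i)
      simpa using this) x.hasSum_weight.summable
  have hsum : (∑' i, shiftWeight i s * x.weight i) + (∑' i, (1 - shiftWeight i s) * x.weight i)
      = 1 := by
    rw [← ha.tsum_add hb]; exact h1.tsum_eq
  have hb' := hasSum_nat_cons hb.hasSum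
  have := ha.hasSum.add hb'
  rw [hsum] at this
  convert this using 1
  funext i
  cases i <;> simp [shiftW]

theorem finite_support_shiftW (x : MilnorJoin G) (s : I) :
    (Function.support (shiftW x s)).Finite := by
  refine ((x.weight.hasFiniteSupport).union ((x.weight.hasFiniteSupport).image Nat.succ)).subset ?_
  intro i hi
  by_contra! h
  simp only [mem_union, Function.mem_support, not_or, not_not, mem_image, not_exists, not_and] at h
  refine hi ?_
  cases i with
  | zero => simp [shiftW, h.1]
  | succ i =>
    have : x.weight i = 0 := by
      by_contra h'
      exact h.2 i h' rfl
    simp [shiftW, h.1, this]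

end Coordinates

section Topology

variable {G : Type} [TopologicalSpace G]

theorem isOpen_weight (i : ℕ) {V : Set NNReal} (hV : IsOpen V) :
    IsOpen {x : MilnorJoin G | x.weight i ∈ V} :=
  TopologicalSpace.isOpen_generateFrom_of_mem (Or.inl ⟨i, V, hV, rfl⟩)

theorem isOpen_label (i : ℕ) {V : Set G} (hV : IsOpen V) :
    IsOpen {x : MilnorJoin G | ∃ g ∈ V, x.label i = some g} :=
  TopologicalSpace.isOpen_generateFrom_of_mem (Or.inr ⟨i, V, hV, rfl⟩)

theorem continuous_weight (i : ℕ) : Continuous fun x : MilnorJoin G => x.weight i :=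
  continuous_def.2 fun _ hV => isOpen_weight i hV

theorem continuous_mk {X : Type*} [TopologicalSpace X] {f : X → MilnorJoin G}
    (hw : ∀ i, Continuous fun x => (f x).weight i)
    (hl : ∀ i (V : Set G), IsOpen V → IsOpen {x | ∃ g ∈ V, (f x).label i = some g}) :
    Continuous f := by
  refine continuous_generateFrom_iff.2 ?_
  rintro s (⟨i, V, hV, rfl⟩ | ⟨i, V, hV, rfl⟩)
  · exact hV.preimage (hw i)
  · exact hl i V hV

theorem isOpen_support (i : ℕ) : IsOpen (support G i) :=
  isOpen_weight i (V := {0}ᶜ) isClosed_singleton.isOpen_compl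

theorem continuous_coord (i : ℕ) : Continuous (coord (G := G) i) := by
  refine continuous_def.2 fun V hV => ?_
  convert (isOpen_label i hV).preimage (continuous_subtype_val (p := (· ∈ support G i))) using 1
  ext x
  simp [label_eq_some_coord]

end Topology

section Action

variable {G : Type} [Group G]

@[simp] theorem smul_weight (g : G) (x : MilnorJoin G) : (g • x).weight = x.weight := rfl

@[simp] theorem smul_label (g : G) (x : MilnorJoin G) (i : ℕ) :
    (g • x).label i = (x.label i).map (g * ·) := rfl

theorem coord_smul {i : ℕ} (g : G) (x : support G i) :
    coord i ⟨g • x.1, x.2⟩ = g * coord i x := by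
  have h := label_eq_some_coord i ⟨g • x.1, x.2⟩
  rw [smul_label, label_eq_some_coord i x, Option.map_some] at h
  exact (Option.some_injective _ h).symm

instance [TopologicalSpace G] [IsTopologicalGroup G] : ContinuousSMul G (MilnorJoin G) where
  continuous_smul := by
    refine continuous_mk (fun i => ?_) fun i V hV => ?_
    · change Continuous fun z : G × MilnorJoin G => z.2.weight i
      exact (continuous_weight i).comp continuous_snd
    have hc : Continuous fun z : {z : G × MilnorJoin G | z.2 ∈ support G i} =>
        z.1.1 * coord i ⟨z.1.2, z.2⟩ :=
      (continuous_fst.comp continuous_subtype_val).mul ((continuous_coord i).comp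
        ((continuous_snd.comp continuous_subtype_val).subtype_mk _))
    have ho : IsOpen {z : G × MilnorJoin G | z.2 ∈ support G i} :=
      (isOpen_support i).preimage continuous_snd
    convert ho.isOpenMap_subtype_val _ (hV.preimage hc) using 1
    ext ⟨g, x⟩
    simp only [mem_ofPred_eq, smul_label, mem_image, mem_preimage, Subtype.exists, exists_and_right,
      exists_eq_right]
    constructor
    · rintro ⟨k, hk, he⟩
      have hx : x ∈ support G i := by
        refine (x.label_isSome i).1 ?_
        cases h : x.label i
        · simp [h] at he
        · rfl
      refine ⟨hx, ?_⟩
      rw [label_eq_some_coord i ⟨x, hx⟩, Option.map_some] at he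
      rwa [Option.some_injective _ he]
    · rintro ⟨hx, hV⟩
      exact ⟨_, hV, by rw [label_eq_some_coord i ⟨x, hx⟩, Option.map_some]⟩

end Action

section Contractible

variable {G : Type}

/-- The homotopy from the shift `(g₀t₀, g₁t₁, …) ↦ (0, g₀t₀, g₁t₁, …)` to the identity. -/
noncomputable def shift (z : MilnorJoin G × I) : MilnorJoin G where
  weight := Finsupp.ofSupportFinite _ (finite_support_shiftW z.1 z.2)
  label := shiftL z.1 z.2
  sum_weight := sum_ofSupportFinite _ (hasSum_shiftW z.1 z.2)
  label_isSome i := shiftL_isSome z.1 z.2 i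

theorem shift_weight (z : MilnorJoin G × I) (i : ℕ) : (shift z).weight i = shiftW z.1 z.2 i := rfl

theorem continuous_shift [TopologicalSpace G] : Continuous (shift (G := G)) := by
  refine continuous_mk (fun i => ?_) fun i V hV => ?_
  · simp only [shift_weight]
    cases i with
    | zero =>
      exact ((continuous_shiftWeight 0).comp continuous_snd).mul
        ((continuous_weight 0).comp continuous_fst)
    | succ i =>
      exact (((continuous_shiftWeight _).comp continuous_snd).mul
        ((continuous_weight _).comp continuous_fst)).add
        ((continuous_const.sub ((continuous_shiftWeight _).comp continuous_snd)).mul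
        ((continuous_weight _).comp continuous_fst))
  · have hz : ∀ j, IsOpen {z : MilnorJoin G × I | shiftWeight j z.2 ≠ 0} := fun j =>
      isOpen_ne.preimage ((continuous_shiftWeight j).comp continuous_snd)
    have ho : ∀ j, IsOpen {z : MilnorJoin G × I | shiftWeight j z.2 ≠ 1} := fun j =>
      isOpen_ne.preimage ((continuous_shiftWeight j).comp continuous_snd)
    have hl : ∀ j, IsOpen {z : MilnorJoin G × I | ∃ g ∈ V, z.1.label j = some g} := fun j =>
      (isOpen_label j hV).preimage continuous_fst
    cases i with
    | zero =>
      convert (hz 0).inter (hl 0) using 1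
      ext z
      by_cases h : shiftWeight 0 z.2 = 0 <;> simp [shift, shiftL, h]
    | succ i =>
      convert ((hz (i + 1)).inter (hl (i + 1))).union ((ho i).inter (hl i)) using 1
      ext z
      by_cases h : shiftWeight i z.2 = 1
      · by_cases h' : shiftWeight (i + 1) z.2 = 0 <;> simp [shift, shiftL, h, h']
      · have h' : shiftWeight (i + 1) z.2 = 0 := by
          by_contra h'
          exact h (shiftWeight_eq_one h')
        simp [shift, shiftL, h, h']

theorem shift_one (x : MilnorJoin G) : shift (x, 1) = x := by
  apply MilnorJoin.ext
  · ext i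
    rw [shift_weight]
    cases i <;> simp [shiftW, shiftWeight_one]
  · funext i
    cases i <;> simp [shift, shiftL, shiftWeight_one]

/-- The weights of the homotopy that joins a shifted point to the vertex `1` at position `0`. -/
noncomputable def coneW (x : MilnorJoin G) (s : I) : ℕ → NNReal
  | 0 => (Real.toNNReal (1 - s))
  | i + 1 => Real.toNNReal s * x.weight i

/-- The labels of the homotopy that joins a shifted point to the vertex `1` at position `0`. -/
noncomputable def coneL [Group G] (x : MilnorJoin G) (s : I) : ℕ → Option G
  | 0 => if s = 1 then none else some 1
  | i + 1 => if s = 0 then none else x.label i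

theorem toNNReal_eq_zero_iff (s : I) : Real.toNNReal s = 0 ↔ s = 0 := by
  rw [Real.toNNReal_eq_zero]
  constructor
  · exact fun h => Subtype.ext (le_antisymm h s.2.1)
  · rintro rfl; simp

theorem toNNReal_one_sub_eq_zero_iff (s : I) : Real.toNNReal (1 - s) = 0 ↔ s = 1 := by
  rw [Real.toNNReal_eq_zero, sub_nonpos]
  constructor
  · exact fun h => Subtype.ext (le_antisymm s.2.2 h)
  · rintro rfl; simp

theorem finite_support_coneW (x : MilnorJoin G) (s : I) :
    (Function.support (coneW x s)).Finite := by
  refine ((finite_singleton 0).union (x.weight.hasFiniteSupport.image Nat.succ)).subset ?_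
  intro i hi
  cases i with
  | zero => exact Or.inl rfl
  | succ i =>
    refine Or.inr ⟨i, fun h => hi ?_, rfl⟩
    simp [coneW, h]

theorem hasSum_coneW (x : MilnorJoin G) (s : I) : HasSum (coneW x s) 1 := by
  have h1 : HasSum (coneW x s) _ := HasSum.zero_add (x.hasSum_weight.mul_left (Real.toNNReal s))
  convert h1 using 1
  rw [mul_one]
  simp only [coneW]
  rw [← Real.toNNReal_add (by linarith [s.2.2]) s.2.1]
  simp

theorem coneL_isSome [Group G] (x : MilnorJoin G) (s : I) (i : ℕ) :
    (coneL x s i).isSome ↔ coneW x s i ≠ 0 := by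
  cases i with
  | zero =>
    rw [coneW, ne_eq, toNNReal_one_sub_eq_zero_iff]
    by_cases h : s = 1 <;> simp [coneL, h]
  | succ i =>
    rw [coneW, mul_ne_zero_iff, ne_eq, toNNReal_eq_zero_iff]
    by_cases h : s = 0 <;> simp [coneL, h, x.label_isSome]

/-- The homotopy from the constant map at the vertex `1` at position `0` to the shift. -/
noncomputable def cone [Group G] (z : MilnorJoin G × I) : MilnorJoin G where
  weight := Finsupp.ofSupportFinite _ (finite_support_coneW z.1 z.2)
  label := coneL z.1 z.2
  sum_weight := sum_ofSupportFinite _ (hasSum_coneW z.1 z.2)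
  label_isSome i := coneL_isSome z.1 z.2 i

theorem cone_weight [Group G] (z : MilnorJoin G × I) (i : ℕ) :
    (cone z).weight i = coneW z.1 z.2 i := rfl

theorem continuous_cone [TopologicalSpace G] [Group G] : Continuous (cone (G := G)) := by
  refine continuous_mk (fun i => ?_) fun i V hV => ?_
  · simp only [cone_weight]
    cases i with
    | zero => simp only [coneW]; fun_prop
    | succ i =>
      exact (continuous_real_toNNReal.comp (continuous_subtype_val.comp continuous_snd)).mul
        ((continuous_weight _).comp continuous_fst)
  · cases i with
    | zero =>
      by_cases h1 : (1 : G) ∈ V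
      · convert (isOpen_ne (x := (1 : I))).preimage
          (continuous_snd (X := MilnorJoin G)) using 1
        ext z
        by_cases h : z.2 = 1 <;> simp [cone, coneL, h, h1]
      · convert isOpen_empty
        ext z
        by_cases h : z.2 = 1 <;> simp [cone, coneL, h1]
    | succ i =>
      convert ((isOpen_ne (x := (0 : I))).preimage
          (continuous_snd (X := MilnorJoin G))).inter
          ((isOpen_label i hV).preimage continuous_fst) using 1
      ext z
      by_cases h : z.2 = 0 <;> simp [cone, coneL, h]

theorem cone_one [Group G] (x : MilnorJoin G) : cone (x, 1) = shift (x, 0) := by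
  apply MilnorJoin.ext
  · ext i
    rw [shift_weight, cone_weight]
    cases i <;> simp [shiftW, coneW, shiftWeight_zero]
  · funext i
    cases i <;> simp [shift, shiftL, cone, coneL, shiftWeight_zero]

theorem cone_zero [Group G] (x y : MilnorJoin G) : cone (x, 0) = cone (y, 0) := by
  apply MilnorJoin.ext
  · ext i
    rw [cone_weight, cone_weight]
    cases i <;> simp [coneW]
  · funext i
    cases i <;> simp [cone, coneL]

noncomputable instance [Group G] : Inhabited (MilnorJoin G) where
  default :=
    { weight := Finsupp.single 0 1
      label := fun i => if i = 0 then some 1 else none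
      sum_weight := by simp
      label_isSome := fun i => by
        by_cases h : i = 0
        · simp [h]
        · simp [h] }

/-- Milnor's space `EG` is contractible: the identity is homotopic to the shift, which leaves room
at position `0` for a cone to a vertex. -/
instance [TopologicalSpace G] [Group G] : ContractibleSpace (MilnorJoin G) := by
  rw [contractible_iff_id_nullhomotopic]
  refine ⟨cone (default, 0), ?_⟩
  have h1 : ContinuousMap.Homotopic ⟨fun x : MilnorJoin G => shift (x, 0),
      continuous_shift.comp (by fun_prop)⟩ (ContinuousMap.id _) :=
    ⟨{ toFun := fun z => shift (z.2, z.1)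
       continuous_toFun := continuous_shift.comp (by fun_prop)
       map_zero_left := fun x => rfl
       map_one_left := fun x => shift_one x }⟩
  have h2 : ContinuousMap.Homotopic (ContinuousMap.const _ (cone (default, 0)))
      ⟨fun x : MilnorJoin G => shift (x, 0), continuous_shift.comp (by fun_prop)⟩ :=
    ⟨{ toFun := fun z => cone (z.2, z.1)
       continuous_toFun := continuous_cone.comp (by fun_prop)
       map_zero_left := fun x => cone_zero _ _
       map_one_left := fun x => cone_one x }⟩
  exact (h2.trans h1).symm

end Contractible

end MilnorJoin

/-! ### Extension of maps -/

section Extension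

open Topology Set unitInterval Metric

/-- Every continuous map from `A` to `Y` extends to the whole space. The map on `A` is given as the
restriction of a function that is continuous on `A`. -/
def ExtendsFrom {E : Type*} [TopologicalSpace E] (A : Set E) (Y : Type*) [TopologicalSpace Y] :
    Prop :=
  ∀ f : E → Y, ContinuousOn f A → ∃ g : E → Y, Continuous g ∧ EqOn g f A

/-- Maps from closed subsets of `E` to the unit sphere of a space of larger dimension extend to `E`:
a continuous extension with values in the vector space is modified, where it is small, to a smooth
approximation, whose image misses a small vector `c` for reasons of dimension. -/
theorem extendsFrom_sphere {E F : Type*} [NormedAddCommGroup E] [NormedSpace ℝ E]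
    [FiniteDimensional ℝ E] [NormedAddCommGroup F] [InnerProductSpace ℝ F] [FiniteDimensional ℝ F]
    (hd : Module.finrank ℝ E < Module.finrank ℝ F) {A : Set E} (hA : IsClosed A) :
    ExtendsFrom A (sphere (0 : F) 1) := by
  intro f hf
  have hfn : ∀ x, ‖(f x : F)‖ = 1 := fun x => mem_sphere_zero_iff_norm.1 (f x).2
  have hf' : Continuous (A.domRestrict fun x => (f x : F)) :=
    (continuous_subtype_val.comp_continuousOn hf).domRestrict
  obtain ⟨F₀, hF₀⟩ := ContinuousMap.exists_restrict_eq hA ⟨_, hf'⟩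
  have hFA : ∀ x ∈ A, F₀ x = f x := fun x hx => congrArg (fun h => h ⟨x, hx⟩) hF₀
  obtain ⟨P, hP, hPF, -⟩ := F₀.continuous.exists_contDiff_approx 1 (ε := fun _ => 1 / 8)
    continuous_const (fun _ => by norm_num)
  obtain ⟨c, hcP, hc⟩ := (hP.dense_compl_range_of_finrank_lt_finrank hd).exists_dist_lt 0
    (show (0 : ℝ) < 1 / 8 by norm_num)
  rw [dist_zero_left] at hc
  set l : E → ℝ := fun x => max 0 (min 1 (2 - 2 * ‖F₀ x‖)) with hl
  have hl0 : ∀ x, 0 ≤ l x := fun x => le_max_left _ _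
  have hl1 : ∀ x, l x ≤ 1 := fun x => max_le zero_le_one (min_le_left _ _)
  set h : E → F := fun x => F₀ x + l x • (P x - c - F₀ x) with hh
  have hPc := hP.continuous
  have hcont : Continuous h := by fun_prop
  have hne : ∀ x, h x ≠ 0 := by
    intro x hx
    by_cases hx2 : ‖F₀ x‖ ≤ 1 / 2
    · have : l x = 1 := by
        simp only [hl]
        rw [min_eq_left (by linarith), max_eq_right zero_le_one]
      refine hcP ⟨x, ?_⟩
      simp only [hh, this, one_smul] at hx
      rw [← sub_eq_zero, ← hx]
      abel
    · have h1 : ‖l x • (P x - c - F₀ x)‖ ≤ 1 / 4 := by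
        rw [norm_smul, Real.norm_of_nonneg (hl0 x)]
        have h2 : ‖P x - c - F₀ x‖ ≤ 1 / 4 := by
          have := hPF x
          rw [dist_eq_norm] at this
          calc ‖P x - c - F₀ x‖ = ‖(P x - F₀ x) - c‖ := by congr 1; abel
            _ ≤ ‖P x - F₀ x‖ + ‖c‖ := norm_sub_le _ _
            _ ≤ 1 / 4 := by linarith
        nlinarith [norm_nonneg (P x - c - F₀ x), hl0 x, hl1 x]
      have h3 : F₀ x = -(l x • (P x - c - F₀ x)) := eq_neg_of_add_eq_zero_left hx
      rw [h3, norm_neg] at hx2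
      linarith
  refine ⟨fun x => ⟨‖h x‖⁻¹ • h x, ?_⟩, ?_, ?_⟩
  · rw [mem_sphere_zero_iff_norm, norm_smul, norm_inv, norm_norm,
      inv_mul_cancel₀ (norm_ne_zero_iff.2 (hne x))]
  · exact Continuous.subtype_mk
      ((hcont.norm.inv₀ fun x => norm_ne_zero_iff.2 (hne x)).smul hcont) _
  · intro x hx
    have hlx : l x = 0 := by simp [hl, hFA x hx, hfn]
    have hhx : h x = f x := by simp [hh, hlx, hFA x hx]
    apply Subtype.ext
    simp [hhx, hfn]

/-- Maps from the unit sphere to a contractible space extend to the whole space, radially along a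
contraction. -/
theorem extendsFrom_of_contractible {E : Type*} [NormedAddCommGroup E] [NormedSpace ℝ E]
    {Y : Type*} [TopologicalSpace Y] [ContractibleSpace Y] :
    ExtendsFrom (sphere (0 : E) 1) Y := by
  intro f hf
  obtain ⟨y₀, ⟨H⟩⟩ := (contractible_iff_id_nullhomotopic Y).1 inferInstance
  refine ⟨fun x => if 1 / 2 ≤ ‖x‖ then
    H (projIcc (0 : ℝ) 1 zero_le_one (2 - 2 * ‖x‖), f (‖x‖⁻¹ • x)) else y₀, ?_, ?_⟩
  · refine continuous_if_le continuous_const continuous_norm ?_ continuousOn_const ?_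
    · refine H.continuous.comp_continuousOn (ContinuousOn.prodMk (by fun_prop) ?_)
      refine hf.comp ?_ ?_
      · refine ContinuousOn.smul (continuous_norm.continuousOn.inv₀ ?_) continuousOn_id
        intro x hx hx0
        simp only [mem_ofPred_eq, hx0] at hx
        norm_num at hx
      · intro x hx
        have : ‖x‖ ≠ 0 := by
          intro hx0
          simp only [mem_ofPred_eq, hx0] at hx
          norm_num at hx
        rw [mem_sphere_zero_iff_norm, norm_smul, norm_inv, norm_norm, inv_mul_cancel₀ this]
    · intro x hx
      have : projIcc (0 : ℝ) 1 zero_le_one (2 - 2 * ‖x‖) = 1 := by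
        rw [← hx]; norm_num [projIcc]
      rw [this]
      simp
  · intro x hx
    rw [mem_sphere_zero_iff_norm] at hx
    simp only [hx]
    norm_num

theorem ExtendsFrom.of_homeomorph {E : Type*} [TopologicalSpace E] {A : Set E} {Y Y' : Type*}
    [TopologicalSpace Y] [TopologicalSpace Y'] (h : ExtendsFrom A Y) (e : Y' ≃ₜ Y) :
    ExtendsFrom A Y' := by
  intro f hf
  obtain ⟨g, hg, hgf⟩ := h (e ∘ f) (e.continuous.comp_continuousOn hf)
  exact ⟨e.symm ∘ g, e.symm.continuous.comp hg, fun x hx => by simp [hgf hx]⟩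

theorem ExtendsFrom.prod {E : Type*} [TopologicalSpace E] {A : Set E} {Y Y' : Type*}
    [TopologicalSpace Y] [TopologicalSpace Y'] (h : ExtendsFrom A Y) (h' : ExtendsFrom A Y') :
    ExtendsFrom A (Y × Y') := by
  intro f hf
  obtain ⟨g, hg, hgf⟩ := h (fun x => (f x).1) (continuous_fst.comp_continuousOn hf)
  obtain ⟨g', hg', hgf'⟩ := h' (fun x => (f x).2) (continuous_snd.comp_continuousOn hf)
  exact ⟨fun x => (g x, g' x), hg.prodMk hg', fun x hx => Prod.ext (hgf hx) (hgf' hx)⟩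

end Extension

/-! ### Lifting cubes through principal bundles -/

section Principal

open Topology Set unitInterval Metric

/-- A principal `G`-bundle: the fibres are the orbits of a free action whose difference map is
continuous (stated through maps into `Z`), and there are local sections. -/
structure IsPrincipal (G : Type) {Z B : Type} [Group G] [TopologicalSpace G] [TopologicalSpace Z]
    [TopologicalSpace B] [MulAction G Z] (π : Z → B) : Prop where
  continuous : Continuous π
  smul : ∀ (g : G) (z : Z), π (g • z) = π z
  section' : ∀ b : B, ∃ U : Set B, IsOpen U ∧ b ∈ U ∧
    ∃ s : B → Z, ContinuousOn s U ∧ ∀ b' ∈ U, π (s b') = b'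
  difference : ∀ (X : Type) [TopologicalSpace X] (f₁ f₂ : X → Z), Continuous f₁ → Continuous f₂ →
    (∀ x, π (f₁ x) = π (f₂ x)) → ∃ δ : X → G, Continuous δ ∧ ∀ x, f₁ x = δ x • f₂ x

namespace IsPrincipal

variable {G Z B : Type} [Group G] [TopologicalSpace G] [TopologicalSpace Z]
  [TopologicalSpace B] [MulAction G Z] [ContinuousSMul G Z] {π : Z → B}

/-- Lifts over two boxes with a common face are glued after translating one of them by the
difference of the two lifts on that face. -/
theorem lift_glue (hπ : IsPrincipal G π) {k : ℕ} {f : (Fin k → ℝ) → B} {a b : Fin k → ℝ}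
    (i : Fin k) {m : ℝ} (hm : m ∈ Icc (a i) (b i)) {F₁ F₂ : (Fin k → ℝ) → Z}
    (h₁ : ContinuousOn F₁ (Icc a (Function.update b i m)))
    (h₁' : ∀ x ∈ Icc a (Function.update b i m), π (F₁ x) = f x)
    (h₂ : ContinuousOn F₂ (Icc (Function.update a i m) b))
    (h₂' : ∀ x ∈ Icc (Function.update a i m) b, π (F₂ x) = f x) :
    ∃ F : (Fin k → ℝ) → Z, ContinuousOn F (Icc a b) ∧ ∀ x ∈ Icc a b, π (F x) = f x := by
  classical
  set J₁ := Icc a (Function.update b i m)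
  set J₂ := Icc (Function.update a i m) b
  have hJ₁ : ∀ x, x ∈ J₁ ↔ x ∈ Icc a b ∧ x i ≤ m := by
    intro x
    simp only [J₁, mem_Icc, le_update_iff]
    constructor
    · rintro ⟨h1, h2, h3⟩
      refine ⟨⟨h1, fun j => ?_⟩, h2⟩
      by_cases hj : j = i
      · subst hj; exact h2.trans hm.2
      · exact h3 j hj
    · rintro ⟨⟨h1, h2⟩, h3⟩
      exact ⟨h1, h3, fun j _ => h2 j⟩
  have hJ₂ : ∀ x, x ∈ J₂ ↔ x ∈ Icc a b ∧ m ≤ x i := by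
    intro x
    simp only [J₂, mem_Icc, update_le_iff]
    constructor
    · rintro ⟨⟨h2, h3⟩, h1⟩
      refine ⟨⟨fun j => ?_, h1⟩, h2⟩
      by_cases hj : j = i
      · subst hj; exact hm.1.trans h2
      · exact h3 j hj
    · rintro ⟨⟨h1, h2⟩, h3⟩
      exact ⟨⟨h3, fun j _ => h1 j⟩, h2⟩
  obtain ⟨δ, hδ, hδ'⟩ := hπ.difference ↥(J₁ ∩ J₂) (fun x => F₁ x) (fun x => F₂ x)
    (h₁.mono inter_subset_left).domRestrict (h₂.mono inter_subset_right).domRestrict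
    (fun x : ↥(J₁ ∩ J₂) => (h₁' x.1 x.2.1).trans (h₂' x.1 x.2.2).symm)
  have hup : ∀ x ∈ Icc a b, Function.update x i m ∈ J₁ ∩ J₂ := by
    intro x hx
    have h : Function.update x i m ∈ Icc a b :=
      ⟨(le_update_iff.2 ⟨hm.1, fun j _ => hx.1 j⟩), update_le_iff.2 ⟨hm.2, fun j _ => hx.2 j⟩⟩
    exact ⟨(hJ₁ _).2 ⟨h, by simp⟩, (hJ₂ _).2 ⟨h, by simp⟩⟩
  set D : (Fin k → ℝ) → G := fun x =>
    if h : Function.update x i m ∈ J₁ ∩ J₂ then δ ⟨_, h⟩ else 1 with hD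
  have hDc : ContinuousOn D (Icc a b) := by
    rw [continuousOn_iff_continuous_domRestrict]
    have : (Icc a b).domRestrict D = fun x : Icc a b => δ ⟨Function.update x.1 i m, hup x x.2⟩ := by
      funext x
      exact dif_pos (hup x.1 x.2)
    rw [this]
    exact hδ.comp (Continuous.subtype_mk (continuous_subtype_val.update i continuous_const) _)
  have hcover : Icc a b = J₁ ∪ J₂ := by
    ext x
    rw [mem_union, hJ₁, hJ₂, ← and_or_left]
    exact ⟨fun h => ⟨h, le_total _ _⟩, fun h => h.1⟩
  set F : (Fin k → ℝ) → Z := fun x => if x i ≤ m then F₁ x else D x • F₂ x with hF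
  have hF₁ : EqOn F F₁ J₁ := fun x hx => by simp [hF, ((hJ₁ x).1 hx).2]
  have hF₂ : EqOn F (fun x => D x • F₂ x) J₂ := by
    intro x hx
    obtain ⟨hx1, hx2⟩ := (hJ₂ x).1 hx
    rcases hx2.eq_or_lt with h | h
    · have hx' : x ∈ J₁ ∩ J₂ := ⟨(hJ₁ x).2 ⟨hx1, h.ge⟩, hx⟩
      have hu : Function.update x i m = x := by rw [h, Function.update_eq_self]
      simp only [hF, h.ge, if_true, hD, hu, hx', dif_pos]
      exact hδ' ⟨x, hx'⟩
    · simp [hF, not_le.2 h]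
  refine ⟨F, ?_, fun x hx => ?_⟩
  · rw [hcover]
    refine ContinuousOn.union_of_isClosed (h₁.congr hF₁) ?_ isClosed_Icc isClosed_Icc
    refine ContinuousOn.congr ?_ hF₂
    exact (hDc.mono (hcover ▸ subset_union_right)).smul h₂
  · rw [hcover] at hx
    rcases hx with hx | hx
    · rw [hF₁ hx, h₁' x hx]
    · rw [hF₂ hx, hπ.smul, h₂' x hx]

/-- Maps of cubes to the base of a principal bundle lift to the total space: subdivide until each
box lies in the domain of a local section, and glue the lifts along common faces. -/
theorem exists_lift_cube (hπ : IsPrincipal G π) {k : ℕ} {f : (Fin k → ℝ) → B}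
    (hf : Continuous f) : ∃ F : (Fin k → ℝ) → Z,
      ContinuousOn F (Icc 0 1) ∧ ∀ x ∈ Icc (0 : Fin k → ℝ) 1, π (F x) = f x := by
  choose U hUo hbU s hs hs' using hπ.section'
  obtain ⟨d, hd, hdU⟩ := lebesgue_number_lemma_of_metric (isCompact_Icc (a := (0 : Fin k → ℝ))
    (b := 1)) (c := fun b => f ⁻¹' U b) (fun b => (hUo b).preimage hf)
    (fun x _ => mem_iUnion.2 ⟨f x, hbU _⟩)
  -- Boxes of side at most `2 ^ n * (d / 2)` admit lifts, by bisecting one coordinate at a time.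
  have key : ∀ n : ℕ, ∀ a b : Fin k → ℝ, a ∈ Icc (0 : Fin k → ℝ) 1 → (∀ j, a j ≤ b j) →
      b ∈ Icc (0 : Fin k → ℝ) 1 → (∀ j, b j - a j ≤ 2 ^ n * (d / 2)) →
      ∃ F : (Fin k → ℝ) → Z, ContinuousOn F (Icc a b) ∧ ∀ x ∈ Icc a b, π (F x) = f x := by
    intro n
    induction n with
    | zero =>
      intro a b ha hab hb hd2
      obtain ⟨b₀, hb₀⟩ := hdU a ha
      have hsub : Icc a b ⊆ f ⁻¹' U b₀ := by
        refine Subset.trans (fun x hx => ?_) hb₀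
        rw [mem_ball]
        refine lt_of_le_of_lt ((dist_pi_le_iff (by positivity : 0 ≤ d / 2)).2 fun j => ?_)
          (half_lt_self hd)
        rw [Real.dist_eq, abs_of_nonneg (sub_nonneg.2 (hx.1 j))]
        have := hd2 j
        have := hx.2 j
        simp only [pow_zero, one_mul] at *
        linarith
      exact ⟨s b₀ ∘ f, (hs b₀).comp hf.continuousOn hsub, fun x hx => hs' b₀ _ (hsub hx)⟩
    | succ n ih =>
      have inner : ∀ S : Finset (Fin k), ∀ a b : Fin k → ℝ, a ∈ Icc (0 : Fin k → ℝ) 1 →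
          (∀ j, a j ≤ b j) → b ∈ Icc (0 : Fin k → ℝ) 1 →
          (∀ j ∈ S, b j - a j ≤ 2 ^ (n + 1) * (d / 2)) →
          (∀ j ∉ S, b j - a j ≤ 2 ^ n * (d / 2)) →
          ∃ F : (Fin k → ℝ) → Z, ContinuousOn F (Icc a b) ∧ ∀ x ∈ Icc a b, π (F x) = f x := by
        intro S
        induction S using Finset.induction_on with
        | empty => exact fun a b ha hab hb _ h => ih a b ha hab hb fun j => h j (by simp)
        | insert i S hi ihS =>
          intro a b ha hab hb hS hS'
          have hi1 : a i ≤ (a i + b i) / 2 := by linarith [hab i]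
          have hi2 : (a i + b i) / 2 ≤ b i := by linarith [hab i]
          have hsi := hS i (Finset.mem_insert_self i S)
          rw [pow_succ] at hsi
          obtain ⟨F₁, h₁, h₁'⟩ := ihS a (Function.update b i ((a i + b i) / 2)) ha
            (fun j => by
              by_cases hj : j = i
              · subst hj; simpa using hi1
              · simpa [hj] using hab j)
            ⟨le_update_iff.2 ⟨(ha.1 i).trans hi1, fun j _ => hb.1 j⟩,
              update_le_iff.2 ⟨hi2.trans (hb.2 i), fun j _ => hb.2 j⟩⟩
            (fun j hj => by
              have hji : j ≠ i := fun h => hi (h ▸ hj)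
              simpa [hji] using hS j (Finset.mem_insert_of_mem hj))
            (fun j hj => by
              by_cases hji : j = i
              · subst hji
                simp only [Function.update_self]
                linarith
              · simpa [hji] using hS' j (by simp [hji, hj]))
          obtain ⟨F₂, h₂, h₂'⟩ := ihS (Function.update a i ((a i + b i) / 2)) b
            ⟨le_update_iff.2 ⟨(ha.1 i).trans hi1, fun j _ => ha.1 j⟩,
              update_le_iff.2 ⟨hi2.trans (hb.2 i), fun j _ => ha.2 j⟩⟩
            (fun j => by
              by_cases hj : j = i
              · subst hj; simpa using hi2
              · simpa [hj] using hab j) hb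
            (fun j hj => by
              have hji : j ≠ i := fun h => hi (h ▸ hj)
              simpa [hji] using hS j (Finset.mem_insert_of_mem hj))
            (fun j hj => by
              by_cases hji : j = i
              · subst hji
                simp only [Function.update_self]
                linarith
              · simpa [hji] using hS' j (by simp [hji, hj]))
          exact hπ.lift_glue i ⟨hi1, hi2⟩ h₁ h₁' h₂ h₂'
      exact fun a b ha hab hb h => inner Finset.univ a b ha hab hb (fun j _ => h j)
        (fun j hj => absurd (Finset.mem_univ j) hj)
  obtain ⟨n, hn⟩ := pow_unbounded_of_one_lt (2 / d) (one_lt_two (α := ℝ))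
  refine key n 0 1 ⟨le_rfl, zero_le_one⟩ (fun j => zero_le_one) ⟨zero_le_one, le_rfl⟩ fun j => ?_
  rw [div_lt_iff₀ hd] at hn
  simp only [Pi.one_apply, Pi.zero_apply, sub_zero]
  linarith

end IsPrincipal

/-- The Borel construction is the base of a principal bundle: on the set where the label `gᵢ` is
defined, `z ↦ gᵢ⁻¹ • z` descends to a local section, and difference maps are quotients of labels. -/
theorem isPrincipal_borelConstruction (G M : Type) [Group G] [TopologicalSpace G]
    [IsTopologicalGroup G] [TopologicalSpace M] [MulAction G M] [ContinuousSMul G M] :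
    IsPrincipal G (fun z : M × MilnorJoin G => (Quotient.mk _ z : BorelConstruction G M)) where
  continuous := continuous_quotient_mk'
  smul g z := Quotient.sound ⟨g, rfl⟩
  section' := by
    intro b
    induction b using Quotient.inductionOn with | _ z₀ => ?_
    obtain ⟨i, hi⟩ := MilnorJoin.exists_mem_support z₀.2
    have hq : IsOpenMap (fun z : M × MilnorJoin G => (Quotient.mk _ z : BorelConstruction G M)) :=
      isOpenMap_quotient_mk'_mul
    set S : Set (M × MilnorJoin G) := {z | z.2 ∈ MilnorJoin.support G i} with hS
    have hSo : IsOpen S := (MilnorJoin.isOpen_support i).preimage continuous_snd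
    set c : S → G := fun z => MilnorJoin.coord i ⟨z.1.2, z.2⟩ with hc
    have hcc : Continuous c := (MilnorJoin.continuous_coord i).comp
      ((continuous_snd.comp continuous_subtype_val).subtype_mk _)
    set t : S → M × MilnorJoin G := fun z => (c z)⁻¹ • z.1 with ht
    have htc : Continuous t := hcc.inv.smul continuous_subtype_val
    -- `t` is invariant, so it only depends on the orbit
    have hinv : ∀ z w : S, (Quotient.mk _ z.1 : BorelConstruction G M) = Quotient.mk _ w.1 →
        t z = t w := by
      intro z w h
      obtain ⟨g, hg⟩ := Quotient.exact h
      have hcz : c z = g * c w := by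
        have h1 := MilnorJoin.coord_smul (i := i) g ⟨w.1.2, w.2⟩
        simp only [hc]
        rw [← h1]
        congr 2
        exact (congrArg Prod.snd hg).symm
      simp only [ht, hcz, ← hg, mul_inv_rev, mul_smul]
      simp
    classical
    refine ⟨(fun z => (Quotient.mk _ z : BorelConstruction G M)) '' S, hq S hSo, ⟨z₀, hi, rfl⟩,
      fun b => if h : ∃ z : S, (Quotient.mk _ z.1 : BorelConstruction G M) = b then t h.choose
        else z₀, ?_, ?_⟩
    · have hval : ∀ z : S, (if h : ∃ w : S, (Quotient.mk _ w.1 : BorelConstruction G M) =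
          Quotient.mk _ z.1 then t h.choose else z₀) = t z := by
        intro z
        have h : ∃ w : S, (Quotient.mk _ w.1 : BorelConstruction G M) = Quotient.mk _ z.1 :=
          ⟨z, rfl⟩
        rw [dif_pos h]
        exact hinv _ _ h.choose_spec
      have hsat : (fun z => (Quotient.mk _ z : BorelConstruction G M)) ⁻¹'
          ((fun z => (Quotient.mk _ z : BorelConstruction G M)) '' S) = S := by
        refine Subset.antisymm ?_ (subset_preimage_image _ _)
        rintro z ⟨w, hw, hwz⟩
        obtain ⟨g, hg⟩ := Quotient.exact hwz
        have : g • z = w := hg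
        exact (show (g • z).2 ∈ MilnorJoin.support G i from this ▸ hw)
      refine (isQuotientMap_quotient_mk'.continuousOn_isOpen_iff (hq S hSo)).2 ?_
      change ContinuousOn _ ((fun z => (Quotient.mk _ z : BorelConstruction G M)) ⁻¹' _)
      rw [hsat, continuousOn_iff_continuous_domRestrict]
      convert htc using 1
      funext z
      exact hval z
    · rintro _ ⟨z, hz, rfl⟩
      have h : ∃ w : S, (Quotient.mk _ w.1 : BorelConstruction G M) = Quotient.mk _ z :=
        ⟨⟨z, hz⟩, rfl⟩
      simp only [dif_pos h]
      rw [hinv _ ⟨z, hz⟩ h.choose_spec]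
      exact Quotient.sound ⟨(c ⟨z, hz⟩)⁻¹, rfl⟩
  difference := by
    intro X _ f₁ f₂ h₁ h₂ h
    choose δ hδ using fun x => Quotient.exact (h x)
    refine ⟨δ, continuous_iff_continuousAt.2 fun x => ?_, fun x => (hδ x).symm⟩
    obtain ⟨i, hi⟩ := MilnorJoin.exists_mem_support (f₂ x).2
    set S : Set X := {y | (f₂ y).2 ∈ MilnorJoin.support G i} with hS
    have hSo : IsOpen S := (MilnorJoin.isOpen_support i).preimage (continuous_snd.comp h₂)
    have hS₁ : ∀ y ∈ S, (f₁ y).2 ∈ MilnorJoin.support G i := by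
      intro y hy
      rw [← hδ y]
      exact hy
    refine ContinuousOn.continuousAt ?_ (hSo.mem_nhds hi)
    rw [continuousOn_iff_continuous_domRestrict]
    have : S.domRestrict δ = fun y : S => MilnorJoin.coord i ⟨(f₁ y).2, hS₁ y y.2⟩ *
        (MilnorJoin.coord i ⟨(f₂ y).2, y.2⟩)⁻¹ := by
      funext y
      rw [eq_mul_inv_iff_mul_eq]
      simp only [domRestrict_apply]
      rw [← MilnorJoin.coord_smul]
      congr 2
      exact congrArg Prod.snd (hδ y)
    rw [this]
    exact ((MilnorJoin.continuous_coord i).comp (Continuous.subtype_mk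
      (continuous_snd.comp (h₁.comp continuous_subtype_val)) _)).mul
      ((MilnorJoin.continuous_coord i).comp (Continuous.subtype_mk
      (continuous_snd.comp (h₂.comp continuous_subtype_val)) _)).inv

/-- In the base `B` of a principal bundle `Z → B` with group `G`, the homotopy set `πᵢ` is trivial
as soon as maps from the boundary of the `(i + 1)`-cube to `Z`, and from the boundary of the
`i`-cube to `G`, extend. -/
theorem IsPrincipal.subsingleton_homotopyGroup {G Z B : Type} [Group G] [TopologicalSpace G]
    [IsTopologicalGroup G] [TopologicalSpace Z] [TopologicalSpace B] [MulAction G Z]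
    [ContinuousSMul G Z] {π : Z → B} (hπ : IsPrincipal G π) (k : ℕ)
    (hG : ExtendsFrom {y : Fin k → ℝ | y ∈ Icc 0 1 ∧ ∃ i, y i = 0 ∨ y i = 1} G)
    (hZ : ExtendsFrom (sphere (0 : ℝ × (Fin k → ℝ)) 1) Z) (x₀ : B) :
    Subsingleton (HomotopyGroup.Pi k B x₀) := by
  classical
  refine subsingleton_of_forall_eq (Quotient.mk _ GenLoop.const) fun f => ?_
  induction f using Quotient.inductionOn with | _ f => ?_
  refine Quotient.sound ?_
  set clamp : (Fin k → ℝ) → (Fin k → I) := fun y j => projIcc 0 1 zero_le_one (y j) with hclamp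
  have hcl : Continuous clamp := by
    refine continuous_pi fun j => continuous_projIcc.comp (continuous_apply j)
  obtain ⟨F, hF, hF'⟩ := hπ.exists_lift_cube (f := fun y => f (clamp y))
    (f.1.continuous.comp hcl)
  obtain ⟨U, -, hxU, s, -, hs⟩ := hπ.section' x₀
  set e := s x₀
  have he : π e = x₀ := hs _ hxU
  set A : Set (Fin k → ℝ) := {y | y ∈ Icc 0 1 ∧ ∃ i, y i = 0 ∨ y i = 1} with hA
  have hclA : ∀ y ∈ A, clamp y ∈ Cube.boundary (Fin k) := by
    rintro y ⟨-, i, hi⟩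
    refine ⟨i, ?_⟩
    rcases hi with hi | hi <;> simp [hclamp, hi]
  obtain ⟨δ, hδ, hδ'⟩ := hπ.difference A (fun _ => e) (fun y => F y) continuous_const
    (hF.mono fun y hy => hy.1).domRestrict fun y => by
      rw [he, hF' _ y.2.1]
      exact (f.2 _ (hclA y y.2)).symm
  obtain ⟨D, hD, hDδ⟩ := hG (fun y => if h : y ∈ A then δ ⟨y, h⟩ else 1) (by
    rw [continuousOn_iff_continuous_domRestrict]
    convert hδ using 1
    funext y
    have := y.2
    simp [this])
  -- The corrected lift sends the boundary of the cube to `e`.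
  set F' : (Fin k → ℝ) → Z := fun y => D y • F y with hF'def
  have hF'c : ContinuousOn F' (Icc 0 1) := hD.continuousOn.smul hF
  have hF'A : ∀ y ∈ A, F' y = e := by
    intro y hy
    have := hDδ hy
    simp only [hy, dif_pos] at this
    rw [hF'def]
    simp only [this]
    exact (hδ' ⟨y, hy⟩).symm
  have hπF' : ∀ y ∈ Icc (0 : Fin k → ℝ) 1, π (F' y) = f (clamp y) := fun y hy => by
    rw [hF'def]; simp only; rw [hπ.smul, hF' y hy]
  set half : (Fin k → ℝ) → (Fin k → ℝ) := fun y j => (y j + 1) / 2 with hhalf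
  have hhalfc : Continuous half := by fun_prop
  have hsph : ∀ z : ℝ × (Fin k → ℝ), z ∈ sphere 0 1 → half z.2 ∈ Icc (0 : Fin k → ℝ) 1 := by
    intro z hz
    rw [mem_sphere_zero_iff_norm] at hz
    have h1 : ∀ j, |z.2 j| ≤ 1 := fun j => (norm_le_pi_norm z.2 j).trans (hz ▸ norm_snd_le z)
    exact ⟨fun j => by have := abs_le.1 (h1 j); simp only [hhalf, Pi.zero_apply]; linarith,
      fun j => by have := abs_le.1 (h1 j); simp only [hhalf, Pi.one_apply]; linarith⟩
  have hsph' : ∀ z : ℝ × (Fin k → ℝ), z ∈ sphere 0 1 → z.1 = -1 ∨ z.1 = 1 ∨ half z.2 ∈ A := by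
    intro z hz
    have hz' := hsph z hz
    rw [mem_sphere_zero_iff_norm, Prod.norm_def] at hz
    by_cases h1 : |z.1| = 1
    · rcases eq_or_eq_neg_of_abs_eq h1 with h | h
      · exact Or.inr (Or.inl h)
      · exact Or.inl h
    · have h2 : ‖z.2‖ = 1 := by
        rcases max_choice ‖z.1‖ ‖z.2‖ with h | h
        · exact absurd (h.symm.trans hz) h1
        · exact h.symm.trans hz
      refine Or.inr (Or.inr ⟨hz', ?_⟩)
      by_contra! h3
      have h4 : ‖z.2‖ < 1 := by
        refine (pi_norm_lt_iff one_pos).2 fun j => ?_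
        have h5 := hz'.1 j
        have h6 := hz'.2 j
        have h7 := h3 j
        simp only [hhalf, Pi.zero_apply, Pi.one_apply] at h5 h6 h7
        rw [Real.norm_eq_abs, abs_lt]
        constructor
        · have := lt_of_le_of_ne h5 h7.1.symm
          linarith
        · have := lt_of_le_of_ne h6 h7.2
          linarith
      exact absurd h2 h4.ne
  have hAcl : IsClosed A := by
    have : A = Icc 0 1 ∩ ⋃ i, ({y | y i = 0} ∪ {y | y i = 1}) := by
      ext y; simp [hA]
    rw [this]
    refine isClosed_Icc.inter (isClosed_iUnion_of_finite fun i => ?_)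
    exact (isClosed_eq (continuous_apply i) continuous_const).union
      (isClosed_eq (continuous_apply i) continuous_const)
  -- The map on the boundary of the `(k + 1)`-cube: `F'` on the bottom face, `e` elsewhere.
  set φ : ℝ × (Fin k → ℝ) → Z := fun z => if z.1 = -1 then F' (half z.2) else e with hφ
  have hφA : ∀ z : ℝ × (Fin k → ℝ), (z.1 = 1 ∨ half z.2 ∈ A) → φ z = e := by
    rintro z (h | h)
    · simp only [hφ, h]; norm_num
    · simp only [hφ, hF'A _ h, ite_self]
  have hφc : ContinuousOn φ (sphere 0 1) := by
    have hsub : sphere (0 : ℝ × (Fin k → ℝ)) 1 =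
        (sphere 0 1 ∩ {z | z.1 = -1}) ∪ (sphere 0 1 ∩ {z | z.1 = 1 ∨ half z.2 ∈ A}) := by
      ext z
      simp only [mem_union, mem_inter_iff, mem_ofPred_eq, ← and_or_left]
      exact ⟨fun h => ⟨h, hsph' z h⟩, fun h => h.1⟩
    have hhc : Continuous fun z : ℝ × (Fin k → ℝ) => half z.2 := hhalfc.comp continuous_snd
    rw [hsub]
    refine ContinuousOn.union_of_isClosed ?_ ?_ ?_ ?_
    · refine ContinuousOn.congr (f := fun z : ℝ × (Fin k → ℝ) => F' (half z.2)) ?_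
        fun z hz => if_pos (show z.1 = -1 from hz.2)
      exact hF'c.comp hhc.continuousOn fun z hz => hsph z hz.1
    · exact continuousOn_const.congr fun z hz => hφA z hz.2
    · exact isClosed_sphere.inter (isClosed_eq continuous_fst continuous_const)
    · exact isClosed_sphere.inter
        ((isClosed_eq continuous_fst continuous_const).union (hAcl.preimage hhc))
  obtain ⟨g, hg, hgφ⟩ := hZ φ hφc
  set dbl : I × (Fin k → I) → ℝ × (Fin k → ℝ) :=
    fun z => (2 * (z.1 : ℝ) - 1, fun j => 2 * (z.2 j : ℝ) - 1) with hdbl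
  have hdblc : Continuous dbl := by fun_prop
  have hhd : ∀ t y, half (dbl (t, y)).2 = fun j => (y j : ℝ) := by
    intro t y; funext j; simp [hhalf, hdbl]
  have hmemI : ∀ y : Fin k → I, (fun j => (y j : ℝ)) ∈ Icc (0 : Fin k → ℝ) 1 :=
    fun y => ⟨fun j => (y j).2.1, fun j => (y j).2.2⟩
  have hcy : ∀ y : Fin k → I, clamp (fun j => (y j : ℝ)) = y := by
    intro y; funext j; exact projIcc_val _ _
  have habs : ∀ t : I, |2 * (t : ℝ) - 1| ≤ 1 := fun t =>
    abs_le.2 ⟨by linarith [t.2.1], by linarith [t.2.2]⟩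
  have hd2 : ∀ t y, ‖(dbl (t, y)).2‖ ≤ 1 := fun t y =>
    (pi_norm_le_iff_of_nonneg zero_le_one).2 fun j => habs _
  have hdn : ∀ t y, ‖(dbl (t, y)).1‖ ≤ 1 := fun t y => habs t
  have hmem1 : ∀ t y, |(dbl (t, y)).1| = 1 → dbl (t, y) ∈ sphere 0 1 := by
    intro t y h
    rw [mem_sphere_zero_iff_norm, Prod.norm_def, Real.norm_eq_abs, h]
    exact max_eq_left (hd2 t y)
  have hmem2 : ∀ t, ∀ y ∈ Cube.boundary (Fin k),
      dbl (t, y) ∈ sphere 0 1 ∧ half (dbl (t, y)).2 ∈ A := by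
    rintro t y ⟨j, hj⟩
    constructor
    · rw [mem_sphere_zero_iff_norm, Prod.norm_def]
      have : ‖(dbl (t, y)).2‖ = 1 := by
        refine le_antisymm (hd2 t y) ?_
        refine le_trans ?_ (norm_le_pi_norm _ j)
        rcases hj with hj | hj
        · simp [hdbl, hj]
        · simp [hdbl, hj]; norm_num
      rw [this]
      exact max_eq_right (hdn t y)
    · rw [hhd]
      refine ⟨hmemI y, j, ?_⟩
      rcases hj with hj | hj <;> simp [hj]
  refine ⟨⟨⟨⟨fun z => π (g (dbl z)), hπ.continuous.comp (hg.comp hdblc)⟩, fun y => ?_,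
    fun y => ?_⟩, fun t y hy => ?_⟩⟩
  · change π (g (dbl (0, y))) = f y
    rw [hgφ (hmem1 0 y (by simp [hdbl]))]
    have : φ (dbl (0, y)) = F' (fun j => (y j : ℝ)) := by
      rw [← hhd 0 y]
      exact if_pos (by simp [hdbl])
    rw [this, hπF' _ (hmemI y), hcy]
  · change π (g (dbl (1, y))) = x₀
    have h1 : (dbl (1, y)).1 = 1 := by simp only [hdbl, Icc.coe_one]; norm_num
    rw [hgφ (hmem1 1 y (by rw [h1, abs_one])), hφA _ (Or.inl h1), he]
  · change π (g (dbl (t, y))) = f y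
    rw [hgφ (hmem2 t y hy).1, hφA _ (Or.inr (hmem2 t y hy).2), he]
    exact (f.2 y hy).symm

end Principal

/-! ### The representation of `SU(2)` on binary cubic forms -/

open Matrix

/-- The action of a `2 × 2` matrix on binary cubic forms, in the basis `e₁³`, `√3 e₁²e₂`,
`√3 e₁e₂²`, `e₂³`, which is orthonormal for the invariant Hermitian form. -/
noncomputable def cubicMatrix (A : Matrix (Fin 2) (Fin 2) ℂ) : Matrix (Fin 4) (Fin 4) ℂ :=
  let w : ℂ := (√3 : ℝ)
  let p := A 0 0
  let q := A 0 1
  let r := A 1 0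
  let s := A 1 1
  !![p ^ 3, w * (p ^ 2 * q), w * (p * q ^ 2), q ^ 3;
    w * (p ^ 2 * r), p ^ 2 * s + 2 * p * r * q, 2 * p * q * s + r * q ^ 2, w * (q ^ 2 * s);
    w * (p * r ^ 2), 2 * p * r * s + r ^ 2 * q, p * s ^ 2 + 2 * q * r * s, w * (q * s ^ 2);
    r ^ 3, w * (r ^ 2 * s), w * (r * s ^ 2), s ^ 3]

theorem sqrt_three_sq : ((√3 : ℝ) : ℂ) ^ 2 = 3 := by
  rw [← Complex.ofReal_pow, Real.sq_sqrt (by norm_num)]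
  norm_num

set_option maxHeartbeats 1000000 in
theorem cubicMatrix_mul (A B : Matrix (Fin 2) (Fin 2) ℂ) :
    cubicMatrix (A * B) = cubicMatrix A * cubicMatrix B := by
  have hw := sqrt_three_sq
  simp only [cubicMatrix, Matrix.mul_apply, Fin.sum_univ_two]
  generalize ((√3 : ℝ) : ℂ) = w at hw
  generalize A 0 0 = a
  generalize A 0 1 = b
  generalize A 1 0 = c
  generalize A 1 1 = d
  generalize B 0 0 = a'
  generalize B 0 1 = b'
  generalize B 1 0 = c'
  generalize B 1 1 = d'
  ext i j
  fin_cases i <;> fin_cases j <;> simp [Matrix.mul_apply, Fin.sum_univ_four] <;> ring_nf <;>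
    simp only [hw]

theorem cubicMatrix_one : cubicMatrix 1 = 1 := by
  ext i j
  fin_cases i <;> fin_cases j <;> simp [cubicMatrix]

theorem cubicMatrix_star (A : Matrix (Fin 2) (Fin 2) ℂ) :
    cubicMatrix (star A) = star (cubicMatrix A) := by
  ext i j
  fin_cases i <;> fin_cases j <;> simp [cubicMatrix, Matrix.star_apply] <;> ring_nf
  simp

theorem cubicMatrix_smul (c : ℂ) (A : Matrix (Fin 2) (Fin 2) ℂ) :
    cubicMatrix (c • A) = c ^ 3 • cubicMatrix A := by
  ext i j
  fin_cases i <;> fin_cases j <;> simp [cubicMatrix] <;> ring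

theorem cubicMatrix_mem_unitary (g : SU2) :
    cubicMatrix g.1 ∈ unitary (Matrix (Fin 4) (Fin 4) ℂ) := by
  have h : g.1 ∈ unitary (Matrix (Fin 2) (Fin 2) ℂ) := (Matrix.mem_specialUnitaryGroup_iff.1 g.2).1
  rw [Unitary.mem_iff] at h ⊢
  rw [← cubicMatrix_star, ← cubicMatrix_mul, ← cubicMatrix_mul, h.1, h.2, cubicMatrix_one]
  exact ⟨rfl, rfl⟩

/-- The action of `SU(2)` on binary cubic forms, as a unitary representation on `ℂ⁴`. -/
noncomputable def cubicRep : SU2 →* (Cn 4 ≃ₗᵢ[ℂ] Cn 4) :=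
  (Unitary.linearIsometryEquiv (𝕜 := ℂ) (H := Cn 4)).toMonoidHom.comp
    { toFun := fun g => ⟨toEuclideanCLM (n := Fin 4) (𝕜 := ℂ) (cubicMatrix g.1), by
        have h := cubicMatrix_mem_unitary g
        rw [Unitary.mem_iff] at h ⊢
        rw [← map_star, ← map_mul, ← map_mul, h.1, h.2, map_one]
        exact ⟨rfl, rfl⟩⟩
      map_one' := Subtype.ext (by
        change toEuclideanCLM (n := Fin 4) (𝕜 := ℂ) (cubicMatrix 1) = 1
        rw [cubicMatrix_one, map_one])
      map_mul' := fun g h => Subtype.ext (by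
        change toEuclideanCLM (n := Fin 4) (𝕜 := ℂ) (cubicMatrix (g.1 * h.1)) =
          toEuclideanCLM (n := Fin 4) (𝕜 := ℂ) (cubicMatrix g.1) *
          toEuclideanCLM (n := Fin 4) (𝕜 := ℂ) (cubicMatrix h.1)
        rw [cubicMatrix_mul, map_mul]) }

theorem cubicRep_apply (g : SU2) (x : Cn 4) :
    cubicRep g x = toEuclideanCLM (n := Fin 4) (𝕜 := ℂ) (cubicMatrix g.1) x := rfl

/-- The quaternion with first column `m`, as a complex matrix. -/
def quatMatrix (m : Cn 2) : Matrix (Fin 2) (Fin 2) ℂ := !![m 0, -star (m 1); m 1, star (m 0)]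

/-- The action of the quaternions on binary cubic forms, a homogeneous polynomial map that extends
the action of `SU(2)`. -/
noncomputable def quatAct (m : Cn 2) (x : Cn 4) : Cn 4 :=
  toEuclideanCLM (n := Fin 4) (𝕜 := ℂ) (cubicMatrix (quatMatrix m)) x

theorem quatMatrix_homeoSphere (g : SU2) : quatMatrix (SU2.homeoSphere g).1 = g.1 := by
  have h : SU2.homeoSphere.symm (SU2.homeoSphere g) = g := SU2.homeoSphere.symm_apply_apply g
  exact congrArg Subtype.val h

theorem quatAct_homeoSphere (g : SU2) (x : Cn 4) :
    quatAct (SU2.homeoSphere g).1 x = cubicRep g x := by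
  rw [quatAct, quatMatrix_homeoSphere, cubicRep_apply]

theorem quatAct_real_smul (c : ℝ) (m : Cn 2) (x : Cn 4) :
    quatAct (c • m) x = c ^ 3 • quatAct m x := by
  have h : quatMatrix (c • m) = (c : ℂ) • quatMatrix m := by
    ext i j
    fin_cases i <;> fin_cases j <;> simp [quatMatrix]
  rw [quatAct, h, cubicMatrix_smul, map_smul]
  change (c : ℂ) ^ 3 • quatAct m x = _
  rw [← Complex.ofReal_pow, Complex.coe_smul]

theorem quatAct_apply (m : Cn 2) (x : Cn 4) (i : Fin 4) :
    quatAct m x i = ∑ j, cubicMatrix (quatMatrix m) i j * x j := rfl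

theorem contDiff_cubicMatrix {E : Type*} [NormedAddCommGroup E] [NormedSpace ℝ E] {n : ℕ∞ω}
    {p q r s : E → ℂ} (hp : ContDiff ℝ n p) (hq : ContDiff ℝ n q) (hr : ContDiff ℝ n r)
    (hs : ContDiff ℝ n s) (i j : Fin 4) :
    ContDiff ℝ n fun z => cubicMatrix !![p z, q z; r z, s z] i j := by
  fin_cases i <;> fin_cases j <;> simp [cubicMatrix] <;> fun_prop

theorem contDiff_quatAct {n : ℕ∞ω} : ContDiff ℝ n fun z : Cn 2 × Cn 4 => quatAct z.1 z.2 := by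
  rw [contDiff_piLp]
  intro i
  simp only [quatAct_apply]
  have h1 : ∀ k, ContDiff ℝ n fun z : Cn 2 × Cn 4 => z.1 k := fun k =>
    ((EuclideanSpace.proj (𝕜 := ℂ) (ι := Fin 2) k).restrictScalars ℝ).contDiff.comp
      contDiff_fst
  have h2 : ∀ k, ContDiff ℝ n fun z : Cn 2 × Cn 4 => z.2 k := fun k =>
    ((EuclideanSpace.proj (𝕜 := ℂ) (ι := Fin 4) k).restrictScalars ℝ).contDiff.comp
      contDiff_snd
  have h3 : ∀ k, ContDiff ℝ n fun z : Cn 2 × Cn 4 => star (z.1 k) := fun k =>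
    (starL' ℝ (A := ℂ)).contDiff.comp (h1 k)
  exact ContDiff.sum fun j _ =>
    (contDiff_cubicMatrix (h1 0) (h3 1).neg (h1 1) (h3 0) i j).mul (h2 j)

theorem continuous_cubicRep : Continuous fun z : SU2 × Cn 4 => cubicRep z.1 z.2 := by
  have h : (fun z : SU2 × Cn 4 => cubicRep z.1 z.2) =
      (fun z : Cn 2 × Cn 4 => quatAct z.1 z.2) ∘ fun z => ((SU2.homeoSphere z.1).1, z.2) := by
    funext z
    exact (quatAct_homeoSphere z.1 z.2).symm
  rw [h]
  refine (contDiff_quatAct (n := 0)).continuous.comp ?_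
  exact (continuous_subtype_val.comp (SU2.homeoSphere.continuous.comp continuous_fst)).prodMk
    continuous_snd

/-! ### Irreducibility and isotropy groups -/

/-- The element of `SU(2)` with first column `(a, b)`. -/
noncomputable def SU2.ofPair (a b : ℂ) (h : ‖a‖ ^ 2 + ‖b‖ ^ 2 = 1) : SU2 :=
  SU2.homeoSphere.symm ⟨!₂[a, b], by
    rw [mem_sphere_zero_iff_norm, EuclideanSpace.norm_eq, Real.sqrt_eq_one, Fin.sum_univ_two]
    simpa using h⟩

theorem SU2.ofPair_val (a b : ℂ) (h : ‖a‖ ^ 2 + ‖b‖ ^ 2 = 1) :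
    (SU2.ofPair a b h).1 = !![a, -star b; b, star a] := rfl

/-- The diagonal matrix with entries `a` and `a⁻¹` in `SU(2)`. -/
noncomputable def SU2.torus (a : Circle) : SU2 := SU2.ofPair a 0 (by simp [Circle.norm_coe])

theorem cubicRep_torus (a : Circle) (x : Cn 4) :
    cubicRep (SU2.torus a) x =
      !₂[(a : ℂ) ^ 3 * x 0, a * x 1, star (a : ℂ) * x 2, star (a : ℂ) ^ 3 * x 3] := by
  have ha : (a : ℂ) * (starRingEnd ℂ) (a : ℂ) = 1 := by
    rw [Complex.mul_conj', Circle.norm_coe]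
    simp
  ext i
  change ∑ j, cubicMatrix (SU2.torus a).1 i j * x j = _
  rw [SU2.torus, SU2.ofPair_val, Fin.sum_univ_four]
  fin_cases i
  · simp [cubicMatrix]
  · simp [cubicMatrix]
    left
    linear_combination (a : ℂ) * ha
  · simp [cubicMatrix]
    left
    linear_combination ((starRingEnd ℂ) (a : ℂ)) * ha
  · simp [cubicMatrix]

/-- The determinant of the minor of `cubicMatrix A` with rows `e₁e₂²`, `e₂³` and columns `e₁³`,
`e₁²e₂` is a fourth power; hence a form `z e₁³ + w e₁²e₂` is only fixed by diagonal matrices. -/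
theorem cubicMatrix_minor {A : Matrix (Fin 2) (Fin 2) ℂ} (hA : A.det = 1) :
    cubicMatrix A 2 0 * cubicMatrix A 3 1 - cubicMatrix A 3 0 * cubicMatrix A 2 1 =
      A 1 0 ^ 4 := by
  rw [Matrix.det_fin_two] at hA
  have hw := sqrt_three_sq
  simp only [cubicMatrix, of_apply, cons_val', cons_val_zero, cons_val_one, cons_val,
    cons_val_fin_one]
  generalize ((√3 : ℝ) : ℂ) = w at hw
  linear_combination (A 1 0 ^ 4 * A 0 0 * A 1 1) * hw + A 1 0 ^ 4 * hA

theorem SU2.det_eq_one (g : SU2) : g.1.det = 1 := g.2.2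

theorem SU2.eq_one_of_entries {g : SU2} (h0 : g.1 0 0 = 1) (h1 : g.1 1 0 = 0) : g = 1 := by
  apply SU2.homeoSphere.injective
  apply Subtype.ext
  ext i
  fin_cases i
  · change g.1 0 0 = (1 : Matrix (Fin 2) (Fin 2) ℂ) 0 0
    simp [h0]
  · change g.1 1 0 = (1 : Matrix (Fin 2) (Fin 2) ℂ) 1 0
    simp [h1]

/-- A form with a root of multiplicity exactly two has trivial isotropy: an element that fixes it is
diagonal, by `cubicMatrix_minor`, and fixes its component of weight one. -/
theorem cubicRep_fixed_regular {g : SU2} {x : Cn 4} (h1 : x 1 ≠ 0) (h2 : x 2 = 0) (h3 : x 3 = 0)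
    (hg : cubicRep g x = x) : g = 1 := by
  have hrow : ∀ i, ∑ j, cubicMatrix g.1 i j * x j = x i := fun i =>
    congrArg (fun y : Cn 4 => y i) hg
  have hm := cubicMatrix_minor (SU2.det_eq_one g)
  have r1 := hrow 1
  have r2 := hrow 2
  have r3 := hrow 3
  simp only [Fin.sum_univ_four, h2, h3, mul_zero, add_zero] at r1 r2 r3
  have hr : g.1 1 0 = 0 := by
    have : g.1 1 0 ^ 4 * x 1 = 0 := by
      rw [← hm]
      linear_combination cubicMatrix g.1 2 0 * r3 - cubicMatrix g.1 3 0 * r2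
    simpa [h1] using this
  refine SU2.eq_one_of_entries ?_ hr
  have hd := SU2.det_eq_one g
  rw [Matrix.det_fin_two, hr, mul_zero, sub_zero] at hd
  simp only [cubicMatrix, of_apply, cons_val', cons_val_zero, cons_val_one,
    cons_val_fin_one, hr] at r1
  have : (g.1 0 0 - 1) * x 1 = 0 := by
    linear_combination r1 - (g.1 0 0 * x 1) * hd
  simpa [h1, sub_eq_zero] using this

/-- An invariant subspace contains the coordinate projections of its vectors, by averaging over
powers of a torus element, and an element of `SU(2)` whose matrix has no zero entry then moves any
basis vector in it onto all the others. -/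
theorem cubicRep_irreducible (W : Submodule ℂ (Cn 4))
    (hW : ∀ g : SU2, ∀ w ∈ W, cubicRep g w ∈ W) : W = ⊥ ∨ W = ⊤ := by
  classical
  refine or_iff_not_imp_left.2 fun hne => ?_
  obtain ⟨w, hw, hw0⟩ := Submodule.exists_mem_ne_zero_of_ne_bot hne
  -- The eigenvalues of a torus element of order eight on the four basis vectors are distinct.
  have hsingle : ∀ x ∈ W, ∀ i, EuclideanSpace.single i (x i) ∈ W := by
    set a : Circle := Circle.exp (Real.pi / 4) with ha
    have ha2 : (a : ℂ) ^ 2 = Complex.I := by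
      rw [ha, Circle.coe_exp, ← Complex.exp_nat_mul]
      refine Eq.trans (congrArg Complex.exp ?_) Complex.exp_pi_div_two_mul_I
      push_cast
      ring
    have ha4 : (a : ℂ) ^ 4 = -1 := by
      linear_combination ((a : ℂ) ^ 2 + Complex.I) * ha2 + Complex.I_sq
    have ha0 : (a : ℂ) ≠ 0 := a.coe_ne_zero
    have hstar : star (a : ℂ) = -(a : ℂ) ^ 3 := by
      have h : (a : ℂ) * star (a : ℂ) = 1 := by
        rw [RCLike.star_def, Complex.mul_conj', Circle.norm_coe]
        simp
      refine mul_left_cancel₀ ha0 ?_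
      rw [h]
      linear_combination ha4
    set D : Cn 4 → Cn 4 := fun x => cubicRep (SU2.torus a) x with hD
    have hDW : ∀ x ∈ W, D x ∈ W := fun x hx => hW _ x hx
    have hDx : ∀ x : Cn 4, D x = !₂[(a : ℂ) ^ 3 * x 0, a * x 1, -(a : ℂ) ^ 3 * x 2,
        -(a : ℂ) * x 3] := by
      intro x
      have h3 : (-(a : ℂ) ^ 3) ^ 3 = -a := by linear_combination (-(a : ℂ) ^ 5 + a) * ha4
      rw [hD]
      simp only [cubicRep_torus, hstar, h3]
    -- The square of the torus element has the eigenvalue `-i` on the basis vectors 0 and 2, and `i`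
    -- on 1 and 3.
    have hE : ∀ x ∈ W, !₂[x 0, 0, x 2, 0] ∈ W ∧ !₂[0, x 1, 0, x 3] ∈ W := by
      intro x hx
      have hI := Complex.I_sq
      constructor
      · have h := W.smul_mem (Complex.I / 2) (W.sub_mem (hDW _ (hDW x hx))
          (W.smul_mem Complex.I hx))
        convert h using 1
        ext k
        rw [hDx, hDx]
        fin_cases k <;> simp
        · linear_combination (-x 0 * (Complex.I * ((a : ℂ) ^ 2)) / 2) * ha4
            + x 0 * Complex.I / 2 * ha2 + x 0 * hI
        · linear_combination x 1 * ha2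
        · linear_combination (-x 2 * (Complex.I * ((a : ℂ) ^ 2)) / 2) * ha4
            + x 2 * Complex.I / 2 * ha2 + x 2 * hI
        · linear_combination x 3 * ha2
      · have h := W.smul_mem (-Complex.I / 2) (W.add_mem (hDW _ (hDW x hx))
          (W.smul_mem Complex.I hx))
        convert h using 1
        ext k
        rw [hDx, hDx]
        fin_cases k <;> simp
        · linear_combination (x 0 * (Complex.I * ((a : ℂ) ^ 2)) / 2) * ha4
            - x 0 * Complex.I / 2 * ha2
        · linear_combination (x 1 * Complex.I / 2) * ha2 + x 1 * hI
        · linear_combination (x 2 * (Complex.I * ((a : ℂ) ^ 2)) / 2) * ha4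
            - x 2 * Complex.I / 2 * ha2
        · linear_combination (x 3 * Complex.I / 2) * ha2 + x 3 * hI
    intro x hx i
    obtain ⟨h0, h1⟩ := hE x hx
    fin_cases i
    · convert W.smul_mem (1 / 2) (W.sub_mem h0 (W.smul_mem (a : ℂ) (hDW _ h0))) using 1
      ext k
      rw [hDx]
      fin_cases k <;> simp
      · linear_combination (x 0 / 2) * ha4
      · linear_combination x 2 * ha4
    · convert W.smul_mem (1 / 2) (W.sub_mem h1 (W.smul_mem ((a : ℂ) ^ 3) (hDW _ h1))) using 1
      ext k
      rw [hDx]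
      fin_cases k <;> simp
      · linear_combination (x 1 / 2) * ha4
      · linear_combination x 3 * ha4
    · convert W.smul_mem (1 / 2) (W.add_mem h0 (W.smul_mem (a : ℂ) (hDW _ h0))) using 1
      ext k
      rw [hDx]
      fin_cases k <;> simp
      · linear_combination (-x 0 / 2) * ha4
      · linear_combination (x 2 / 2) * ha4
    · convert W.smul_mem (1 / 2) (W.add_mem h1 (W.smul_mem ((a : ℂ) ^ 3) (hDW _ h1))) using 1
      ext k
      rw [hDx]
      fin_cases k <;> simp
      · linear_combination (-x 1 / 2) * ha4
      · linear_combination (x 3 / 2) * ha4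
  have hne' : ∃ i, w i ≠ 0 := by
    by_contra! h
    exact hw0 (by ext i; exact h i)
  obtain ⟨i, hi⟩ := hne'
  have hbasis : ∀ x ∈ W, ∀ j, x j ≠ 0 → EuclideanSpace.single j (1 : ℂ) ∈ W := by
    intro x hx j hj
    have h := W.smul_mem (x j)⁻¹ (hsingle x hx j)
    convert h using 1
    ext k
    by_cases hk : k = j
    · subst hk; simp [hj]
    · simp [hk]
  -- All matrix coefficients of a suitable rotation are nonzero.
  set g : SU2 := SU2.ofPair (3 / 5) (4 / 5) (by norm_num) with hg
  have hcoef : ∀ k l, cubicMatrix g.1 k l ≠ 0 := by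
    have h3 : ((√3 : ℝ) : ℂ) ≠ 0 := by simp
    intro k l
    rw [hg, SU2.ofPair_val]
    fin_cases k <;> fin_cases l <;> simp [cubicMatrix, h3] <;> norm_num
  have hall : ∀ j, EuclideanSpace.single j (1 : ℂ) ∈ W := by
    intro j
    refine hbasis _ (hW g _ (hbasis w hw i hi)) j ?_
    change ∑ k, cubicMatrix g.1 j k * (EuclideanSpace.single i (1 : ℂ) : Cn 4) k ≠ 0
    simpa using hcoef j i
  rw [eq_top_iff]
  intro x _
  have hx : x = ∑ j, x j • EuclideanSpace.single j (1 : ℂ) := by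
    ext k
    simp [Fin.sum_univ_four]
    fin_cases k <;> simp
  rw [hx]
  exact W.sum_mem fun j _ => W.smul_mem _ (hall j)

/-! ### Smooth structures on `SU(2)` and on the sphere -/

section Normalize

open Metric Set Topology

variable {E : Type*} [NormedAddCommGroup E] [InnerProductSpace ℝ E]

/-- The radial projection to the unit sphere, with a junk value at the origin. -/
noncomputable def sphereNormalize (x₀ : sphere (0 : E) 1) (v : E) : sphere (0 : E) 1 :=
  open Classical in
  if h : v = 0 then x₀ else ⟨‖v‖⁻¹ • v, by
    rw [mem_sphere_zero_iff_norm, norm_smul, norm_inv, norm_norm,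
      inv_mul_cancel₀ (norm_ne_zero_iff.2 h)]⟩

theorem sphereNormalize_val (x₀ : sphere (0 : E) 1) {v : E} (h : v ≠ 0) :
    (sphereNormalize x₀ v : E) = ‖v‖⁻¹ • v := by
  simp [sphereNormalize, h]

theorem sphereNormalize_coe (x₀ v : sphere (0 : E) 1) : sphereNormalize x₀ (v : E) = v := by
  have hv : ‖(v : E)‖ = 1 := mem_sphere_zero_iff_norm.1 v.2
  have h0 : (v : E) ≠ 0 := by
    rw [← norm_ne_zero_iff, hv]
    exact one_ne_zero
  apply Subtype.ext
  rw [sphereNormalize_val x₀ h0, hv, inv_one, one_smul]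

theorem contMDiffAt_sphereNormalize {d : ℕ} [Fact (Module.finrank ℝ E = d + 1)] {n : ℕ∞ω}
    (x₀ : sphere (0 : E) 1) {v : E} (hv : v ≠ 0) :
    ContMDiffAt 𝓘(ℝ, E) (𝓡 d) n (sphereNormalize x₀) v := by
  let U : TopologicalSpace.Opens E := ⟨{0}ᶜ, isClosed_singleton.isOpen_compl⟩
  have hU : ∀ u : U, ‖(u : E)‖ ≠ 0 := fun u => norm_ne_zero_iff.2 u.2
  have h1 : ContMDiff 𝓘(ℝ, E) 𝓘(ℝ, E) n fun u : U => ‖(u : E)‖⁻¹ • (u : E) := by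
    intro u
    have h : ContDiffAt ℝ n (fun v : E => ‖v‖⁻¹ • v) (u : E) :=
      ((contDiffAt_norm ℝ (show (u : E) ≠ 0 from u.2)).inv (hU u)).smul contDiffAt_id
    exact contMDiffAt_subtype_iff.2 h.contMDiffAt
  have h2 := h1.codRestrict_sphere (n := d) (fun u => by
    rw [mem_sphere_zero_iff_norm, norm_smul, norm_inv, norm_norm, inv_mul_cancel₀ (hU u)])
  refine (contMDiffAt_subtype_iff (U := U) (x := ⟨v, hv⟩)).1 ?_
  refine (h2 ⟨v, hv⟩).congr_of_eventuallyEq (Filter.Eventually.of_forall fun u => ?_)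
  exact Subtype.ext (sphereNormalize_val x₀ u.2)

/-- A map to the sphere is smooth if it is smooth as a map to the ambient space. -/
theorem contMDiffAt_sphere_iff {d : ℕ} [Fact (Module.finrank ℝ E = d + 1)] {n : ℕ∞ω}
    {F H X : Type*} [NormedAddCommGroup F] [NormedSpace ℝ F] [TopologicalSpace H]
    {I : ModelWithCorners ℝ F H} [TopologicalSpace X] [ChartedSpace H X]
    {f : X → sphere (0 : E) 1} {x : X} :
    ContMDiffAt I (𝓡 d) n f x ↔ ContMDiffAt I 𝓘(ℝ, E) n (fun y => (f y : E)) x := by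
  constructor
  · intro h
    exact contMDiff_coe_sphere.contMDiffAt.comp x h
  · intro h
    have h0 : (f x : E) ≠ 0 := by
      rw [← norm_ne_zero_iff, mem_sphere_zero_iff_norm.1 (f x).2]
      exact one_ne_zero
    have h1 := (contMDiffAt_sphereNormalize (d := d) (n := n) (f x) h0).comp x h
    refine h1.congr_of_eventuallyEq (Filter.Eventually.of_forall fun y => ?_)
    exact (sphereNormalize_coe _ _).symm

end Normalize

namespace SU2

open Metric Set Topology

theorem chartAt_eq (g : SU2) : chartAt (EuclideanSpace ℝ (Fin 3)) g =
    SU2.homeoSphere.toOpenPartialHomeomorph ≫ₕ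
      chartAt (EuclideanSpace ℝ (Fin 3)) (SU2.homeoSphere g) := rfl

theorem symm_chart_trans (e e' : OpenPartialHomeomorph (sphere (0 : Cn 2) 1)
    (EuclideanSpace ℝ (Fin 3))) :
    (SU2.homeoSphere.toOpenPartialHomeomorph ≫ₕ e).symm ≫ₕ
      (SU2.homeoSphere.toOpenPartialHomeomorph ≫ₕ e') = e.symm ≫ₕ e' := by
  apply OpenPartialHomeomorph.ext
  · intro x
    simp
  · intro x
    simp
  · ext x
    simp

instance : IsManifold (𝓡 3) ω SU2 where
  compatible := by
    rintro _ _ ⟨f, hf, e, he, rfl⟩ ⟨f', hf', e', he', rfl⟩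
    obtain rfl : f = SU2.homeoSphere.toOpenPartialHomeomorph := hf
    obtain rfl : f' = SU2.homeoSphere.toOpenPartialHomeomorph := hf'
    rw [symm_chart_trans]
    exact HasGroupoid.compatible he he'

theorem contMDiff_homeoSphere {n : ℕ∞ω} : ContMDiff (𝓡 3) (𝓡 3) n SU2.homeoSphere := by
  intro g
  have h1 : ContMDiffAt (𝓡 3) (𝓡 3) ω (chartAt (EuclideanSpace ℝ (Fin 3)) g) g :=
    contMDiffOn_chart.contMDiffAt ((chartAt _ g).open_source.mem_nhds (mem_chart_source _ g))
  have h2 : ContMDiffAt (𝓡 3) (𝓡 3) ω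
      (chartAt (EuclideanSpace ℝ (Fin 3)) (SU2.homeoSphere g)).symm
      (chartAt (EuclideanSpace ℝ (Fin 3)) g g) :=
    contMDiffOn_chart_symm.contMDiffAt ((chartAt _ _).open_target.mem_nhds
      (mem_chart_target _ (SU2.homeoSphere g)))
  refine ((h2.comp g h1).of_le le_top).congr_of_eventuallyEq ?_
  filter_upwards [(chartAt (EuclideanSpace ℝ (Fin 3)) g).open_source.mem_nhds
    (mem_chart_source _ g)] with k hk
  have hk' : SU2.homeoSphere k ∈
      (chartAt (EuclideanSpace ℝ (Fin 3)) (SU2.homeoSphere g)).source := by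
    rw [chartAt_eq] at hk
    exact hk.2
  exact ((chartAt _ (SU2.homeoSphere g)).left_inv hk').symm

theorem contMDiff_homeoSphere_symm {n : ℕ∞ω} :
    ContMDiff (𝓡 3) (𝓡 3) n SU2.homeoSphere.symm := by
  intro x
  set g := SU2.homeoSphere.symm x with hg
  have hx : SU2.homeoSphere g = x := SU2.homeoSphere.apply_symm_apply x
  have h1 : ContMDiffAt (𝓡 3) (𝓡 3) ω (chartAt (EuclideanSpace ℝ (Fin 3)) x) x :=
    contMDiffOn_chart.contMDiffAt ((chartAt _ x).open_source.mem_nhds (mem_chart_source _ x))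
  have h2 : ContMDiffAt (𝓡 3) (𝓡 3) ω (chartAt (EuclideanSpace ℝ (Fin 3)) g).symm
      (chartAt (EuclideanSpace ℝ (Fin 3)) x x) := by
    refine contMDiffOn_chart_symm.contMDiffAt ((chartAt _ _).open_target.mem_nhds ?_)
    simp [chartAt_eq, hx]
  refine ((h2.comp x h1).of_le le_top).congr_of_eventuallyEq ?_
  filter_upwards [(chartAt (EuclideanSpace ℝ (Fin 3)) x).open_source.mem_nhds
    (mem_chart_source _ x)] with y hy
  simp only [Function.comp_apply, chartAt_eq, hx]
  simp [hy]

/-- Smoothness of maps to `SU(2)` is smoothness of the first column. -/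
theorem contMDiffAt_iff {n : ℕ∞ω}
    {F H X : Type*} [NormedAddCommGroup F] [NormedSpace ℝ F] [TopologicalSpace H]
    {I : ModelWithCorners ℝ F H} [TopologicalSpace X] [ChartedSpace H X] {f : X → SU2} {x : X} :
    ContMDiffAt I (𝓡 3) n f x ↔
      ContMDiffAt I 𝓘(ℝ, Cn 2) n (fun y => (SU2.homeoSphere (f y) : Cn 2)) x := by
  rw [← contMDiffAt_sphere_iff (d := 3) (f := fun y => SU2.homeoSphere (f y))]
  constructor
  · exact fun h => contMDiff_homeoSphere.contMDiffAt.comp x h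
  · intro h
    have h1 := (contMDiff_homeoSphere_symm (n := n)).contMDiffAt.comp x h
    simpa [Function.comp_def] using h1

theorem contMDiff_column {n : ℕ∞ω} :
    ContMDiff (𝓡 3) 𝓘(ℝ, Cn 2) n fun g : SU2 => (SU2.homeoSphere g : Cn 2) :=
  fun _ => contMDiffAt_iff.1 contMDiffAt_id

theorem contDiff_matrix_mul {n : ℕ∞ω} : ContDiff ℝ n fun z : Cn 2 × Cn 2 =>
    (!₂[z.1 0 * z.2 0 - star (z.1 1) * z.2 1, z.1 1 * z.2 0 + star (z.1 0) * z.2 1] : Cn 2) := by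
  have h1 : ∀ k, ContDiff ℝ n fun z : Cn 2 × Cn 2 => z.1 k := fun k =>
    ((EuclideanSpace.proj (𝕜 := ℂ) (ι := Fin 2) k).restrictScalars ℝ).contDiff.comp
      contDiff_fst
  have h2 : ∀ k, ContDiff ℝ n fun z : Cn 2 × Cn 2 => z.2 k := fun k =>
    ((EuclideanSpace.proj (𝕜 := ℂ) (ι := Fin 2) k).restrictScalars ℝ).contDiff.comp
      contDiff_snd
  have h3 : ∀ k, ContDiff ℝ n fun z : Cn 2 × Cn 2 => star (z.1 k) := fun k =>
    (starL' ℝ (A := ℂ)).contDiff.comp (h1 k)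
  rw [contDiff_piLp]
  intro i
  fin_cases i
  · exact ((h1 0).mul (h2 0)).sub ((h3 1).mul (h2 1))
  · exact ((h1 1).mul (h2 0)).add ((h3 0).mul (h2 1))

theorem contDiff_matrix_inv {n : ℕ∞ω} : ContDiff ℝ n fun z : Cn 2 =>
    (!₂[star (z 0), -z 1] : Cn 2) := by
  have h1 : ∀ k, ContDiff ℝ n fun z : Cn 2 => z k := fun k =>
    ((EuclideanSpace.proj (𝕜 := ℂ) (ι := Fin 2) k).restrictScalars ℝ).contDiff
  rw [contDiff_piLp]
  intro i
  fin_cases i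
  · exact (starL' ℝ (A := ℂ)).contDiff.comp (h1 0)
  · exact (h1 1).neg

theorem column_mul (g h : SU2) : (SU2.homeoSphere (g * h) : Cn 2) =
    !₂[g.1 0 0 * h.1 0 0 - star (g.1 1 0) * h.1 1 0,
      g.1 1 0 * h.1 0 0 + star (g.1 0 0) * h.1 1 0] := by
  have hg := SU2.entries g
  ext i
  fin_cases i
  · change (g.1 * h.1) 0 0 = _
    rw [Matrix.mul_apply, Fin.sum_univ_two, hg.1]
    simp [sub_eq_add_neg]
  · change (g.1 * h.1) 1 0 = _
    rw [Matrix.mul_apply, Fin.sum_univ_two, hg.2]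
    simp

theorem column_inv (g : SU2) : (SU2.homeoSphere g⁻¹ : Cn 2) = !₂[star (g.1 0 0), -g.1 1 0] := by
  have hg := SU2.entries g
  ext i
  fin_cases i
  · change star (g.1 0 0) = _
    simp
  · change star (g.1 0 1) = _
    rw [hg.1]
    simp

instance : LieGroup (𝓡 3) ω SU2 where
  contMDiff_mul := by
    intro z
    rw [contMDiffAt_iff]
    simp only [column_mul]
    have h : ContMDiffAt ((𝓡 3).prod (𝓡 3)) 𝓘(ℝ, Cn 2 × Cn 2) ω (fun z : SU2 × SU2 =>
        ((SU2.homeoSphere z.1 : Cn 2), (SU2.homeoSphere z.2 : Cn 2))) z :=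
      (contMDiff_column.comp contMDiff_fst).prodMk_space
        (contMDiff_column.comp contMDiff_snd) |>.contMDiffAt
    exact (contDiff_matrix_mul.contMDiff.contMDiffAt).comp z h
  contMDiff_inv := by
    intro z
    rw [contMDiffAt_iff]
    simp only [column_inv]
    exact (contDiff_matrix_inv.contMDiff.contMDiffAt).comp z contMDiff_column.contMDiffAt

instance : IsTopologicalGroup SU2 := topologicalGroup_of_lieGroup (𝓡 3) ω

instance : CompactSpace SU2 := SU2.homeoSphere.symm.compactSpace

end SU2

/-- The unit sphere in `ℂ⁴` with the action of `SU(2)` on binary cubic forms. -/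
abbrev S7 : Type := RepSphere cubicRep

namespace S7

open Metric Set Topology

instance : T2Space S7 := inferInstanceAs (T2Space (sphere (0 : Cn 4) 1))

instance : CompactSpace S7 := inferInstanceAs (CompactSpace (sphere (0 : Cn 4) 1))

instance : SecondCountableTopology S7 :=
  inferInstanceAs (SecondCountableTopology (sphere (0 : Cn 4) 1))

instance : IsManifold (𝓡 7) ω S7 := inferInstanceAs (IsManifold (𝓡 7) ω (sphere (0 : Cn 4) 1))

/-- The inclusion of the unit sphere into `ℂ⁴`. -/
def coe (x : S7) : Cn 4 := Subtype.val (p := (· ∈ sphere (0 : Cn 4) 1)) x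

theorem coe_injective : Function.Injective coe := fun _ _ h => Subtype.ext h

theorem norm_coe (x : S7) : ‖coe x‖ = 1 := mem_sphere_zero_iff_norm.1 x.2

theorem coe_ne_zero (x : S7) : coe x ≠ 0 := by
  rw [← norm_ne_zero_iff, norm_coe]
  exact one_ne_zero

theorem coe_smul (g : SU2) (x : S7) : coe (g • x) = cubicRep g (coe x) := rfl

theorem isEmbedding_coe : IsEmbedding coe := IsEmbedding.subtypeVal

theorem continuous_coe : Continuous coe := isEmbedding_coe.continuous

theorem contMDiffAt_iff {n : ℕ∞ω}
    {F H X : Type*} [NormedAddCommGroup F] [NormedSpace ℝ F] [TopologicalSpace H]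
    {I : ModelWithCorners ℝ F H} [TopologicalSpace X] [ChartedSpace H X] {f : X → S7} {x : X} :
    ContMDiffAt I (𝓡 7) n f x ↔ ContMDiffAt I 𝓘(ℝ, Cn 4) n (fun y => coe (f y)) x :=
  contMDiffAt_sphere_iff (d := 7) (E := Cn 4) (f := f)

theorem contMDiff_coe {n : ℕ∞ω} : ContMDiff (𝓡 7) 𝓘(ℝ, Cn 4) n coe :=
  fun _ => contMDiffAt_iff.1 contMDiffAt_id

theorem contMDiff_smul {n : ℕ∞ω} :
    ContMDiff ((𝓡 3).prod (𝓡 7)) (𝓡 7) n fun z : SU2 × S7 => z.1 • z.2 := by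
  intro z
  rw [contMDiffAt_iff]
  have h : ContMDiffAt ((𝓡 3).prod (𝓡 7)) 𝓘(ℝ, Cn 2 × Cn 4) n (fun z : SU2 × S7 =>
      ((SU2.homeoSphere z.1 : Cn 2), coe z.2)) z :=
    (SU2.contMDiff_column.comp contMDiff_fst).prodMk_space
      (contMDiff_coe.comp contMDiff_snd) |>.contMDiffAt
  have h2 := (contDiff_quatAct.contMDiff.contMDiffAt).comp z h
  refine h2.congr_of_eventuallyEq (Filter.Eventually.of_forall fun y => ?_)
  exact (quatAct_homeoSphere y.1 (coe y.2)).symm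

instance : ContinuousSMul SU2 S7 := ⟨(contMDiff_smul (n := 0)).continuous⟩

end S7

/-! ### The normal spaces of the orbits -/

section Infinitesimal

open Matrix

/-- The derivative of `cubicMatrix` at the identity in the direction of the quaternion `β`. -/
noncomputable def cubicDeriv (β : Cn 2) : Matrix (Fin 4) (Fin 4) ℂ :=
  let w : ℂ := (√3 : ℝ)
  let a := β 0
  let b := β 1
  !![3 * a, -w * star b, 0, 0;
    w * b, 2 * a + star a, -2 * star b, 0;
    0, 2 * b, a + 2 * star a, -w * star b;
    0, 0, w * b, 3 * star a]

/-- The determinant is `9 (|a|² + |b|²) (8 (Re a)² + |a|² + |b|²)`. -/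
theorem det_cubicDeriv_ne_zero {β : Cn 2} (h : β ≠ 0) : (cubicDeriv β).det ≠ 0 := by
  have hw := sqrt_three_sq
  have hdet : (cubicDeriv β).det = ((9 * (‖β 0‖ ^ 2 + ‖β 1‖ ^ 2) *
      (8 * (β 0).re ^ 2 + ‖β 0‖ ^ 2 + ‖β 1‖ ^ 2) : ℝ) : ℂ) := by
    have hre : (((β 0).re : ℝ) : ℂ) = (β 0 + (starRingEnd ℂ) (β 0)) / 2 := by
      rw [Complex.re_eq_add_conj]
    push_cast
    rw [hre, ← Complex.mul_conj', ← Complex.mul_conj']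
    simp only [cubicDeriv]
    generalize ((√3 : ℝ) : ℂ) = w at hw
    simp [Matrix.det_succ_row_zero, Fin.sum_univ_succ, Fin.succAbove]
    linear_combination (6 * (β 1 * (starRingEnd ℂ) (β 1)) * (β 0 * (starRingEnd ℂ) (β 0) +
      β 0 ^ 2 + (starRingEnd ℂ) (β 0) ^ 2) +
      (β 1 * (starRingEnd ℂ) (β 1)) ^ 2 * (w ^ 2 + 3)) * hw
  rw [hdet, Complex.ofReal_ne_zero]
  have hpos : 0 < ‖β 0‖ ^ 2 + ‖β 1‖ ^ 2 := by
    by_contra! h0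
    refine h ?_
    have h1 : ‖β 0‖ = 0 := by nlinarith [sq_nonneg ‖β 0‖, sq_nonneg ‖β 1‖]
    have h2 : ‖β 1‖ = 0 := by nlinarith [sq_nonneg ‖β 0‖, sq_nonneg ‖β 1‖]
    ext i
    fin_cases i
    · simpa using h1
    · simpa using h2
  have : 0 < 8 * (β 0).re ^ 2 + ‖β 0‖ ^ 2 + ‖β 1‖ ^ 2 := by nlinarith [sq_nonneg (β 0).re]
  positivity

theorem hasDerivAt_cubicMatrix {p q r s : ℝ → ℂ} {a b : ℂ} (hp : HasDerivAt p a 0)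
    (hq : HasDerivAt q (-star b) 0) (hr : HasDerivAt r b 0) (hs : HasDerivAt s (star a) 0)
    (hp0 : p 0 = 1) (hq0 : q 0 = 0) (hr0 : r 0 = 0) (hs0 : s 0 = 1) (i j : Fin 4) :
    HasDerivAt (fun t => cubicMatrix !![p t, q t; r t, s t] i j) (cubicDeriv !₂[a, b] i j) 0 := by
  have h2p := hp.const_mul 2
  have h2q := hq.const_mul 2
  have P2 := hp.fun_pow 2
  have Q2 := hq.fun_pow 2
  have R2 := hr.fun_pow 2
  have S2 := hs.fun_pow 2
  fin_cases i <;> fin_cases j <;> simp only [cubicMatrix, cubicDeriv]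
  · exact (hp.fun_pow 3).congr_deriv (by simp [hp0])
  · exact ((P2.fun_mul hq).const_mul _).congr_deriv (by simp [hp0, hq0])
  · exact ((hp.fun_mul Q2).const_mul _).congr_deriv (by simp [hp0, hq0])
  · exact (hq.fun_pow 3).congr_deriv (by simp [hq0])
  · exact ((P2.fun_mul hr).const_mul _).congr_deriv (by simp [hp0, hr0])
  · exact ((P2.fun_mul hs).fun_add ((h2p.fun_mul hr).fun_mul hq)).congr_deriv
      (by simp [hp0, hq0, hr0, hs0])
  · exact (((h2p.fun_mul hq).fun_mul hs).fun_add (hr.fun_mul Q2)).congr_deriv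
      (by simp [hp0, hq0, hr0, hs0])
  · exact ((Q2.fun_mul hs).const_mul _).congr_deriv (by simp [hq0, hs0])
  · exact ((hp.fun_mul R2).const_mul _).congr_deriv (by simp [hp0, hr0])
  · exact (((h2p.fun_mul hr).fun_mul hs).fun_add (R2.fun_mul hq)).congr_deriv
      (by simp [hp0, hq0, hr0, hs0])
  · exact ((hp.fun_mul S2).fun_add ((h2q.fun_mul hr).fun_mul hs)).congr_deriv
      (by simp [hp0, hq0, hr0, hs0])
  · exact ((hq.fun_mul S2).const_mul _).congr_deriv (by simp [hq0, hs0])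
  · exact (hr.fun_pow 3).congr_deriv (by simp [hr0])
  · exact ((R2.fun_mul hs).const_mul _).congr_deriv (by simp [hr0, hs0])
  · exact ((hr.fun_mul S2).const_mul _).congr_deriv (by simp [hr0, hs0])
  · exact (hs.fun_pow 3).congr_deriv (by simp [hs0])

/-- The quaternion `1`. -/
noncomputable def quatOne : Cn 2 := !₂[1, 0]

theorem quatMatrix_quatOne : quatMatrix quatOne = 1 := by
  ext i j
  fin_cases i <;> fin_cases j <;> simp [quatMatrix, quatOne]

theorem quatAct_quatOne (x : Cn 4) : quatAct quatOne x = x := by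
  rw [quatAct, quatMatrix_quatOne, cubicMatrix_one, map_one]
  rfl

theorem homeoSphere_one : (SU2.homeoSphere 1 : Cn 2) = quatOne := by
  ext i
  fin_cases i
  · change (1 : Matrix (Fin 2) (Fin 2) ℂ) 0 0 = _
    simp [quatOne]
  · change (1 : Matrix (Fin 2) (Fin 2) ℂ) 1 0 = _
    simp [quatOne]

/-- The derivative at the identity of the orbit map of `x` under the action of the quaternions; its
image is spanned by `x` and the tangent space of the orbit of `x` under `SU(2)`. -/
noncomputable def orbitDeriv (x : Cn 4) : Cn 2 →L[ℝ] Cn 4 :=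
  fderiv ℝ (fun m => quatAct m x) quatOne

theorem contDiff_quatAct_left {n : ℕ∞ω} (x : Cn 4) : ContDiff ℝ n fun m : Cn 2 => quatAct m x := by
  have h : ContDiff ℝ n fun m : Cn 2 => (m, x) := contDiff_prodMk_left x
  have h2 : ContDiff ℝ n ((fun z : Cn 2 × Cn 4 => quatAct z.1 z.2) ∘ fun m : Cn 2 => (m, x)) :=
    ContDiff.comp contDiff_quatAct h
  exact h2

theorem hasFDerivAt_orbit (x : Cn 4) :
    HasFDerivAt (fun m => quatAct m x) (orbitDeriv x) quatOne :=
  ((contDiff_quatAct_left (n := 1) x).differentiable one_ne_zero quatOne).hasFDerivAt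

theorem orbitDeriv_apply (x : Cn 4) (β : Cn 2) (i : Fin 4) :
    orbitDeriv x β i = ∑ j, cubicDeriv β i j * x j := by
  have h1 : HasDerivAt (fun t : ℝ => quatOne + t • β) β 0 := by
    simpa using ((hasDerivAt_id (0 : ℝ)).smul_const β).const_add quatOne
  have h2 : HasDerivAt (fun t : ℝ => quatAct (quatOne + t • β) x) (orbitDeriv x β) 0 := by
    have := hasFDerivAt_orbit x
    rw [← add_zero quatOne, ← zero_smul ℝ β] at this
    exact HasFDerivAt.comp_hasDerivAt (0 : ℝ) this h1
  have h3 : HasDerivAt (fun t : ℝ => quatAct (quatOne + t • β) x i) (orbitDeriv x β i) 0 :=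
    HasFDerivAt.comp_hasDerivAt (0 : ℝ)
      ((EuclideanSpace.proj (𝕜 := ℂ) (ι := Fin 4) i).restrictScalars ℝ).hasFDerivAt h2
  have h4 : ∀ k, HasDerivAt (fun t : ℝ => (quatOne + t • β) k) (β k) 0 := fun k =>
    HasFDerivAt.comp_hasDerivAt (0 : ℝ)
      ((EuclideanSpace.proj (𝕜 := ℂ) (ι := Fin 2) k).restrictScalars ℝ).hasFDerivAt h1
  have h5 : ∀ k, HasDerivAt (fun t : ℝ => star ((quatOne + t • β) k)) (star (β k)) 0 := fun k =>
    HasFDerivAt.comp_hasDerivAt (0 : ℝ) (starL' ℝ (A := ℂ)).hasFDerivAt (h4 k)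
  have h6 : HasDerivAt (fun t : ℝ => quatAct (quatOne + t • β) x i)
      (∑ j, cubicDeriv !₂[β 0, β 1] i j * x j) 0 := by
    simp only [quatAct_apply]
    refine HasDerivAt.fun_sum fun j _ => HasDerivAt.mul_const ?_ _
    exact hasDerivAt_cubicMatrix (h4 0) (h5 1).neg (h4 1) (h5 0) (by simp [quatOne])
      (by simp [quatOne]) (by simp [quatOne]) (by simp [quatOne]) i j
  exact h3.unique h6

theorem orbitDeriv_injective {x : Cn 4} (hx : x ≠ 0) : Function.Injective (orbitDeriv x) := by
  rw [injective_iff_map_eq_zero]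
  intro β hβ
  by_contra h0
  refine hx ?_
  have h := Matrix.eq_zero_of_mulVec_eq_zero (det_cubicDeriv_ne_zero h0) (v := fun j => x j) (by
    funext i
    change ∑ j, cubicDeriv β i j * x j = 0
    rw [← orbitDeriv_apply, hβ]
    rfl)
  ext j
  exact congrFun h j

end Infinitesimal

/-! ### Slices -/

section Slice

open Metric Set Topology Filter

/-- Euclidean four-space, the model of the normal spaces of the orbits. -/
abbrev E4 : Type := EuclideanSpace ℝ (Fin 4)

/-- The real orthogonal complement of `x` and the tangent space of the orbit of `x`. -/
noncomputable def normalSpace (x : Cn 4) : Submodule ℝ (Cn 4) :=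
  (LinearMap.range (orbitDeriv x).toLinearMap)ᗮ

theorem finrank_normalSpace {x : Cn 4} (hx : x ≠ 0) : Module.finrank ℝ (normalSpace x) = 4 := by
  have h1 := (LinearMap.range (orbitDeriv x).toLinearMap).finrank_add_finrank_orthogonal
  have h2 : Module.finrank ℝ (LinearMap.range (orbitDeriv x).toLinearMap) = 4 := by
    rw [LinearMap.finrank_range_of_inj (orbitDeriv_injective hx)]
    exact finrank_real_C2.out
  rw [h2, finrank_real_C4.out] at h1
  change Module.finrank ℝ (LinearMap.range (orbitDeriv x).toLinearMap)ᗮ = 4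
  omega

theorem orbitDeriv_quatOne (x : Cn 4) : orbitDeriv x quatOne = (3 : ℝ) • x := by
  ext i
  rw [orbitDeriv_apply, Fin.sum_univ_four]
  fin_cases i
  · simp [cubicDeriv, quatOne]
  · simp [cubicDeriv, quatOne]
    exact Or.inl (by ring)
  · simp [cubicDeriv, quatOne]
    exact Or.inl (by ring)
  · simp [cubicDeriv, quatOne]

theorem inner_normalSpace {x : Cn 4} (v : normalSpace x) : inner ℝ x (v : Cn 4) = 0 := by
  have h : inner ℝ (orbitDeriv x quatOne) (v : Cn 4) = 0 :=
    (Submodule.mem_orthogonal _ _).1 v.2 _ ⟨quatOne, rfl⟩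
  rw [orbitDeriv_quatOne, inner_smul_left] at h
  simpa using h

/-- An isometric parametrization of the normal space of `x`. -/
noncomputable def normalEquiv (x : S7) : E4 ≃ₗᵢ[ℝ] normalSpace (S7.coe x) :=
  ((stdOrthonormalBasis ℝ (normalSpace (S7.coe x))).reindex
    (finCongr (finrank_normalSpace x.coe_ne_zero))).repr.symm

/-- The point of the affine normal space at `x` with coordinates `v`. -/
noncomputable def affinePoint (x : S7) (v : E4) : Cn 4 := S7.coe x + (normalEquiv x v : Cn 4)

theorem inner_affinePoint (x : S7) (v : E4) : inner ℝ (S7.coe x) (affinePoint x v) = 1 := by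
  rw [affinePoint, inner_add_right, inner_normalSpace, real_inner_self_eq_norm_sq, S7.norm_coe]
  norm_num

theorem affinePoint_ne_zero (x : S7) (v : E4) : affinePoint x v ≠ 0 := by
  intro h
  have := inner_affinePoint x v
  rw [h, inner_zero_right] at this
  exact zero_ne_one this

theorem affinePoint_zero (x : S7) : affinePoint x 0 = S7.coe x := by simp [affinePoint]

theorem contDiff_affinePoint {n : ℕ∞ω} (x : S7) : ContDiff ℝ n (affinePoint x) :=
  contDiff_const.add ((normalSpace (S7.coe x)).subtypeL.contDiff.comp
    (normalEquiv x).toContinuousLinearEquiv.contDiff)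

/-- The slice through `x`: the radial projection of the affine normal space to the sphere. -/
noncomputable def slice (x : S7) (v : E4) : S7 :=
  sphereNormalize (E := Cn 4) x (affinePoint x v)

theorem coe_slice (x : S7) (v : E4) :
    S7.coe (slice x v) = ‖affinePoint x v‖⁻¹ • affinePoint x v :=
  sphereNormalize_val (E := Cn 4) x (affinePoint_ne_zero x v)

theorem slice_zero (x : S7) : slice x 0 = x := by
  apply S7.coe_injective
  rw [coe_slice, affinePoint_zero, S7.norm_coe, inv_one, one_smul]

theorem contMDiff_slice {n : ℕ∞ω} (x : S7) : ContMDiff 𝓘(ℝ, E4) (𝓡 7) n (slice x) := by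
  intro v
  exact (contMDiffAt_sphereNormalize (E := Cn 4) (d := 7) x (affinePoint_ne_zero x v)).comp v
    (contDiff_affinePoint x).contMDiff.contMDiffAt

theorem slice_injective (x : S7) : Function.Injective (slice x) := by
  intro u v h
  have h1 := congrArg S7.coe h
  rw [coe_slice, coe_slice] at h1
  have h2 := congrArg (fun y => inner ℝ (S7.coe x) y) h1
  simp only [inner_smul_right, inner_affinePoint, mul_one] at h2
  rw [h2] at h1
  have h3 := smul_right_injective (Cn 4)
    (inv_ne_zero (norm_ne_zero_iff.2 (affinePoint_ne_zero x v))) h1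
  exact (normalEquiv x).injective (Subtype.ext (add_left_cancel h3))

/-- The homogeneous extension `(m, v) ↦ m • (x + v)` of the tube map, on a quaternion times the
normal space. Its derivative at `(1, 0)` is invertible. -/
noncomputable def tubeMap (x : S7) (z : Cn 2 × E4) : Cn 4 := quatAct z.1 (affinePoint x z.2)

theorem contDiff_tubeMap {n : ℕ∞ω} (x : S7) : ContDiff ℝ n (tubeMap x) := by
  have h : ContDiff ℝ n fun z : Cn 2 × E4 => (z.1, affinePoint x z.2) :=
    contDiff_fst.prodMk ((contDiff_affinePoint x).comp contDiff_snd)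
  have h2 : ContDiff ℝ n ((fun z : Cn 2 × Cn 4 => quatAct z.1 z.2) ∘
      fun z : Cn 2 × E4 => (z.1, affinePoint x z.2)) := ContDiff.comp contDiff_quatAct h
  exact h2

theorem fderiv_tubeMap (x : S7) (β : Cn 2) (v : E4) :
    fderiv ℝ (tubeMap x) (quatOne, 0) (β, v) =
      orbitDeriv (S7.coe x) β + (normalEquiv x v : Cn 4) := by
  have hd : HasFDerivAt (tubeMap x) (fderiv ℝ (tubeMap x) (quatOne, 0)) (quatOne, 0) :=
    ((contDiff_tubeMap (n := 1) x).differentiable one_ne_zero _).hasFDerivAt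
  have h1 : HasFDerivAt (fun m : Cn 2 => tubeMap x (m, 0))
      ((fderiv ℝ (tubeMap x) (quatOne, 0)).comp (ContinuousLinearMap.inl ℝ (Cn 2) E4)) quatOne :=
    HasFDerivAt.comp (g := tubeMap x) (f := fun m : Cn 2 => (m, (0 : E4))) quatOne hd
      (hasFDerivAt_prodMk_left quatOne (0 : E4))
  have h2 : HasFDerivAt (fun v : E4 => tubeMap x (quatOne, v))
      ((fderiv ℝ (tubeMap x) (quatOne, 0)).comp (ContinuousLinearMap.inr ℝ (Cn 2) E4)) 0 :=
    HasFDerivAt.comp (g := tubeMap x) (f := fun v : E4 => (quatOne, v)) 0 hd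
      (hasFDerivAt_prodMk_right quatOne (0 : E4))
  have h1' : HasFDerivAt (fun m : Cn 2 => tubeMap x (m, 0)) (orbitDeriv (S7.coe x)) quatOne := by
    simp only [tubeMap, affinePoint_zero]
    exact hasFDerivAt_orbit _
  set N : E4 →L[ℝ] Cn 4 := (normalSpace (S7.coe x)).subtypeL.comp
    (normalEquiv x).toContinuousLinearEquiv.toContinuousLinearMap with hN
  have h2' : HasFDerivAt (fun v : E4 => tubeMap x (quatOne, v)) N 0 := by
    simp only [tubeMap, quatAct_quatOne]
    exact N.hasFDerivAt.const_add (S7.coe x)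
  have e1 := congrArg (fun f => f β) (h1.unique h1')
  have e2 := congrArg (fun f => f v) (h2.unique h2')
  simp only [ContinuousLinearMap.comp_apply, ContinuousLinearMap.inl_apply,
    ContinuousLinearMap.inr_apply] at e1 e2
  have : ((β, v) : Cn 2 × E4) = (β, 0) + (0, v) := by simp
  rw [this, map_add, e1, e2]
  rfl

theorem fderiv_tubeMap_injective (x : S7) :
    Function.Injective (fderiv ℝ (tubeMap x) (quatOne, 0)) := by
  rw [injective_iff_map_eq_zero]
  rintro ⟨β, v⟩ h
  rw [fderiv_tubeMap] at h
  have horth : inner ℝ (orbitDeriv (S7.coe x) β) (normalEquiv x v : Cn 4) = 0 :=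
    (Submodule.mem_orthogonal _ _).1 (normalEquiv x v).2 _ ⟨β, rfl⟩
  have h1 : orbitDeriv (S7.coe x) β = -(normalEquiv x v : Cn 4) := eq_neg_of_add_eq_zero_left h
  rw [h1, inner_neg_left, neg_eq_zero, inner_self_eq_zero] at horth
  have hv : v = 0 := by
    refine (normalEquiv x).injective (Subtype.ext ?_)
    rw [horth, map_zero]
    rfl
  have hβ : β = 0 := by
    refine orbitDeriv_injective x.coe_ne_zero ?_
    rw [h1, horth, neg_zero, map_zero]
  rw [hβ, hv]
  rfl

theorem exists_tubeMap_inverse (x : S7) : ∃ Θ : Cn 4 → Cn 2 × E4,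
    (∀ᶠ y in 𝓝 (S7.coe x), ContDiffAt ℝ ω Θ y) ∧
    (∀ᶠ y in 𝓝 (S7.coe x), tubeMap x (Θ y) = y) ∧
    (∀ᶠ z in 𝓝 (quatOne, (0 : E4)), Θ (tubeMap x z) = z) := by
  have hfin : Module.finrank ℝ (Cn 2 × E4) = Module.finrank ℝ (Cn 4) := by
    rw [Module.finrank_prod, finrank_real_C2.out, finrank_real_C4.out]
    simp
  set f' : (Cn 2 × E4) ≃L[ℝ] Cn 4 := (LinearEquiv.ofInjectiveOfFinrankEq
    (fderiv ℝ (tubeMap x) (quatOne, 0)).toLinearMap (fderiv_tubeMap_injective x)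
    hfin).toContinuousLinearEquiv with hf'
  have hc : ContDiffAt ℝ ω (tubeMap x) (quatOne, 0) := (contDiff_tubeMap x).contDiffAt
  have hd : HasFDerivAt (tubeMap x) (f' : Cn 2 × E4 →L[ℝ] Cn 4) (quatOne, 0) := by
    have := ((contDiff_tubeMap (n := 1) x).differentiable one_ne_zero (quatOne, 0)).hasFDerivAt
    have hcoe : (f' : Cn 2 × E4 →L[ℝ] Cn 4) = fderiv ℝ (tubeMap x) (quatOne, 0) :=
      ContinuousLinearMap.ext fun z => rfl
    rw [hcoe]
    exact this
  have hs : HasStrictFDerivAt (tubeMap x) (f' : Cn 2 × E4 →L[ℝ] Cn 4) (quatOne, 0) :=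
    hc.hasStrictFDerivAt' hd (by simp)
  have hx : tubeMap x (quatOne, 0) = S7.coe x := by
    simp [tubeMap, quatAct_quatOne, affinePoint_zero]
  refine ⟨hc.localInverse hd (by simp), ?_, ?_, ?_⟩
  · have := (hc.to_localInverse hd (by simp)).eventually (by simp)
    rwa [hx] at this
  · have := hs.eventually_right_inverse
    rwa [hx] at this
  · exact hs.eventually_left_inverse

end Slice

/-! ### Tubes around orbits -/

section Tube

open Metric Set Topology Filter

theorem cubicRep_real_smul (g : SU2) (c : ℝ) (y : Cn 4) :
    cubicRep g (c • y) = c • cubicRep g y := by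
  rw [← Complex.coe_smul, ← Complex.coe_smul, map_smul]

/-- The tube map `(g, v) ↦ g • s v` around the orbit of `x`, where `s` is the slice at `x`. -/
noncomputable def tube (x : S7) (z : SU2 × E4) : S7 := z.1 • slice x z.2

theorem tube_one (x : S7) (v : E4) : tube x (1, v) = slice x v := one_smul _ _

theorem contMDiff_tube {n : ℕ∞ω} (x : S7) :
    ContMDiff ((𝓡 3).prod (𝓡 4)) (𝓡 7) n (tube x) := by
  have h1 : ContMDiff ((𝓡 3).prod (𝓡 4)) (𝓡 7) n fun z : SU2 × E4 => slice x z.2 :=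
    ContMDiff.comp (g := slice x) (f := Prod.snd) (contMDiff_slice x) contMDiff_snd
  have h : ContMDiff ((𝓡 3).prod (𝓡 4)) ((𝓡 3).prod (𝓡 7)) n
      fun z : SU2 × E4 => (z.1, slice x z.2) :=
    ContMDiff.prodMk contMDiff_fst h1
  have h2 : ContMDiff ((𝓡 3).prod (𝓡 4)) (𝓡 7) n ((fun z : SU2 × S7 => z.1 • z.2) ∘
      fun z : SU2 × E4 => (z.1, slice x z.2)) := ContMDiff.comp S7.contMDiff_smul h
  exact h2

theorem quatOne_ne_zero : quatOne ≠ 0 := by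
  rw [← homeoSphere_one, ← norm_ne_zero_iff, mem_sphere_zero_iff_norm.1 (SU2.homeoSphere 1).2]
  exact one_ne_zero

theorem quatAct_smul_column (c : ℝ) (g : SU2) (y : Cn 4) :
    quatAct (c • (SU2.homeoSphere g : Cn 2)) y = c ^ 3 • cubicRep g y := by
  rw [quatAct_real_smul, quatAct_homeoSphere]

/-- The tube map is a local diffeomorphism at `(1, 0)`: the local inverse of its homogeneous
extension is composed with the radial projection of the quaternions to `SU(2)`. -/
theorem exists_tube_inverse (x : S7) : ∃ Ψ : S7 → SU2 × E4,
    (∀ᶠ y in 𝓝 x, ContMDiffAt (𝓡 7) ((𝓡 3).prod (𝓡 4)) ∞ Ψ y) ∧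
    (∀ᶠ y in 𝓝 x, tube x (Ψ y) = y) ∧
    (∀ᶠ z in 𝓝 ((1 : SU2), (0 : E4)), Ψ (tube x z) = z) := by
  obtain ⟨Θ, hΘ1, hΘ2, hΘ3⟩ := exists_tubeMap_inverse x
  have hx : Θ (S7.coe x) = (quatOne, 0) := by
    have := hΘ3.self_of_nhds
    rwa [tubeMap, quatAct_quatOne, affinePoint_zero] at this
  have hcoe : Tendsto S7.coe (𝓝 x) (𝓝 (S7.coe x)) := S7.continuous_coe.continuousAt
  have hne : ∀ᶠ y in 𝓝 (S7.coe x), (Θ y).1 ≠ 0 := by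
    have hc : ContinuousAt (fun y => (Θ y).1) (S7.coe x) :=
      continuousAt_fst.comp hΘ1.self_of_nhds.continuousAt
    refine hc.eventually_ne ?_
    rw [hx]
    exact quatOne_ne_zero
  set ν : Cn 2 → SU2 := fun m => SU2.homeoSphere.symm (sphereNormalize (SU2.homeoSphere 1) m)
    with hν
  have hνval : ∀ m, m ≠ 0 → (SU2.homeoSphere (ν m) : Cn 2) = ‖m‖⁻¹ • m := by
    intro m hm
    rw [hν]
    simp only [Homeomorph.apply_symm_apply]
    exact sphereNormalize_val _ hm
  refine ⟨fun y => (ν (Θ (S7.coe y)).1, (Θ (S7.coe y)).2), ?_, ?_, ?_⟩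
  · filter_upwards [hcoe.eventually hΘ1, hcoe.eventually hne] with y h1 h2
    have h3 : ContMDiffAt (𝓡 7) 𝓘(ℝ, Cn 2 × E4) ∞ (fun y => Θ (S7.coe y)) y :=
      (h1.of_le le_top).contMDiffAt.comp y S7.contMDiff_coe.contMDiffAt
    refine ContMDiffAt.prodMk ?_ ?_
    · have h4 : ContMDiffAt (𝓡 7) 𝓘(ℝ, Cn 2) ∞ (fun y => (Θ (S7.coe y)).1) y :=
        (contDiff_fst.contMDiff.contMDiffAt).comp y h3
      have h5 := (contMDiffAt_sphereNormalize (d := 3) (n := ∞) (SU2.homeoSphere 1) h2)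
      exact SU2.contMDiff_homeoSphere_symm.contMDiffAt.comp y (h5.comp y h4)
    · exact (contDiff_snd.contMDiff.contMDiffAt).comp y h3
  · filter_upwards [hcoe.eventually hΘ2, hcoe.eventually hne] with y h1 h2
    set m := (Θ (S7.coe y)).1
    set v := (Θ (S7.coe y)).2
    have hm : ‖m‖ ≠ 0 := norm_ne_zero_iff.2 h2
    have hy : ‖m‖ ^ 3 • cubicRep (ν m) (affinePoint x v) = S7.coe y := by
      rw [← h1, tubeMap, ← quatAct_smul_column, hνval m h2, smul_inv_smul₀ hm]
    have hnorm := congrArg norm hy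
    rw [norm_smul, LinearIsometryEquiv.norm_map, S7.norm_coe, norm_pow, norm_norm] at hnorm
    apply S7.coe_injective
    change S7.coe (ν m • slice x v) = _
    rw [S7.coe_smul, coe_slice, cubicRep_real_smul, ← hy, eq_inv_of_mul_eq_one_left hnorm]
  · set c : E4 → ℝ := fun v => ‖affinePoint x v‖⁻¹ ^ (1 / 3 : ℝ) with hc
    have hpos : ∀ v, 0 < ‖affinePoint x v‖⁻¹ := fun v =>
      inv_pos.2 (norm_pos_iff.2 (affinePoint_ne_zero x v))
    have hc3 : ∀ v, c v ^ 3 = ‖affinePoint x v‖⁻¹ := by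
      intro v
      rw [hc, ← Real.rpow_natCast, ← Real.rpow_mul (hpos v).le]
      norm_num
    have hcpos : ∀ v, 0 < c v := fun v => Real.rpow_pos_of_pos (hpos v) _
    have hcc : Continuous c := by
      refine Continuous.rpow_const ?_ fun v => Or.inl (hpos v).ne'
      exact (contDiff_affinePoint (n := 0) x).continuous.norm.inv₀
        fun v => norm_ne_zero_iff.2 (affinePoint_ne_zero x v)
    have hlim : Tendsto (fun z : SU2 × E4 => (c z.2 • (SU2.homeoSphere z.1 : Cn 2), z.2))
        (𝓝 (1, 0)) (𝓝 (quatOne, 0)) := by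
      have h1 : Continuous fun z : SU2 × E4 =>
          (c z.2 • (SU2.homeoSphere z.1 : Cn 2), z.2) :=
        ((hcc.comp continuous_snd).smul (continuous_subtype_val.comp
          (SU2.homeoSphere.continuous.comp continuous_fst))).prodMk continuous_snd
      have h2 := h1.tendsto (1, 0)
      have h3 : c 0 = 1 := by
        rw [hc]
        simp only [affinePoint_zero, S7.norm_coe, inv_one, Real.one_rpow]
      simpa only [h3, one_smul, homeoSphere_one] using h2
    filter_upwards [hlim.eventually hΘ3] with z hz
    have h1 : S7.coe (tube x z) = tubeMap x (c z.2 • (SU2.homeoSphere z.1 : Cn 2), z.2) := by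
      rw [tubeMap, quatAct_smul_column, hc3, tube, S7.coe_smul, coe_slice, cubicRep_real_smul]
    have h0 : c z.2 • (SU2.homeoSphere z.1 : Cn 2) ≠ 0 := by
      refine smul_ne_zero (hcpos _).ne' ?_
      rw [← norm_ne_zero_iff, mem_sphere_zero_iff_norm.1 (SU2.homeoSphere z.1).2]
      exact one_ne_zero
    rw [h1, hz]
    refine Prod.ext ?_ rfl
    apply SU2.homeoSphere.injective
    apply Subtype.ext
    change (SU2.homeoSphere (ν _) : Cn 2) = _
    rw [hνval _ h0, norm_smul, mem_sphere_zero_iff_norm.1 (SU2.homeoSphere z.1).2,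
      Real.norm_of_nonneg (hcpos _).le, mul_one, inv_smul_smul₀ (hcpos _).ne']

/-- A local inverse of the tube map at `(1, 0)`. -/
noncomputable def tubeInv (x : S7) : S7 → SU2 × E4 := (exists_tube_inverse x).choose

/-- Almost freeness: the tube map is injective near `(1, 0)`, so the isotropy group is discrete, and
it is compact. -/
theorem finite_stabilizer (x : S7) : Finite (MulAction.stabilizer SU2 x) := by
  have h := (exists_tube_inverse x).choose_spec.2.2
  have h1 : ∀ᶠ g in 𝓝 (1 : SU2), tubeInv x (tube x (g, 0)) = (g, 0) :=
    (Continuous.prodMk_left (0 : E4)).tendsto (1 : SU2) |>.eventually h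
  have hopen : IsOpen ({1} : Set (MulAction.stabilizer SU2 x)) := by
    rw [isOpen_singleton_iff_nhds_eq_pure, ← principal_singleton]
    refine le_antisymm ?_ (by rw [principal_singleton]; exact pure_le_nhds _)
    rw [le_principal_iff]
    have h2 : ∀ᶠ g : MulAction.stabilizer SU2 x in 𝓝 1,
        tubeInv x (tube x ((g : SU2), 0)) = ((g : SU2), 0) :=
      (continuous_subtype_val.tendsto (1 : MulAction.stabilizer SU2 x)).eventually h1
    filter_upwards [h2] with g hg
    have h3 : tube x ((g : SU2), 0) = tube x (1, 0) := by
      rw [tube, tube, slice_zero, one_smul]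
      exact g.2
    rw [h3] at hg
    have h4 := h1.self_of_nhds
    rw [h4] at hg
    exact Subtype.ext (congrArg Prod.fst hg).symm
  have hdisc : DiscreteTopology (MulAction.stabilizer SU2 x) :=
    discreteTopology_of_isOpen_singleton_one hopen
  have hclosed : IsClosed (MulAction.stabilizer SU2 x : Set SU2) :=
    isClosed_eq (continuous_id.smul continuous_const) continuous_const
  have hcomp : CompactSpace (MulAction.stabilizer SU2 x) :=
    isCompact_iff_compactSpace.1 hclosed.isCompact
  exact finite_of_compact_of_discrete

end Tube

/-! ### The isotropy representation on the normal space -/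

section Isotropy

open Metric Set Topology Filter Matrix

/-- Conjugation of quaternions by an element of `SU(2)`. -/
noncomputable def quatConj (g : SU2) (m : Cn 2) : Cn 2 :=
  !₂[(g.1 * quatMatrix m * star g.1) 0 0, (g.1 * quatMatrix m * star g.1) 1 0]

theorem quatMatrix_quatConj (g : SU2) (m : Cn 2) :
    quatMatrix (quatConj g m) = g.1 * quatMatrix m * star g.1 := by
  have h := SU2.entries g
  ext i j
  fin_cases i <;> fin_cases j <;>
    simp [quatMatrix, quatConj, Matrix.mul_apply, Fin.sum_univ_two, Matrix.star_apply, h.1, h.2] <;>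
    ring

theorem quatConj_quatOne (g : SU2) : quatConj g quatOne = quatOne := by
  have h : g.1 * quatMatrix quatOne * star g.1 = 1 := by
    rw [quatMatrix_quatOne, mul_one]
    exact (Unitary.mem_iff.1 (Matrix.mem_specialUnitaryGroup_iff.1 g.2).1).2
  ext i
  fin_cases i <;> simp only [quatConj, h] <;> simp [quatOne]

theorem differentiable_quatConj (g : SU2) : Differentiable ℝ (quatConj g) := by
  have h1 : ∀ k, ContDiff ℝ 1 fun z : Cn 2 => z k := fun k =>
    ((EuclideanSpace.proj (𝕜 := ℂ) (ι := Fin 2) k).restrictScalars ℝ).contDiff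
  have h2 : ∀ k, ContDiff ℝ 1 fun z : Cn 2 => (starRingEnd ℂ) (z k) := fun k =>
    (starL' ℝ (A := ℂ)).contDiff.comp (h1 k)
  have h3 : ContDiff ℝ 1 (quatConj g) := by
    rw [contDiff_piLp]
    intro i
    fin_cases i <;>
      simp only [quatConj, quatMatrix, Matrix.mul_apply, Fin.sum_univ_two, Matrix.star_apply] <;>
      simp <;> fun_prop (disch := skip)
  exact h3.differentiable one_ne_zero

/-- The unitary map `cubicRep g`, as a real isometry. -/
noncomputable def cubicIsometry (g : SU2) : Cn 4 →ₗᵢ[ℝ] Cn 4 where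
  toLinearMap := (cubicRep g).toLinearEquiv.toLinearMap.restrictScalars ℝ
  norm_map' := (cubicRep g).norm_map

theorem cubicIsometry_apply (g : SU2) (y : Cn 4) : cubicIsometry g y = cubicRep g y := rfl

theorem quatAct_quatConj {g : SU2} {y : Cn 4} (h : cubicRep g y = y) (m : Cn 2) :
    quatAct (quatConj g m) y = cubicRep g (quatAct m y) := by
  have h1 : quatAct (quatConj g m) y = cubicRep g (quatAct m (cubicRep g⁻¹ y)) := by
    rw [quatAct, quatMatrix_quatConj, cubicMatrix_mul, cubicMatrix_mul, map_mul, map_mul]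
    rfl
  have h2 : cubicRep g⁻¹ y = y := by
    conv_lhs => rw [← h]
    rw [map_inv]
    exact (cubicRep g).symm_apply_apply y
  rw [h1, h2]

/-- The isotropy group of `y` preserves the image of `orbitDeriv y`, because
`g (m y) = (g m g⁻¹) y` for every quaternion `m`. -/
theorem cubicRep_mem_range_orbitDeriv {g : SU2} {y : Cn 4} (h : cubicRep g y = y) {w : Cn 4}
    (hw : w ∈ LinearMap.range (orbitDeriv y).toLinearMap) :
    cubicRep g w ∈ LinearMap.range (orbitDeriv y).toLinearMap := by
  obtain ⟨β, rfl⟩ := hw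
  have h1 : HasFDerivAt (fun m => quatAct (quatConj g m) y)
      ((orbitDeriv y).comp (fderiv ℝ (quatConj g) quatOne)) quatOne := by
    have h2 := hasFDerivAt_orbit y
    rw [← quatConj_quatOne g] at h2
    exact HasFDerivAt.comp quatOne h2 (differentiable_quatConj g quatOne).hasFDerivAt
  have h3 : HasFDerivAt (fun m => cubicIsometry g (quatAct m y))
      ((cubicIsometry g).toContinuousLinearMap.comp (orbitDeriv y)) quatOne :=
    HasFDerivAt.comp quatOne (cubicIsometry g).toContinuousLinearMap.hasFDerivAt
      (hasFDerivAt_orbit y)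
  have h4 : (fun m => quatAct (quatConj g m) y) = fun m => cubicIsometry g (quatAct m y) :=
    funext fun m => quatAct_quatConj h m
  rw [h4] at h1
  exact ⟨fderiv ℝ (quatConj g) quatOne β, congrArg (fun f => f β) (h1.unique h3)⟩

theorem cubicRep_coe {x : S7} (γ : MulAction.stabilizer SU2 x) :
    cubicRep γ.1 (S7.coe x) = S7.coe x := congrArg S7.coe γ.2

theorem cubicRep_mem_normalSpace {x : S7} (γ : MulAction.stabilizer SU2 x) {w : Cn 4}
    (hw : w ∈ normalSpace (S7.coe x)) : cubicRep γ.1 w ∈ normalSpace (S7.coe x) := by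
  rw [normalSpace, Submodule.mem_orthogonal] at hw ⊢
  intro u hu
  have h1 := hw _ (cubicRep_mem_range_orbitDeriv (cubicRep_coe γ⁻¹) hu)
  rw [← (cubicIsometry γ.1).inner_map_map, cubicIsometry_apply, cubicIsometry_apply] at h1
  have h2 : cubicRep γ.1 (cubicRep (γ⁻¹ : MulAction.stabilizer SU2 x).1 u) = u := by
    change (cubicRep γ.1 * cubicRep (γ.1)⁻¹) u = u
    rw [← map_mul, mul_inv_cancel, map_one]
    rfl
  rwa [h2] at h1

/-- The representation of the isotropy group of `x` on the normal space, in coordinates. -/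
noncomputable def normalMap (x : S7) (γ : MulAction.stabilizer SU2 x) (v : E4) : E4 :=
  (normalEquiv x).symm ⟨cubicRep γ.1 (normalEquiv x v : Cn 4),
    cubicRep_mem_normalSpace γ (normalEquiv x v).2⟩

theorem normalEquiv_normalMap (x : S7) (γ : MulAction.stabilizer SU2 x) (v : E4) :
    (normalEquiv x (normalMap x γ v) : Cn 4) = cubicRep γ.1 (normalEquiv x v : Cn 4) := by
  rw [normalMap, LinearIsometryEquiv.apply_symm_apply]

theorem normalMap_one (x : S7) (v : E4) : normalMap x 1 v = v := by
  apply (normalEquiv x).injective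
  apply Subtype.ext
  rw [normalEquiv_normalMap]
  change cubicRep 1 _ = _
  rw [map_one]
  rfl

theorem normalMap_mul (x : S7) (γ δ : MulAction.stabilizer SU2 x) (v : E4) :
    normalMap x (γ * δ) v = normalMap x γ (normalMap x δ v) := by
  apply (normalEquiv x).injective
  apply Subtype.ext
  rw [normalEquiv_normalMap, normalEquiv_normalMap, normalEquiv_normalMap]
  change cubicRep (γ.1 * δ.1) _ = _
  rw [map_mul]
  rfl

theorem norm_normalMap (x : S7) (γ : MulAction.stabilizer SU2 x) (v : E4) :
    ‖normalMap x γ v‖ = ‖v‖ := by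
  rw [← (normalEquiv x).norm_map, ← (normalEquiv x).norm_map v, Submodule.coe_norm,
    Submodule.coe_norm, normalEquiv_normalMap, LinearIsometryEquiv.norm_map]

theorem affinePoint_normalMap (x : S7) (γ : MulAction.stabilizer SU2 x) (v : E4) :
    affinePoint x (normalMap x γ v) = cubicRep γ.1 (affinePoint x v) := by
  rw [affinePoint, affinePoint, normalEquiv_normalMap, map_add, cubicRep_coe]

theorem slice_normalMap (x : S7) (γ : MulAction.stabilizer SU2 x) (v : E4) :
    slice x (normalMap x γ v) = γ.1 • slice x v := by
  apply S7.coe_injective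
  rw [S7.coe_smul, coe_slice, coe_slice, affinePoint_normalMap, LinearIsometryEquiv.norm_map,
    cubicRep_real_smul]

theorem contDiff_normalMap {n : ℕ∞ω} (x : S7) (γ : MulAction.stabilizer SU2 x) :
    ContDiff ℝ n (normalMap x γ) := by
  have h : IsLinearMap ℝ (normalMap x γ) := by
    constructor
    · intro u v
      apply (normalEquiv x).injective
      apply Subtype.ext
      rw [map_add, Submodule.coe_add, normalEquiv_normalMap, normalEquiv_normalMap,
        normalEquiv_normalMap, map_add, Submodule.coe_add, map_add]
    · intro c v
      apply (normalEquiv x).injective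
      apply Subtype.ext
      rw [map_smul, Submodule.coe_smul, normalEquiv_normalMap, normalEquiv_normalMap, map_smul,
        Submodule.coe_smul, cubicRep_real_smul]
  exact (LinearMap.toContinuousLinearMap (h.mk' _)).contDiff

/-- An element of `SU(2)` that fixes a three-dimensional subspace of `ℂ⁴` is trivial: the subspace
meets the planes `x₂ = x₃ = 0` and `x₀ = x₃ = 0`. -/
theorem eq_one_of_finrank_fixed {g : SU2} (F : Submodule ℂ (Cn 4))
    (hF : ∀ y ∈ F, cubicRep g y = y) (hd : 3 ≤ Module.finrank ℂ F) : g = 1 := by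
  have hmeet : ∀ i j : Fin 4, ∃ y ∈ F, y ≠ 0 ∧ y i = 0 ∧ y j = 0 := by
    intro i j
    let f : F →ₗ[ℂ] ℂ × ℂ := (((EuclideanSpace.proj (𝕜 := ℂ) (ι := Fin 4) i).toLinearMap.prod
      (EuclideanSpace.proj (𝕜 := ℂ) (ι := Fin 4) j).toLinearMap)).comp F.subtype
    have hlt : Module.finrank ℂ (ℂ × ℂ) < Module.finrank ℂ F := by
      rw [Module.finrank_prod, Module.finrank_self]
      omega
    obtain ⟨y, hy, hy0⟩ := Submodule.exists_mem_ne_zero_of_ne_bot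
      (LinearMap.ker_ne_bot_of_finrank_lt (f := f) hlt)
    have h : f y = 0 := hy
    exact ⟨y, y.2, fun h0 => hy0 (Subtype.ext h0), congrArg Prod.fst h, congrArg Prod.snd h⟩
  obtain ⟨y, hyF, hy0, h2, h3⟩ := hmeet 2 3
  by_cases h1 : y 1 = 0
  · have hy00 : y 0 ≠ 0 := by
      intro h
      refine hy0 ?_
      ext i
      fin_cases i
      exacts [h, h1, h2, h3]
    have hrow : ∀ (z : Cn 4), z ∈ F → ∀ i, ∑ j, cubicMatrix g.1 i j * z j = z i :=
      fun z hz i => congrArg (fun y : Cn 4 => y i) (hF z hz)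
    have e3 := hrow y hyF 3
    simp only [Fin.sum_univ_four, h1, h2, h3, mul_zero, add_zero] at e3
    have hr : g.1 1 0 = 0 := by
      have : g.1 1 0 ^ 3 * y 0 = 0 := by simpa [cubicMatrix] using e3
      simpa [hy00] using this
    have hq : g.1 0 1 = 0 := by rw [(SU2.entries g).1, hr]; simp
    have hdet := SU2.det_eq_one g
    rw [Matrix.det_fin_two, hr, mul_zero, sub_zero] at hdet
    obtain ⟨z, hzF, hz0, k0, k3⟩ := hmeet 0 3
    have e1 := hrow z hzF 1
    have e2 := hrow z hzF 2
    simp only [Fin.sum_univ_four, k0, k3, mul_zero, add_zero, zero_add] at e1 e2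
    simp [cubicMatrix, hr, hq] at e1 e2
    have hp : g.1 0 0 = 1 := by
      by_cases hz1 : z 1 = 0
      · have hz2 : z 2 ≠ 0 := by
          intro h
          refine hz0 ?_
          ext i
          fin_cases i
          exacts [k0, hz1, h, k3]
        have e4 : g.1 0 0 * g.1 1 1 ^ 2 = 1 :=
          mul_right_cancel₀ hz2 (by linear_combination e2)
        have e5 : g.1 1 1 = 1 := by linear_combination e4 - g.1 1 1 * hdet
        rw [e5, mul_one] at hdet
        exact hdet
      · have e4 : g.1 0 0 ^ 2 * g.1 1 1 = 1 :=
          mul_right_cancel₀ hz1 (by linear_combination e1)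
        linear_combination e4 - g.1 0 0 * hdet
    exact SU2.eq_one_of_entries hp hr
  · exact cubicRep_fixed_regular h1 h2 h3 (hF y hyF)

/-- The isotropy representation on the normal space is faithful. -/
theorem eq_one_of_normalMap_eq {x : S7} {γ : MulAction.stabilizer SU2 x}
    (h : ∀ v, normalMap x γ v = v) : γ = 1 := by
  let F : Submodule ℂ (Cn 4) :=
    LinearMap.eqLocus (cubicRep γ.1).toLinearEquiv.toLinearMap LinearMap.id
  have hN : normalSpace (S7.coe x) ≤ F.restrictScalars ℝ := by
    intro w hw
    change cubicRep γ.1 w = w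
    have := normalEquiv_normalMap x γ ((normalEquiv x).symm ⟨w, hw⟩)
    rw [h, LinearIsometryEquiv.apply_symm_apply] at this
    exact this.symm
  have hx : Submodule.span ℝ {S7.coe x} ≤ F.restrictScalars ℝ := by
    rw [Submodule.span_singleton_le_iff_mem]
    exact cubicRep_coe γ
  have hdisj : normalSpace (S7.coe x) ⊓ Submodule.span ℝ {S7.coe x} = ⊥ := by
    rw [Submodule.eq_bot_iff]
    rintro w ⟨hw1, hw2⟩
    obtain ⟨c, rfl⟩ := Submodule.mem_span_singleton.1 hw2
    have h1 := inner_normalSpace ⟨_, hw1⟩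
    rw [inner_smul_right, real_inner_self_eq_norm_sq, S7.norm_coe] at h1
    have h2 : c = 0 := by simpa using h1
    rw [h2, zero_smul]
  have hsum := Submodule.finrank_sup_add_finrank_inf_eq (normalSpace (S7.coe x))
    (Submodule.span ℝ {S7.coe x})
  rw [hdisj, finrank_bot, finrank_normalSpace x.coe_ne_zero,
    finrank_span_singleton x.coe_ne_zero] at hsum
  have hle := Submodule.finrank_mono (sup_le hN hx)
  have hF : Module.finrank ℝ (F.restrictScalars ℝ) = 2 * Module.finrank ℂ F := by
    rw [← Complex.finrank_real_complex]
    exact (Module.finrank_mul_finrank ℝ ℂ F).symm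
  refine Subtype.ext (eq_one_of_finrank_fixed F (fun y hy => hy) ?_)
  omega

end Isotropy

/-! ### Local diffeomorphisms from mutually inverse germs -/

section Germ

open Set Topology Filter

variable {E F H K : Type*} [NormedAddCommGroup E] [NormedSpace ℝ E] [NormedAddCommGroup F]
  [NormedSpace ℝ F] [TopologicalSpace H] [TopologicalSpace K] {I : ModelWithCorners ℝ E H}
  {J : ModelWithCorners ℝ F K} {M N : Type*} [TopologicalSpace M] [ChartedSpace H M]
  [TopologicalSpace N] [ChartedSpace K N]

theorem exists_partialDiffeomorph {f : M → N} {k : N → M} {x : M} {p : M → Prop}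
    (hf : ∀ᶠ z in 𝓝 x, ContMDiffAt I J ∞ f z) (hk : ∀ᶠ y in 𝓝 (f x), ContMDiffAt J I ∞ k y)
    (hl : ∀ᶠ z in 𝓝 x, k (f z) = z) (hr : ∀ᶠ y in 𝓝 (f x), f (k y) = y) (hp : ∀ᶠ z in 𝓝 x, p z) :
    ∃ Φ : PartialDiffeomorph I J M N ∞, x ∈ Φ.source ∧ Φ.toFun = f ∧ ∀ z ∈ Φ.source, p z := by
  obtain ⟨A, hA, hAo, hxA⟩ := eventually_nhds_iff.1 (hf.and (hl.and hp))
  obtain ⟨B, hB, hBo, hxB⟩ := eventually_nhds_iff.1 (hk.and hr)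
  have hfc : ContinuousOn f A := fun z hz => (hA z hz).1.continuousAt.continuousWithinAt
  have hkc : ContinuousOn k B := fun z hz => (hB z hz).1.continuousAt.continuousWithinAt
  let Φ : PartialDiffeomorph I J M N ∞ :=
    { toFun := f
      invFun := k
      source := A ∩ f ⁻¹' B
      target := B ∩ k ⁻¹' A
      map_source' := fun z hz => ⟨hz.2, by
        change k (f z) ∈ A
        rw [(hA z hz.1).2.1]
        exact hz.1⟩
      map_target' := fun y hy => ⟨hy.2, by
        change f (k y) ∈ B
        rw [(hB y hy.1).2]
        exact hy.1⟩
      left_inv' := fun z hz => (hA z hz.1).2.1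
      right_inv' := fun y hy => (hB y hy.1).2
      open_source := hfc.isOpen_inter_preimage hAo hBo
      open_target := hkc.isOpen_inter_preimage hBo hAo
      contMDiffOn_toFun := fun z hz => (hA z hz.1).1.contMDiffWithinAt
      contMDiffOn_invFun := fun y hy => (hB y hy.1).1.contMDiffWithinAt }
  exact ⟨Φ, ⟨hxA, hxB⟩, rfl, fun z hz => (hA z hz.1).2.2⟩

/-- A retraction of a manifold onto an open subset, constant outside this subset. -/
noncomputable def opensRetract {U : TopologicalSpace.Opens M} (u₀ : U) (x : M) : U :=
  open Classical in if h : x ∈ U then ⟨x, h⟩ else u₀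

theorem opensRetract_of_mem {U : TopologicalSpace.Opens M} (u₀ : U) {x : M} (h : x ∈ U) :
    opensRetract u₀ x = ⟨x, h⟩ := by
  simp [opensRetract, h]

theorem contMDiffAt_opensRetract {U : TopologicalSpace.Opens M} (u₀ : U) {x : M} (h : x ∈ U) :
    ContMDiffAt I I ∞ (opensRetract u₀) x := by
  refine (contMDiffAt_subtype_iff (U := U) (x := ⟨x, h⟩)).1 ?_
  refine contMDiffAt_id.congr_of_eventuallyEq (Eventually.of_forall fun u => ?_)
  exact opensRetract_of_mem u₀ u.2

theorem contMDiffAt_opens_of_coe {U : TopologicalSpace.Opens M} {f : N → U} {y : N}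
    (h : ContMDiffAt J I ∞ (fun z => (f z : M)) y) : ContMDiffAt J I ∞ f y := by
  refine ContMDiffAt.congr_of_eventuallyEq (ContMDiffAt.comp (g := opensRetract (f y)) y
    (contMDiffAt_opensRetract (f y) (f y).2) h) (Eventually.of_forall fun w => ?_)
  exact (opensRetract_of_mem (f y) (f w).2).symm

end Germ

/-! ### Slices of a uniform size -/

section Radius

open Metric Set Topology Filter

theorem normalMap_smul (x : S7) (γ : MulAction.stabilizer SU2 x) (c : ℝ) (v : E4) :
    normalMap x γ (c • v) = c • normalMap x γ v := by
  apply (normalEquiv x).injective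
  apply Subtype.ext
  rw [map_smul, Submodule.coe_smul, normalEquiv_normalMap, normalEquiv_normalMap, map_smul,
    Submodule.coe_smul, cubicRep_real_smul]

theorem normalMap_zero (x : S7) (γ : MulAction.stabilizer SU2 x) : normalMap x γ 0 = 0 := by
  rw [← norm_eq_zero, norm_normalMap, norm_zero]

theorem contMDiff_const_smul (g : SU2) {n : ℕ∞ω} :
    ContMDiff (𝓡 7) (𝓡 7) n fun y : S7 => g • y := by
  have h : ContMDiff (𝓡 7) ((𝓡 3).prod (𝓡 7)) n fun y : S7 => (g, y) :=
    contMDiff_const.prodMk contMDiff_id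
  have h2 : ContMDiff (𝓡 7) (𝓡 7) n ((fun z : SU2 × S7 => z.1 • z.2) ∘ fun y : S7 => (g, y)) :=
    ContMDiff.comp S7.contMDiff_smul h
  exact h2

/-- Near `x`, two points of the slice at `x` are related by the elements of the isotropy group of
`x` only. -/
theorem eventually_smul_slice (x : S7) : ∀ᶠ w : E4 × E4 in 𝓝 (0, 0), ∀ g : SU2,
    g • slice x w.1 = slice x w.2 → g • x = x := by
  have key : ∀ g₀ : SU2, ∀ᶠ z : (E4 × E4) × SU2 in 𝓝 ((0, 0), g₀),
      z.2 • slice x z.1.1 = slice x z.1.2 → z.2 • x = x := by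
    intro g₀
    have hs : Continuous (slice x) := (contMDiff_slice (n := 0) x).continuous
    by_cases hg : g₀ • x = x
    · have hleft := (exists_tube_inverse x).choose_spec.2.2
      set γ : MulAction.stabilizer SU2 x := ⟨g₀, hg⟩ with hγ
      have c1 : Continuous fun z : (E4 × E4) × SU2 => (z.2 * g₀⁻¹, normalMap x γ z.1.1) :=
        (continuous_snd.mul continuous_const).prodMk
          ((contDiff_normalMap (n := 0) x γ).continuous.comp (continuous_fst.comp continuous_fst))
      have c2 : Continuous fun z : (E4 × E4) × SU2 => ((1 : SU2), z.1.2) :=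
        continuous_const.prodMk (continuous_snd.comp continuous_fst)
      have t1 := c1.tendsto ((0, 0), g₀)
      have t2 := c2.tendsto ((0, 0), g₀)
      simp only [mul_inv_cancel, normalMap_zero] at t1
      filter_upwards [t1.eventually hleft, t2.eventually hleft] with z h1 h2 h
      have h3 : tube x (z.2 * g₀⁻¹, normalMap x γ z.1.1) = tube x (1, z.1.2) := by
        rw [tube_one, ← h, tube, slice_normalMap, smul_smul, hγ, inv_mul_cancel_right]
      rw [h3, h2] at h1
      have h4 : 1 = z.2 * g₀⁻¹ := congrArg Prod.fst h1
      rw [eq_comm, mul_inv_eq_one] at h4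
      rw [h4, hg]
    · have c1 : Continuous fun z : (E4 × E4) × SU2 => z.2 • slice x z.1.1 :=
        continuous_snd.smul (hs.comp (continuous_fst.comp continuous_fst))
      have c2 : Continuous fun z : (E4 × E4) × SU2 => slice x z.1.2 :=
        hs.comp (continuous_snd.comp continuous_fst)
      have hne : ∀ᶠ z : (E4 × E4) × SU2 in 𝓝 ((0, 0), g₀), z.2 • slice x z.1.1 ≠ slice x z.1.2 := by
        refine (c1.continuousAt.ne_iff_eventually_ne c2.continuousAt).1 ?_
        simpa only [slice_zero] using hg
      exact hne.mono fun z hz h => absurd h hz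
  exact (isCompact_univ.eventually_forall_of_forall_eventually
    (P := fun (w : E4 × E4) (g : SU2) => g • slice x w.1 = slice x w.2 → g • x = x)
    fun g _ => key g).mono fun w hw g => hw g (mem_univ g)

/-- A slice of sufficiently small radius is a chart domain: the tube map is a local diffeomorphism
along it, and an element of `SU(2)` that moves one of its points to another fixes the centre. -/
theorem exists_sliceRadius (x : S7) : ∃ r : ℝ, 0 < r ∧
    (∀ v ∈ ball (0 : E4) r,
      (∀ᶠ y in 𝓝 (slice x v), ContMDiffAt (𝓡 7) ((𝓡 3).prod (𝓡 4)) ∞ (tubeInv x) y) ∧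
      (∀ᶠ y in 𝓝 (slice x v), tube x (tubeInv x y) = y) ∧
      (∀ᶠ z in 𝓝 ((1 : SU2), v), tubeInv x (tube x z) = z)) ∧
    ∀ u ∈ ball (0 : E4) r, ∀ v ∈ ball (0 : E4) r, ∀ g : SU2,
      g • slice x u = slice x v → g • x = x := by
  obtain ⟨h1, h2, h3⟩ := (exists_tube_inverse x).choose_spec
  have hs : Tendsto (slice x) (𝓝 0) (𝓝 x) := by
    have := (contMDiff_slice (n := 0) x).continuous.tendsto 0
    rwa [slice_zero] at this
  have hi : Tendsto (fun v : E4 => ((1 : SU2), v)) (𝓝 0) (𝓝 (1, 0)) :=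
    (Continuous.prodMk_right (1 : SU2)).tendsto 0
  have h4 := (hs.eventually (eventually_eventually_nhds.2 h1)).and
    ((hs.eventually (eventually_eventually_nhds.2 h2)).and
      (hi.eventually (eventually_eventually_nhds.2 h3)))
  obtain ⟨r₁, hr₁, h5⟩ := Metric.eventually_nhds_iff_ball.1 h4
  obtain ⟨r₂, hr₂, h6⟩ := Metric.eventually_nhds_iff_ball.1 (eventually_smul_slice x)
  refine ⟨min r₁ r₂, lt_min hr₁ hr₂, fun v hv => h5 v (ball_subset_ball (min_le_left _ _) hv),
    fun u hu v hv g => h6 (u, v) ?_ g⟩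
  rw [← ball_prod_same]
  exact ⟨ball_subset_ball (min_le_right _ _) hu, ball_subset_ball (min_le_right _ _) hv⟩

/-- The radius of the domain of the slice chart at `x`. -/
noncomputable def sliceRadius (x : S7) : ℝ := (exists_sliceRadius x).choose

theorem sliceRadius_pos (x : S7) : 0 < sliceRadius x := (exists_sliceRadius x).choose_spec.1

/-- The domain of the slice chart at `x`. -/
noncomputable def sliceDom (x : S7) : TopologicalSpace.Opens E4 :=
  ⟨ball 0 (sliceRadius x), isOpen_ball⟩

theorem mem_sliceDom {x : S7} {v : E4} : v ∈ sliceDom x ↔ ‖v‖ < sliceRadius x :=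
  mem_ball_zero_iff

theorem contMDiffAt_tubeInv {x : S7} {v : E4} (hv : v ∈ sliceDom x) :
    ∀ᶠ y in 𝓝 (slice x v), ContMDiffAt (𝓡 7) ((𝓡 3).prod (𝓡 4)) ∞ (tubeInv x) y :=
  ((exists_sliceRadius x).choose_spec.2.1 v hv).1

theorem tube_tubeInv {x : S7} {v : E4} (hv : v ∈ sliceDom x) :
    ∀ᶠ y in 𝓝 (slice x v), tube x (tubeInv x y) = y :=
  ((exists_sliceRadius x).choose_spec.2.1 v hv).2.1

theorem tubeInv_tube {x : S7} {v : E4} (hv : v ∈ sliceDom x) :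
    ∀ᶠ z in 𝓝 ((1 : SU2), v), tubeInv x (tube x z) = z :=
  ((exists_sliceRadius x).choose_spec.2.1 v hv).2.2

theorem tubeInv_slice {x : S7} {v : E4} (hv : v ∈ sliceDom x) :
    tubeInv x (slice x v) = (1, v) := by
  have := (tubeInv_tube hv).self_of_nhds
  rwa [tube_one] at this

theorem smul_eq_of_smul_slice {x : S7} {u v : E4} (hu : u ∈ sliceDom x) (hv : v ∈ sliceDom x)
    {g : SU2} (h : g • slice x u = slice x v) : g • x = x :=
  (exists_sliceRadius x).choose_spec.2.2 u hu v hv g h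

end Radius

/-! ### The orbit space as an orbifold -/

section OrbitSpace

open Metric Set Topology Filter

instance : ProperSMul SU2 S7 where
  isProperMap_smul_pair := (continuous_smul.prodMk continuous_snd).isProperMap

/-- The orbit space of the action of `SU(2)` on the unit sphere of the binary cubic forms. -/
abbrev CubicQuotient : Type := MulAction.orbitRel.Quotient SU2 S7

/-- The projection of the sphere to the orbit space. -/
noncomputable def cubicProj (x : S7) : CubicQuotient := Quotient.mk _ x

instance : SecondCountableTopology CubicQuotient :=
  ContinuousConstSMul.secondCountableTopology (Γ := SU2) (T := S7)

theorem continuous_cubicProj : Continuous cubicProj := continuous_quotient_mk'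

theorem isOpenMap_cubicProj : IsOpenMap cubicProj := isOpenMap_quotient_mk'_mul (Γ := SU2) (T := S7)

theorem surjective_cubicProj : Function.Surjective cubicProj := Quotient.mk_surjective

theorem cubicProj_eq_iff {x y : S7} : cubicProj x = cubicProj y ↔ ∃ g : SU2, g • x = y := by
  rw [eq_comm]
  exact Quotient.eq.trans MulAction.orbitRel_apply

theorem cubicProj_smul (g : SU2) (x : S7) : cubicProj (g • x) = cubicProj x :=
  (cubicProj_eq_iff.2 ⟨g, rfl⟩).symm

/-- The tube around the orbit of `x`: the field `slice` of an almost free quotient. -/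
theorem isLocalDiffeomorph_tube (x : S7) : IsLocalDiffeomorph ((𝓡 3).prod (𝓡 4)) (𝓡 7) ∞
    fun z : SU2 × sliceDom x => z.1 • slice x z.2 := by
  rintro ⟨g, u⟩
  have hval : ContMDiff ((𝓡 3).prod (𝓡 4)) ((𝓡 3).prod (𝓡 4)) ∞
      fun z : SU2 × sliceDom x => (z.1, (z.2 : E4)) :=
    ContMDiff.prodMk contMDiff_fst
      (ContMDiff.comp (g := (Subtype.val : sliceDom x → E4)) contMDiff_subtype_val contMDiff_snd)
  have hf : ContMDiff ((𝓡 3).prod (𝓡 4)) (𝓡 7) ∞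
      (tube x ∘ fun z : SU2 × sliceDom x => (z.1, (z.2 : E4))) :=
    ContMDiff.comp (contMDiff_tube x) hval
  have hback : Tendsto (fun y : S7 => g⁻¹ • y) (𝓝 (g • slice x u)) (𝓝 (slice x u)) := by
    have := (continuous_const_smul g⁻¹).tendsto (g • slice x (u : E4))
    rwa [inv_smul_smul] at this
  have hsmooth := hback.eventually (contMDiffAt_tubeInv u.2)
  have hval0 : tubeInv x (g⁻¹ • g • slice x (u : E4)) = (1, (u : E4)) := by
    rw [inv_smul_smul, tubeInv_slice u.2]
  have hdom : ∀ᶠ y in 𝓝 (g • slice x u), (tubeInv x (g⁻¹ • y)).2 ∈ sliceDom x := by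
    have hc : ContinuousAt (fun y => (tubeInv x (g⁻¹ • y)).2) (g • slice x (u : E4)) := by
      refine continuousAt_snd.comp ?_
      refine ContinuousAt.comp (g := tubeInv x) ?_ (continuous_const_smul g⁻¹).continuousAt
      exact hsmooth.self_of_nhds.continuousAt
    refine hc.eventually ((sliceDom x).isOpen.mem_nhds ?_)
    change (tubeInv x (g⁻¹ • g • slice x (u : E4))).2 ∈ sliceDom x
    rw [hval0]
    exact u.2
  suffices h : _ ∧ _ ∧ _ by
    obtain ⟨Φ, h1, h2, -⟩ := exists_partialDiffeomorph (I := (𝓡 3).prod (𝓡 4)) (J := 𝓡 7)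
      (f := fun z : SU2 × sliceDom x => z.1 • slice x z.2) (x := (g, u)) (p := fun _ => True)
      (k := fun y => (g * (tubeInv x (g⁻¹ • y)).1, opensRetract u (tubeInv x (g⁻¹ • y)).2))
      (Eventually.of_forall hf) h.1 h.2.1 h.2.2 (Eventually.of_forall fun _ => trivial)
    exact ⟨Φ, h1, fun z _ => (congrFun h2 z).symm⟩
  refine ⟨?_, ?_, ?_⟩
  · filter_upwards [hsmooth, hdom] with y h1 h2
    have h3 : ContMDiffAt (𝓡 7) ((𝓡 3).prod (𝓡 4)) ∞ (fun y => tubeInv x (g⁻¹ • y)) y :=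
      ContMDiffAt.comp (g := tubeInv x) y h1 (contMDiff_const_smul g⁻¹).contMDiffAt
    have h4 : ContMDiffAt (𝓡 7) (𝓡 3) ∞ (fun y => (tubeInv x (g⁻¹ • y)).1) y :=
      contMDiffAt_fst.comp y h3
    have h5 : ContMDiffAt (𝓡 7) (𝓡 4) ∞ (fun y => (tubeInv x (g⁻¹ • y)).2) y :=
      contMDiffAt_snd.comp y h3
    exact ContMDiffAt.prodMk
      (ContMDiffAt.comp (g := fun k : SU2 => g * k) y contMDiff_mul_left.contMDiffAt h4)
      (ContMDiffAt.comp (g := opensRetract u) y (contMDiffAt_opensRetract u h2) h5)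
  · have hc : Continuous fun z : SU2 × sliceDom x => (g⁻¹ * z.1, (z.2 : E4)) :=
      (continuous_const.mul continuous_fst).prodMk (continuous_subtype_val.comp continuous_snd)
    have ht := hc.tendsto (g, u)
    rw [inv_mul_cancel] at ht
    filter_upwards [ht.eventually (tubeInv_tube u.2)] with z hz
    have h3 : tubeInv x (g⁻¹ • z.1 • slice x (z.2 : E4)) = (g⁻¹ * z.1, (z.2 : E4)) := by
      rw [smul_smul]
      exact hz
    simp only [h3, mul_inv_cancel_left]
    rw [opensRetract_of_mem u z.2.2]
  · filter_upwards [hback.eventually (tube_tubeInv u.2), hdom] with y h1 h2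
    rw [opensRetract_of_mem u h2, mul_smul]
    change g • tube x (tubeInv x (g⁻¹ • y)) = y
    rw [h1, smul_inv_smul]

/-- The coordinate change between the slices at `x` and at `y` determined by an element `g` of
`SU(2)`. -/
noncomputable def sliceTrans (x y : S7) (g : SU2) (w : E4) : E4 := (tubeInv y (g • slice x w)).2

section SliceTrans

variable {x y : S7} {u v : E4} {g : SU2}

theorem tendsto_smul_slice (h : g • slice x u = slice y v) :
    Tendsto (fun w => g • slice x w) (𝓝 u) (𝓝 (slice y v)) := by
  have h1 : Continuous fun w => g • slice x w :=
    (contMDiff_slice (n := 0) x).continuous.const_smul g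
  have h2 := h1.tendsto u
  rwa [h] at h2

theorem sliceTrans_eq (hv : v ∈ sliceDom y) (h : g • slice x u = slice y v) :
    sliceTrans x y g u = v := by
  rw [sliceTrans, h, tubeInv_slice hv]

theorem contMDiffAt_sliceTrans (hv : v ∈ sliceDom y) (h : g • slice x u = slice y v) :
    ∀ᶠ w in 𝓝 u, ContMDiffAt (𝓡 4) (𝓡 4) ∞ (sliceTrans x y g) w := by
  filter_upwards [(tendsto_smul_slice h).eventually (contMDiffAt_tubeInv hv)] with w hw
  have h1 : ContMDiffAt (𝓡 4) (𝓡 7) ∞ (fun w => g • slice x w) w :=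
    ContMDiffAt.comp (g := fun z : S7 => g • z) w (contMDiff_const_smul g).contMDiffAt
      (contMDiff_slice x).contMDiffAt
  have h2 : ContMDiffAt (𝓡 4) ((𝓡 3).prod (𝓡 4)) ∞ (fun w => tubeInv y (g • slice x w)) w :=
    ContMDiffAt.comp (g := tubeInv y) w hw h1
  exact contMDiffAt_snd.comp w h2

theorem smul_slice_sliceTrans (hv : v ∈ sliceDom y) (h : g • slice x u = slice y v) :
    ∀ᶠ w in 𝓝 u, (tubeInv y (g • slice x w)).1 • slice y (sliceTrans x y g w) = g • slice x w :=
  (tendsto_smul_slice h).eventually (tube_tubeInv hv)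

theorem sliceTrans_sliceTrans (hu : u ∈ sliceDom x) (hv : v ∈ sliceDom y)
    (h : g • slice x u = slice y v) :
    ∀ᶠ w in 𝓝 u, sliceTrans y x g⁻¹ (sliceTrans x y g w) = w := by
  have hc : ContinuousAt (fun w => tubeInv y (g • slice x w)) u :=
    ContinuousAt.comp_of_eq (g := tubeInv y) (contMDiffAt_tubeInv hv).self_of_nhds.continuousAt
      ((contMDiff_slice (n := 0) x).continuous.const_smul g).continuousAt h
  have hc2 : ContinuousAt (fun w => (g⁻¹ * (tubeInv y (g • slice x w)).1⁻¹ * g, w)) u :=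
    ((continuousAt_const.mul (continuousAt_fst.comp hc).inv).mul continuousAt_const).prodMk
      continuousAt_id
  have ht : Tendsto (fun w => (g⁻¹ * (tubeInv y (g • slice x w)).1⁻¹ * g, w)) (𝓝 u)
      (𝓝 (1, u)) := by
    have := hc2.tendsto
    simpa only [h, tubeInv_slice hv, inv_one, mul_one, inv_mul_cancel] using this
  filter_upwards [smul_slice_sliceTrans hv h, ht.eventually (tubeInv_tube hu)] with w h1 h2
  have h3 : g⁻¹ • slice y (sliceTrans x y g w) =
      tube x (g⁻¹ * (tubeInv y (g • slice x w)).1⁻¹ * g, w) := by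
    rw [tube, mul_smul, mul_smul, ← inv_smul_eq_iff.2 h1.symm]
  rw [sliceTrans, h3, h2]

end SliceTrans

/-- The map `φ` from the slice at `x` to the orbit space. -/
noncomputable def sliceProj (x : S7) (u : sliceDom x) : CubicQuotient := cubicProj (slice x u)

/-- The action of the isotropy group of `x` on the slice at `x`. -/
noncomputable def sliceAction (x : S7) :
    MulAction.stabilizer SU2 x →* (sliceDom x ≃ₜ sliceDom x) where
  toFun γ :=
    { toFun := fun u => ⟨normalMap x γ u, by
        rw [mem_sliceDom, norm_normalMap]
        exact mem_sliceDom.1 u.2⟩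
      invFun := fun u => ⟨normalMap x γ⁻¹ u, by
        rw [mem_sliceDom, norm_normalMap]
        exact mem_sliceDom.1 u.2⟩
      left_inv := fun u => Subtype.ext <| by
        change normalMap x γ⁻¹ (normalMap x γ u) = u
        rw [← normalMap_mul, inv_mul_cancel, normalMap_one]
      right_inv := fun u => Subtype.ext <| by
        change normalMap x γ (normalMap x γ⁻¹ u) = u
        rw [← normalMap_mul, mul_inv_cancel, normalMap_one]
      continuous_toFun :=
        ((contDiff_normalMap (n := 0) x γ).continuous.comp continuous_subtype_val).subtype_mk _
      continuous_invFun :=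
        ((contDiff_normalMap (n := 0) x γ⁻¹).continuous.comp continuous_subtype_val).subtype_mk _ }
  map_one' := Homeomorph.ext fun u => Subtype.ext (normalMap_one x u)
  map_mul' γ δ := Homeomorph.ext fun u => Subtype.ext (normalMap_mul x γ δ u)

theorem coe_sliceAction (x : S7) (γ : MulAction.stabilizer SU2 x) (u : sliceDom x) :
    (sliceAction x γ u : E4) = normalMap x γ u := rfl

theorem zero_mem_sliceDom (x : S7) : (0 : E4) ∈ sliceDom x := by
  rw [mem_sliceDom, norm_zero]
  exact sliceRadius_pos x

theorem sliceAction_injective (x : S7) : Function.Injective (sliceAction x) := by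
  rw [injective_iff_map_eq_one]
  intro γ hγ
  refine eq_one_of_normalMap_eq fun v => ?_
  have hpos : 0 < ‖v‖ + 1 := by positivity
  set c : ℝ := sliceRadius x / (‖v‖ + 1) with hc
  have hc0 : 0 < c := div_pos (sliceRadius_pos x) hpos
  have hmem : c • v ∈ sliceDom x := by
    rw [mem_sliceDom, norm_smul, Real.norm_of_nonneg hc0.le, hc, div_mul_eq_mul_div,
      div_lt_iff₀ hpos]
    exact mul_lt_mul_of_pos_left (lt_add_one _) (sliceRadius_pos x)
  have h := congrArg (fun f : sliceDom x ≃ₜ sliceDom x => (f ⟨c • v, hmem⟩ : E4)) hγ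
  change normalMap x γ (c • v) = c • v at h
  rw [normalMap_smul] at h
  exact smul_right_injective E4 hc0.ne' h

theorem isOpenMap_sliceProj (x : S7) : IsOpenMap (sliceProj x) := by
  intro V hV
  have h1 : IsOpen ((fun z : SU2 × sliceDom x => z.1 • slice x z.2) '' (univ ×ˢ V)) :=
    (isLocalDiffeomorph_tube x).isOpenMap _ (isOpen_univ.prod hV)
  have h2 : sliceProj x '' V =
      cubicProj '' ((fun z : SU2 × sliceDom x => z.1 • slice x z.2) '' (univ ×ˢ V)) := by
    ext p
    constructor
    · rintro ⟨u, hu, rfl⟩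
      exact ⟨_, ⟨(1, u), ⟨mem_univ _, hu⟩, rfl⟩, cubicProj_smul _ _⟩
    · rintro ⟨_, ⟨z, hz, rfl⟩, rfl⟩
      exact ⟨z.2, hz.2, (cubicProj_smul _ _).symm⟩
  rw [h2]
  exact isOpenMap_cubicProj _ h1

theorem isOrbifoldChart_slice (x : S7) :
    IsOrbifoldChart (sliceDom x) (sliceAction x).range (sliceProj x) where
  connected := ⟨⟨0, zero_mem_sliceDom x⟩, (convex_ball (0 : E4) _).isPreconnected⟩
  finite := by
    have := finite_stabilizer x
    exact Set.finite_range (sliceAction x)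
  smooth := by
    rintro _ ⟨γ, rfl⟩ u
    have h1 : ContMDiffAt (𝓡 4) (𝓡 4) ∞ (normalMap x γ) (u : E4) :=
      (contDiff_normalMap x γ).contMDiff.contMDiffAt
    exact contMDiffAt_opens_of_coe (contMDiffAt_subtype_iff.2 h1)
  continuous := continuous_cubicProj.comp
    ((contMDiff_slice (n := 0) x).continuous.comp continuous_subtype_val)
  isOpenMap := isOpenMap_sliceProj x
  fibers u v := by
    constructor
    · intro h
      obtain ⟨g, hg⟩ := cubicProj_eq_iff.1 h
      refine ⟨_, ⟨⟨g, smul_eq_of_smul_slice u.2 v.2 hg⟩, rfl⟩, Subtype.ext ?_⟩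
      apply slice_injective x
      rw [coe_sliceAction, slice_normalMap, hg]
    · rintro ⟨_, ⟨γ, rfl⟩, rfl⟩
      rw [sliceProj, sliceProj, coe_sliceAction, slice_normalMap, cubicProj_smul]

/-- The orbifold chart given by the slice at `x`. -/
noncomputable def sliceChart (x : S7) : OrbifoldChart 4 CubicQuotient :=
  ⟨sliceDom x, (sliceAction x).range, sliceProj x, isOrbifoldChart_slice x⟩

/-- The coordinate change between two slices moves a point along its orbit, to the second slice, by
the local inverse of the second tube map. -/
theorem compatible_sliceChart (x y : S7) : (sliceChart x).Compatible (sliceChart y) := by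
  intro (u : sliceDom x) (v : sliceDom y) h
  obtain ⟨g, hg⟩ := cubicProj_eq_iff.1 h
  have hg' : g⁻¹ • slice y (v : E4) = slice x u := by rw [← hg, inv_smul_smul]
  have hfu : opensRetract v (sliceTrans x y g u) = v := by
    rw [sliceTrans_eq v.2 hg, opensRetract_of_mem v v.2]
  -- The two coordinate changes are mutually inverse germs.
  have half : ∀ {x y : S7} {u : sliceDom x} {v : sliceDom y} {g : SU2},
      g • slice x (u : E4) = slice y v →
      (∀ᶠ w : sliceDom x in 𝓝 u, ContMDiffAt (𝓡 4) (𝓡 4) ∞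
        (fun w : sliceDom x => opensRetract v (sliceTrans x y g w)) w) ∧
      (∀ᶠ w : sliceDom x in 𝓝 u,
        opensRetract u (sliceTrans y x g⁻¹ (opensRetract v (sliceTrans x y g w))) = w) ∧
      ∀ᶠ w : sliceDom x in 𝓝 u,
        sliceProj y (opensRetract v (sliceTrans x y g w)) = sliceProj x w := by
    intro x y u v g hg
    have hval : Tendsto (Subtype.val : sliceDom x → E4) (𝓝 u) (𝓝 (u : E4)) :=
      continuous_subtype_val.tendsto u
    have hsm := hval.eventually (contMDiffAt_sliceTrans v.2 hg)
    have hdom : ∀ᶠ w : sliceDom x in 𝓝 u, sliceTrans x y g w ∈ sliceDom y := by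
      have hc : ContinuousAt (fun w : sliceDom x => sliceTrans x y g w) u :=
        ContinuousAt.comp (g := sliceTrans x y g) hsm.self_of_nhds.continuousAt
          continuous_subtype_val.continuousAt
      refine hc.eventually ((sliceDom y).isOpen.mem_nhds ?_)
      change sliceTrans x y g u ∈ sliceDom y
      rw [sliceTrans_eq v.2 hg]
      exact v.2
    refine ⟨?_, ?_, ?_⟩
    · filter_upwards [hsm, hdom] with w h1 h2
      exact ContMDiffAt.comp (g := opensRetract v) w (contMDiffAt_opensRetract v h2)
        (contMDiffAt_subtype_iff.2 h1)
    · filter_upwards [hval.eventually (sliceTrans_sliceTrans u.2 v.2 hg), hdom] with w h1 h2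
      rw [opensRetract_of_mem v h2, h1, opensRetract_of_mem u w.2]
    · filter_upwards [hval.eventually (smul_slice_sliceTrans v.2 hg), hdom] with w h1 h2
      rw [opensRetract_of_mem v h2, sliceProj, sliceProj, ← cubicProj_smul g (slice x w), ← h1,
        cubicProj_smul]
  obtain ⟨a1, a2, a3⟩ := half hg
  obtain ⟨b1, b2, -⟩ := half hg'
  rw [inv_inv] at b2
  obtain ⟨Φ, h1, h2, h3⟩ := exists_partialDiffeomorph (I := 𝓡 4) (J := 𝓡 4)
    (f := fun w : sliceDom x => opensRetract v (sliceTrans x y g w)) (x := u)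
    (k := fun w : sliceDom y => opensRetract u (sliceTrans y x g⁻¹ w)) a1
    (by simp only [hfu]; exact b1) a2 (by simp only [hfu]; exact b2) a3
  refine ⟨Φ, h1, ?_, fun w hw => ?_⟩
  · rw [h2]
    exact hfu
  · rw [h2]
    exact h3 w hw

/-- The quotient orbifold. -/
noncomputable def cubicOrbifold : Orbifold 4 where
  carrier := CubicQuotient
  atlas := range sliceChart
  covers p := by
    obtain ⟨x, rfl⟩ := surjective_cubicProj p
    refine ⟨_, ⟨x, rfl⟩, ⟨0, zero_mem_sliceDom x⟩, ?_⟩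
    change cubicProj (slice x 0) = _
    rw [slice_zero]
  compatible := by
    rintro _ ⟨x, rfl⟩ _ ⟨y, rfl⟩
    exact compatible_sliceChart x y

theorem isChart_sliceChart (x : S7) : cubicOrbifold.IsChart (sliceChart x) := by
  rintro _ ⟨y, rfl⟩
  exact compatible_sliceChart x y

theorem isAlmostFreeQuotient_cubicOrbifold :
    IsAlmostFreeQuotient 3 7 SU2 S7 cubicOrbifold cubicProj where
  lieGroup := inferInstance
  compactGroup := inferInstance
  isManifold := inferInstance
  t2 := inferInstance
  secondCountable := inferInstance
  smooth_smul := S7.contMDiff_smul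
  almostFree := finite_stabilizer
  isQuotientMap := isOpenMap_cubicProj.isQuotientMap continuous_cubicProj surjective_cubicProj
  orbits x y := cubicProj_eq_iff
  slice x := by
    refine ⟨sliceChart x, isChart_sliceChart x, ⟨⟨0, zero_mem_sliceDom x⟩, ?_⟩,
      (MulAction.stabilizer SU2 x).subtype.comp
        (MonoidHom.ofInjective (sliceAction_injective x)).symm.toMonoidHom,
      fun u => slice x u.1, ?_, fun u => rfl, ?_, ?_, isLocalDiffeomorph_tube x⟩
    · change cubicProj (slice x 0) = _
      rw [slice_zero]
    · exact Subtype.val_injective.comp (MulEquiv.injective _)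
    · rintro ⟨_, γ, rfl⟩ u
      have h : (MonoidHom.ofInjective (sliceAction_injective x)).symm ⟨_, γ, rfl⟩ = γ :=
        (MulEquiv.symm_apply_eq _).2 rfl
      change slice x (normalMap x γ u.1) =
        ((MonoidHom.ofInjective (sliceAction_injective x)).symm ⟨_, γ, rfl⟩).1 • slice x u.1
      rw [h, slice_normalMap]
    · intro g u v hg
      set γ : MulAction.stabilizer SU2 x := ⟨g, smul_eq_of_smul_slice u.2 v.2 hg⟩
      refine ⟨⟨_, γ, rfl⟩, ?_, Subtype.ext ?_⟩
      · have h : (MonoidHom.ofInjective (sliceAction_injective x)).symm ⟨_, γ, rfl⟩ = γ :=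
          (MulEquiv.symm_apply_eq _).2 rfl
        exact congrArg Subtype.val h
      · apply slice_injective x
        change slice x (normalMap x γ u.1) = _
        rw [slice_normalMap, hg]

instance : CompactSpace cubicOrbifold := inferInstanceAs (CompactSpace CubicQuotient)

end OrbitSpace

/-! ### Connectedness of the Borel construction -/

section Connected

open Metric Set Topology

theorem isKConnectedSpace_borelConstruction : IsKConnectedSpace 3 (BorelConstruction SU2 S7) := by
  have hne : Nonempty S7 := ⟨⟨EuclideanSpace.single 0 1, by simp⟩⟩
  refine ⟨⟨Quotient.mk _ (hne.some, default)⟩, fun x i hi => ?_⟩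
  refine (isPrincipal_borelConstruction SU2 S7).subsingleton_homotopyGroup i ?_ ?_ x
  · refine ExtendsFrom.of_homeomorph (extendsFrom_sphere ?_ ?_) SU2.homeoSphere
    · rw [Module.finrank_fin_fun, finrank_real_C2.out]
      omega
    · refine isClosed_Icc.inter ?_
      have h : {y : Fin i → ℝ | ∃ j, y j = 0 ∨ y j = 1} =
          ⋃ j, ({y : Fin i → ℝ | y j = 0} ∪ {y : Fin i → ℝ | y j = 1}) := by
        ext y
        simp
      change IsClosed {y : Fin i → ℝ | ∃ j, y j = 0 ∨ y j = 1}
      rw [h]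
      exact isClosed_iUnion_of_finite fun j =>
        (isClosed_eq (continuous_apply j) continuous_const).union
          (isClosed_eq (continuous_apply j) continuous_const)
  · refine ExtendsFrom.prod (Y := S7) ?_ extendsFrom_of_contractible
    refine extendsFrom_sphere (F := Cn 4) ?_ isClosed_sphere
    rw [Module.finrank_prod, Module.finrank_fin_fun, finrank_real_C4.out, Module.finrank_self]
    omega

end Connected

/-! ### Orbifold coverings over the regular points -/

section Covering

open Set Topology Filter

/-- Two lifts of a map on a preconnected set that agree at one point agree everywhere, if the
projection is locally injective along one of them. -/
theorem eqOn_of_locallyInjective {A E X : Type*} [TopologicalSpace A] [TopologicalSpace E]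
    [T2Space E] {p : E → X} {S : Set A} (hS : IsPreconnected S) {f g : A → E}
    (hf : ContinuousOn f S) (hg : ContinuousOn g S) (hloc : ∀ a ∈ S, ∃ N ∈ 𝓝 (f a), InjOn p N)
    (hp : ∀ a ∈ S, p (f a) = p (g a)) {a₀ : A} (ha₀ : a₀ ∈ S) (h0 : f a₀ = g a₀) : EqOn f g S := by
  have : PreconnectedSpace S := isPreconnected_iff_preconnectedSpace.1 hS
  have hf' : Continuous fun a : S => f a := continuousOn_iff_continuous_domRestrict.1 hf
  have hg' : Continuous fun a : S => g a := continuousOn_iff_continuous_domRestrict.1 hg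
  have hclopen : IsClopen {a : S | f a = g a} := by
    refine ⟨isClosed_eq hf' hg', isOpen_iff_mem_nhds.2 fun a (ha : f a = g a) => ?_⟩
    obtain ⟨N, hN, hinj⟩ := hloc a a.2
    filter_upwards [hf'.continuousAt.preimage_mem_nhds hN,
      hg'.continuousAt.preimage_mem_nhds (ha ▸ hN)] with b h1 h2
    exact hinj h1 h2 (hp b b.2)
  have huniv := hclopen.eq_univ ⟨⟨a₀, ha₀⟩, h0⟩
  intro a ha
  have : (⟨a, ha⟩ : S) ∈ {a : S | f a = g a} := huniv ▸ mem_univ _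
  exact this

/-- A point with a connected open neighbourhood over which every point of the total space lies on an
open section is evenly covered. -/
theorem isEvenlyCovered_of_sections {E X : Type*} [TopologicalSpace E] [TopologicalSpace X]
    [T2Space E] {p : E → X} (hp : Continuous p) {V : Set X} (hV : IsOpen V)
    (hVc : IsPreconnected V) {b : X} (hb : b ∈ V)
    (hsec : ∀ y, p y ∈ V → ∃ s : X → E, ContinuousOn s V ∧ (∀ x ∈ V, p (s x) = x) ∧
      IsOpen (s '' V) ∧ s (p y) = y) : IsEvenlyCovered p b (p ⁻¹' {b}) := by
  rcases isEmpty_or_nonempty (p ⁻¹' {b}) with hempty | hne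
  · refine (IsEvenlyCovered.of_preimage_eq_empty (I := p ⁻¹' {b}) (hV.mem_nhds hb) ?_)
    rw [eq_empty_iff_forall_notMem]
    intro y hy
    obtain ⟨s, -, h2, -, -⟩ := hsec y hy
    exact hempty.false ⟨s b, h2 b hb⟩
  have hagree : ∀ s s' : X → E, ContinuousOn s V → ContinuousOn s' V → (∀ x ∈ V, p (s x) = x) →
      (∀ x ∈ V, p (s' x) = x) → IsOpen (s '' V) → ∀ x ∈ V, s x = s' x → EqOn s s' V := by
    intro s s' hs hs' h1 h2 h3 x hx hxx
    refine eqOn_of_locallyInjective hVc hs hs' (fun a ha => ?_)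
      (fun a ha => (h1 a ha).trans (h2 a ha).symm) hx hxx
    refine ⟨s '' V, h3.mem_nhds (mem_image_of_mem s ha), ?_⟩
    rintro _ ⟨x₁, hx₁, rfl⟩ _ ⟨x₂, hx₂, rfl⟩ h
    rw [h1 x₁ hx₁, h1 x₂ hx₂] at h
    rw [h]
  have hbase : ∀ e : p ⁻¹' {b}, ∃ s : X → E, ContinuousOn s V ∧ (∀ x ∈ V, p (s x) = x) ∧
      IsOpen (s '' V) ∧ s b = e := by
    rintro ⟨e, he⟩
    have he' : p e = b := he
    obtain ⟨s, h1, h2, h3, h4⟩ := hsec e (he' ▸ hb)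
    exact ⟨s, h1, h2, h3, he' ▸ h4⟩
  choose s hs1 hs2 hs3 hs4 using hbase
  let : TopologicalSpace (p ⁻¹' {b}) := ⊥
  have : DiscreteTopology (p ⁻¹' {b}) := ⟨rfl⟩
  have : Nonempty (X → E) := ⟨s hne.some⟩
  have key : IsEvenlyCovered p b (p ⁻¹' {b}) := by
    refine IsEvenlyCovered.of_trivialization (t := IsOpen.trivializationDiscrete
      (fun e => s e '' V) V hV ?_ ?_ ?_ ?_ ?_) hb
    · intro e W hW
      constructor
      · exact fun h => (h.preimage hp).inter (hs3 e)
      · intro h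
        have : W = V ∩ s e ⁻¹' (p ⁻¹' W ∩ s e '' V) := by
          ext x
          constructor
          · intro hx
            refine ⟨hW hx, ?_, mem_image_of_mem _ (hW hx)⟩
            change p (s e x) ∈ W
            rwa [hs2 e x (hW hx)]
          · rintro ⟨hx, h1, -⟩
            change p (s e x) ∈ W at h1
            rwa [hs2 e x hx] at h1
        rw [this]
        exact (hs1 e).isOpen_inter_preimage hV h
    · rintro e _ ⟨x₁, hx₁, rfl⟩ _ ⟨x₂, hx₂, rfl⟩ h
      rw [hs2 e x₁ hx₁, hs2 e x₂ hx₂] at h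
      rw [h]
    · exact fun e x hx => ⟨s e x, mem_image_of_mem _ hx, hs2 e x hx⟩
    · intro e e' hne
      refine disjoint_left.2 ?_
      rintro _ ⟨x₁, hx₁, rfl⟩ ⟨x₂, hx₂, h⟩
      have hx : x₂ = x₁ := by rw [← hs2 e' x₂ hx₂, h, hs2 e x₁ hx₁]
      rw [hx] at h
      have := hagree _ _ (hs1 e') (hs1 e) (hs2 e') (hs2 e) (hs3 e') x₁ hx₁ h hb
      rw [hs4, hs4] at this
      exact hne (Subtype.ext this).symm
    · intro y hy
      obtain ⟨t, h1, h2, h3, h4⟩ := hsec y hy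
      refine mem_iUnion.2 ⟨⟨t b, h2 b hb⟩, p y, hy, ?_⟩
      rw [← h4]
      have h5 := hagree _ _ (hs1 ⟨t b, h2 b hb⟩) h1 (hs2 _) h2 (hs3 _) b hb (hs4 _) hy
      rw [h4, h5, h4]
  exact key.to_isEvenlyCovered_preimage

/-- An orbifold chart is injective near a point with trivial isotropy. -/
theorem OrbifoldChart.exists_injOn {n : ℕ} {X : Type} [TopologicalSpace X]
    (c : OrbifoldChart n X) {u : c.dom} (hu : c.isotropy u = ⊥) :
    ∃ N ∈ 𝓝 u, InjOn c.toFun N := by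
  have hfin : Finite c.group := c.isChart.finite
  have h1 : ∀ γ : c.group, ∀ᶠ z : c.dom × c.dom in 𝓝 (u, u), γ.1 z.1 = z.2 → γ = 1 := by
    intro γ
    by_cases hγ : γ.1 u = u
    · have : γ.1 ∈ c.isotropy u := ⟨γ.2, hγ⟩
      rw [hu, Subgroup.mem_bot] at this
      exact Eventually.of_forall fun _ _ => Subtype.ext this
    · have hne : ∀ᶠ z : c.dom × c.dom in 𝓝 (u, u), γ.1 z.1 ≠ z.2 :=
        ((γ.1.continuous.comp continuous_fst).continuousAt.ne_iff_eventually_ne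
          continuous_snd.continuousAt).1 hγ
      exact hne.mono fun z hz h => absurd h hz
  have h2 := eventually_all.2 h1
  rw [nhds_prod_eq] at h2
  obtain ⟨N, hN, h3⟩ := (eventually_prod_self_iff
    (r := fun v w => ∀ γ : c.group, γ.1 v = w → γ = 1)).1 h2
  refine ⟨N, hN, fun v hv w hw h => ?_⟩
  obtain ⟨γ, hγ, h4⟩ := (c.isChart.fibers v w).1 h
  have h5 := h3 v hv w hw ⟨γ, hγ⟩ h4
  rw [← h4, show γ = 1 from congrArg Subtype.val h5]
  rfl

/-- The points of the orbit space with trivial isotropy. -/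
def regularSet : Set CubicQuotient := {b | ∃ x, MulAction.stabilizer SU2 x = ⊥ ∧ cubicProj x = b}

theorem sliceProj_injective {x : S7} (hx : MulAction.stabilizer SU2 x = ⊥) :
    Function.Injective (sliceProj x) := by
  intro u v h
  obtain ⟨_, ⟨γ, rfl⟩, hγ⟩ := ((isOrbifoldChart_slice x).fibers u v).1 h
  have h1 : γ = 1 := Subtype.ext (Subgroup.mem_bot.1 (hx ▸ γ.2))
  rw [h1, map_one] at hγ
  exact hγ

/-- Over the regular points, an orbifold covering is a covering: the sheets over the image of a
small connected open set `W` in a chart are the images of the translates of `W`. -/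
theorem isCoveringMapOn_regularSet {O' : Orbifold 4} {p : O' → cubicOrbifold}
    (hp : Orbifold.IsCovering p) : IsCoveringMapOn p regularSet := by
  rintro b ⟨x, hx, rfl⟩
  have : T2Space O' := O'.t2
  obtain ⟨hpc, -, hcov⟩ := hp
  obtain ⟨c, hc, ⟨u₀, hu₀⟩, hlift⟩ := hcov (cubicProj x)
  obtain ⟨h, hu, -, hcomm⟩ := hc _ ⟨x, rfl⟩ u₀ ⟨0, zero_mem_sliceDom x⟩ (by
    rw [hu₀]
    change cubicProj x = cubicProj (slice x 0)
    rw [slice_zero])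
  have hinj : InjOn c.toFun h.source := by
    intro v hv w hw hvw
    rw [← hcomm v hv, ← hcomm w hw] at hvw
    exact h.injOn hv hw (sliceProj_injective hx hvw)
  have : LocallyConnectedSpace c.dom := c.dom.isOpen.locallyConnectedSpace
  set W : Set c.dom := connectedComponentIn h.source u₀ with hW
  have hWo : IsOpen W := h.open_source.connectedComponentIn
  have hWinj : InjOn c.toFun W := hinj.mono (connectedComponentIn_subset _ _)
  have huW : u₀ ∈ W := mem_connectedComponentIn hu
  have : Nonempty c.dom := ⟨u₀⟩
  refine isEvenlyCovered_of_sections hpc (c.isChart.isOpenMap _ hWo)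
    (isPreconnected_connectedComponentIn.image _ c.isChart.continuous.continuousOn)
    (b := cubicProj x) ⟨u₀, huW, hu₀⟩ ?_
  rintro y ⟨w, hw, hwy⟩
  obtain ⟨Γ', ψ, hψ, hle, -, hrange, hpψ⟩ := hlift y ⟨w, hwy⟩
  obtain ⟨v, rfl⟩ : y ∈ range ψ := by
    rw [hrange]
    exact mem_connectedComponentIn ⟨w, hwy⟩
  rw [hpψ] at hwy
  obtain ⟨γ, hγ, rfl⟩ := (c.isChart.fibers w v).1 hwy
  have hleft : LeftInvOn (Function.invFunOn c.toFun W) c.toFun W := hWinj.leftInvOn_invFunOn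
  have himage : (fun b => ψ (γ (Function.invFunOn c.toFun W b))) '' (c.toFun '' W) =
      ψ '' (γ '' W) := by
    rw [image_image, image_image]
    exact image_congr fun v hv => by rw [hleft hv]
  refine ⟨fun b => ψ (γ (Function.invFunOn c.toFun W b)), ?_, ?_, ?_, ?_⟩
  · exact (hψ.continuous.comp γ.continuous).comp_continuousOn
      ((c.isChart.isOpenMap.domRestrict hWo).continuousOn_image_of_leftInvOn hleft)
  · rintro _ ⟨v, hv, rfl⟩
    rw [hpψ, hleft hv]
    exact ((c.isChart.fibers _ _).2 ⟨γ, hγ, rfl⟩).symm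
  · rw [himage]
    exact hψ.isOpenMap _ (γ.isOpenMap _ hWo)
  · change ψ (γ (Function.invFunOn c.toFun W (p (ψ (γ w))))) = _
    rw [hpψ, ← hwy, hleft hw]

end Covering

/-! ### The punctured sphere of forms with a double root -/

section Curve

open Metric Set Topology Filter

/-- The form with coefficients `(a, b, 0, 0)`, as a vector. -/
noncomputable def doubleRoot (a b : ℂ) : Cn 4 := !₂[a, b, 0, 0]

theorem doubleRoot_ne_zero {a b : ℂ} (h : a ≠ 0 ∨ b ≠ 0) : doubleRoot a b ≠ 0 := by
  intro h0
  have h1 : a = 0 := congrArg (fun y : Cn 4 => y 0) h0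
  have h2 : b = 0 := congrArg (fun y : Cn 4 => y 1) h0
  exact h.elim (· h1) (· h2)

theorem continuous_doubleRoot : Continuous fun z : ℂ × ℂ => doubleRoot z.1 z.2 := by
  refine (PiLp.continuous_toLp 2 _).comp (continuous_pi fun i => ?_)
  fin_cases i
  exacts [continuous_fst, continuous_snd, continuous_const, continuous_const]

/-- The point of the sphere that represents the cube of a linear form. -/
noncomputable def cusp : S7 :=
  ⟨EuclideanSpace.single 0 1, by simp⟩

/-- The radial projection of `(a, b, 0, 0)` to the sphere. -/
noncomputable def doubleRootPoint (a b : ℂ) : S7 := sphereNormalize (E := Cn 4) cusp (doubleRoot a b)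

theorem coe_doubleRootPoint {a b : ℂ} (h : a ≠ 0 ∨ b ≠ 0) :
    S7.coe (doubleRootPoint a b) = ‖doubleRoot a b‖⁻¹ • doubleRoot a b :=
  sphereNormalize_val (E := Cn 4) cusp (doubleRoot_ne_zero h)

theorem doubleRootPoint_one_zero : doubleRootPoint 1 0 = cusp := by
  have h : doubleRoot 1 0 = S7.coe cusp := by
    ext i
    fin_cases i <;> simp [doubleRoot, cusp, S7.coe]
  rw [doubleRootPoint, h]
  exact sphereNormalize_coe (E := Cn 4) cusp cusp

theorem continuousAt_doubleRootPoint {a b : ℂ} (h : a ≠ 0 ∨ b ≠ 0) :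
    ContinuousAt (fun z : ℂ × ℂ => doubleRootPoint z.1 z.2) (a, b) :=
  ContinuousAt.comp (g := sphereNormalize (E := Cn 4) cusp)
    (contMDiffAt_sphereNormalize (d := 7) (n := 0) (E := Cn 4) cusp
      (doubleRoot_ne_zero h)).continuousAt continuous_doubleRoot.continuousAt

theorem stabilizer_doubleRootPoint {a b : ℂ} (hb : b ≠ 0) :
    MulAction.stabilizer SU2 (doubleRootPoint a b) = ⊥ := by
  rw [Subgroup.eq_bot_iff_forall]
  intro g hg
  have h0 : doubleRoot a b ≠ 0 := doubleRoot_ne_zero (Or.inr hb)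
  have h1 : cubicRep g (S7.coe (doubleRootPoint a b)) = S7.coe (doubleRootPoint a b) :=
    congrArg S7.coe hg
  rw [coe_doubleRootPoint (Or.inr hb)] at h1
  refine cubicRep_fixed_regular ?_ ?_ ?_ h1
  · simpa [doubleRoot] using ⟨fun _ => hb, hb⟩
  · simp [doubleRoot]
  · simp [doubleRoot]

/-- The torus acts on the forms with a double root. -/
theorem torus_smul_doubleRootPoint (α : Circle) {r : ℝ} (hr : 0 < r) {a b a' b' : ℂ}
    (h : a ≠ 0 ∨ b ≠ 0) (ha : (α : ℂ) ^ 3 * a = r * a') (hb : α * b = r * b') :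
    SU2.torus α • doubleRootPoint a b = doubleRootPoint a' b' := by
  have hα : (α : ℂ) ≠ 0 := by
    rw [← norm_ne_zero_iff, Circle.norm_coe]
    exact one_ne_zero
  have h1 : cubicRep (SU2.torus α) (doubleRoot a b) = r • doubleRoot a' b' := by
    rw [cubicRep_torus]
    ext i
    fin_cases i <;> simp [doubleRoot, ha, hb]
  have h' : a' ≠ 0 ∨ b' ≠ 0 := by
    refine h.imp (fun h0 h2 => ?_) fun h0 h2 => ?_
    · rw [h2, mul_zero] at ha
      exact mul_ne_zero (pow_ne_zero 3 hα) h0 ha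
    · rw [h2, mul_zero] at hb
      exact mul_ne_zero hα h0 hb
  apply S7.coe_injective
  rw [S7.coe_smul, coe_doubleRootPoint h, coe_doubleRootPoint h', cubicRep_real_smul, h1,
    ← (cubicRep (SU2.torus α)).norm_map (doubleRoot a b), h1, norm_smul,
    Real.norm_of_nonneg hr.le, smul_smul, mul_inv, mul_right_comm, inv_mul_cancel₀ hr.ne', one_mul]

/-- The parameter `z` such that the forms `(1, t, 0, 0)` and `(z, 1, 0, 0)` lie, up to positive
multiples, in the same orbit. -/
noncomputable def cuspParam (t : ℂ) : ℂ := (‖t‖ : ℂ) ^ 2 / t ^ 3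

theorem cubicProj_cuspParam {t : ℂ} (ht : t ≠ 0) :
    cubicProj (doubleRootPoint (cuspParam t) 1) = cubicProj (doubleRootPoint 1 t) := by
  have hn : (‖t‖ : ℂ) ≠ 0 := by
    rw [Complex.ofReal_ne_zero, norm_ne_zero_iff]
    exact ht
  set α : Circle := ⟨t / ‖t‖, by
    rw [Submonoid.unitSphere, ← SetLike.mem_coe]
    simp [ht]⟩
  rw [← torus_smul_doubleRootPoint α (inv_pos.2 (norm_pos_iff.2 ht)) (a := cuspParam t) (b := 1)
    (Or.inr one_ne_zero) (a' := 1) (b' := t), cubicProj_smul]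
  · change (t / ‖t‖) ^ 3 * cuspParam t = _
    rw [cuspParam]
    push_cast
    field_simp
  · change t / ‖t‖ * 1 = _
    push_cast
    field_simp

/-- A primitive third root of unity. -/
noncomputable def cubeRoot : Circle := Circle.exp (2 * Real.pi / 3)

theorem cubeRoot_pow : cubeRoot ^ 3 = 1 := by
  rw [cubeRoot, ← Circle.exp_nsmul, nsmul_eq_mul]
  convert Circle.exp_two_pi using 2
  push_cast
  ring

theorem coe_cubeRoot_pow : (cubeRoot : ℂ) ^ 3 = 1 := by
  rw [← Circle.coe_pow, cubeRoot_pow, Circle.coe_one]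

theorem cubeRoot_ne_one : cubeRoot ≠ 1 := by
  rw [cubeRoot, Ne, Circle.exp_eq_one]
  rintro ⟨n, hn⟩
  have h : (1 : ℝ) = 3 * n := by
    have := Real.pi_pos
    field_simp at hn
    linarith
  have h2 : (1 : ℤ) = 3 * n := by exact_mod_cast h
  omega

theorem torus_cubeRoot_ne_one : SU2.torus cubeRoot ≠ 1 := by
  intro h
  apply cubeRoot_ne_one
  have h1 := congrArg (fun g : SU2 => g.1 0 0) h
  rw [SU2.torus, SU2.ofPair_val] at h1
  exact Subtype.ext (by simpa using h1)

theorem cuspParam_cubeRoot_mul (t : ℂ) : cuspParam (cubeRoot * t) = cuspParam t := by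
  rw [cuspParam, cuspParam, norm_mul, Circle.norm_coe, one_mul, mul_pow, coe_cubeRoot_pow, one_mul]

theorem torus_cubeRoot_smul (t : ℂ) :
    SU2.torus cubeRoot • doubleRootPoint 1 t = doubleRootPoint 1 (cubeRoot * t) :=
  torus_smul_doubleRootPoint cubeRoot one_pos (Or.inl one_ne_zero)
    (by rw [coe_cubeRoot_pow]; simp) (by simp)

theorem torus_cubeRoot_smul_cusp : SU2.torus cubeRoot • cusp = cusp := by
  have := torus_cubeRoot_smul 0
  rwa [mul_zero, doubleRootPoint_one_zero] at this

theorem isPreconnected_punctured_ball (δ : ℝ) : IsPreconnected {t : ℂ | 0 < ‖t‖ ∧ ‖t‖ < δ} := by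
  have h : {t : ℂ | 0 < ‖t‖ ∧ ‖t‖ < δ} =
      (fun z : ℝ × ℝ => (z.1 : ℂ) * Complex.exp (z.2 * Complex.I)) '' (Ioo 0 δ ×ˢ univ) := by
    ext t
    constructor
    · exact fun ht => ⟨(‖t‖, t.arg), ⟨ht, mem_univ _⟩, Complex.norm_mul_exp_arg_mul_I t⟩
    · rintro ⟨⟨r, θ⟩, ⟨hr, -⟩, rfl⟩
      have : ‖(r : ℂ) * Complex.exp (θ * Complex.I)‖ = r := by
        rw [norm_mul, Complex.norm_exp_ofReal_mul_I, mul_one, Complex.norm_real,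
          Real.norm_of_nonneg hr.1.le]
      change 0 < ‖_‖ ∧ ‖_‖ < δ
      rw [this]
      exact hr
  rw [h]
  exact (isPreconnected_Ioo.prod isPreconnected_univ).image _ (by fun_prop)

end Curve

/-! ### Badness -/

section Bad

open Metric Set Topology Filter

/-- The forms `(1, t, 0, 0)` with small `t`, in the coordinates of the tube around the orbit of the
cusp. -/
theorem exists_cuspCoord : ∃ (g : ℂ → SU2) (W : ℂ → sliceDom cusp), ContinuousAt g 0 ∧ g 0 = 1 ∧
    W 0 = ⟨0, zero_mem_sliceDom cusp⟩ ∧ (∀ᶠ t in 𝓝 0, ContinuousAt W t) ∧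
    ∀ᶠ t in 𝓝 0, g t • slice cusp (W t) = doubleRootPoint 1 t := by
  have hD : ∀ t, ContinuousAt (fun t : ℂ => doubleRootPoint 1 t) t := fun t =>
    ContinuousAt.comp (g := fun z : ℂ × ℂ => doubleRootPoint z.1 z.2)
      (continuousAt_doubleRootPoint (Or.inl one_ne_zero))
      (continuousAt_const.prodMk continuousAt_id)
  have h0 := zero_mem_sliceDom cusp
  have hD0 : Tendsto (fun t : ℂ => doubleRootPoint 1 t) (𝓝 0) (𝓝 (slice cusp 0)) := by
    have := (hD 0).tendsto
    rwa [doubleRootPoint_one_zero, ← slice_zero cusp] at this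
  have hval : tubeInv cusp (doubleRootPoint 1 0) = (1, 0) := by
    rw [doubleRootPoint_one_zero]
    have := tubeInv_slice h0
    rwa [slice_zero] at this
  have hc : ∀ᶠ t : ℂ in 𝓝 0, ContinuousAt (fun t => tubeInv cusp (doubleRootPoint 1 t)) t :=
    (hD0.eventually (contMDiffAt_tubeInv h0)).mono fun t ht =>
      ContinuousAt.comp (g := tubeInv cusp) ht.continuousAt (hD t)
  have hdom : ∀ᶠ t : ℂ in 𝓝 0, (tubeInv cusp (doubleRootPoint 1 t)).2 ∈ sliceDom cusp := by
    refine (continuousAt_snd.comp hc.self_of_nhds).eventually ((sliceDom cusp).isOpen.mem_nhds ?_)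
    change (tubeInv cusp (doubleRootPoint 1 0)).2 ∈ sliceDom cusp
    rw [hval]
    exact h0
  refine ⟨fun t => (tubeInv cusp (doubleRootPoint 1 t)).1,
    fun t => opensRetract ⟨0, h0⟩ (tubeInv cusp (doubleRootPoint 1 t)).2,
    continuousAt_fst.comp hc.self_of_nhds, ?_, ?_, ?_, ?_⟩
  · simp only [hval]
  · simp only [hval]
    exact opensRetract_of_mem _ h0
  · filter_upwards [hc, hdom] with t h1 h2
    exact ContinuousAt.comp (g := opensRetract ⟨0, h0⟩)
      (contMDiffAt_opensRetract (I := 𝓡 4) _ h2).continuousAt (continuousAt_snd.comp h1)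
  · filter_upwards [hD0.eventually (tube_tubeInv h0), hdom] with t h1 h2
    rw [opensRetract_of_mem _ h2]
    exact h1

/-- The image of the line of forms `(z, 1, 0, 0)` lifts to every covering of the quotient orbifold,
because all its points are regular and the line is simply connected. -/
theorem exists_lift_line {O' : Orbifold 4} {p : O' → cubicOrbifold}
    (hp : Orbifold.IsCovering p) :
    ∃ F : ℂ → O', Continuous F ∧ ∀ z, p (F z) = cubicProj (doubleRootPoint z 1) := by
  have hc : Continuous fun z : ℂ => doubleRootPoint z 1 :=
    continuous_iff_continuousAt.2 fun z =>
      ContinuousAt.comp (g := fun z : ℂ × ℂ => doubleRootPoint z.1 z.2) (f := fun z : ℂ => (z, 1))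
        (continuousAt_doubleRootPoint (Or.inr one_ne_zero))
        (continuousAt_id.prodMk continuousAt_const)
  let f : C(ℂ, CubicQuotient) := ⟨fun z => cubicProj (doubleRootPoint z 1),
    continuous_cubicProj.comp hc⟩
  obtain ⟨e₀, he₀⟩ := hp.2.1 (f 0)
  obtain ⟨F, ⟨-, hF⟩, -⟩ := (isCoveringMapOn_regularSet hp).existsUnique_continuousMap_lifts f
    (a₀ := 0) he₀ fun z => ⟨_, stabilizer_doubleRootPoint one_ne_zero, rfl⟩
  exact ⟨F, F.continuous, fun z => congrFun hF z⟩

/-- A lift of the line of regular points to a covering manifold would, near the cusp, be injective in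
the parameter `t` of the disc `(1, t, 0, 0)`, whereas `t` and `ω t` give the same point of the line
if `ω³ = 1`. -/
theorem isBad_cubicOrbifold : cubicOrbifold.IsBad := by
  rintro ⟨O', p, hmfd, hp⟩
  have : T2Space O' := O'.t2
  obtain ⟨F, hFc, hF⟩ := exists_lift_line hp
  have hcov := isCoveringMapOn_regularSet hp
  obtain ⟨-, -, hlift⟩ := hp
  obtain ⟨c, hc, ⟨u₀, hu₀⟩, hlift⟩ := hlift (cubicProj cusp)
  obtain ⟨g, W, hg, hg0, hW0, hWc, hgW⟩ := exists_cuspCoord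
  obtain ⟨Φ, hΦ, hΦ0, hcomm⟩ : ∃ Φ : PartialDiffeomorph (𝓡 4) (𝓡 4) c.dom (sliceDom cusp) ∞,
      u₀ ∈ Φ.source ∧ Φ.toFun u₀ = ⟨0, zero_mem_sliceDom cusp⟩ ∧
        ∀ w ∈ Φ.source, sliceProj cusp (Φ.toFun w) = c.toFun w :=
    hc _ ⟨cusp, rfl⟩ u₀ ⟨0, zero_mem_sliceDom cusp⟩ (by
      rw [hu₀]
      change cubicProj cusp = cubicProj (slice cusp 0)
      rw [slice_zero])
  rw [← hΦ0] at hW0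
  -- The forms `(1, t, 0, 0)` in the coordinates of the chart `c`.
  set H : ℂ → c.dom := fun t => Φ.invFun (W t) with hH
  have hH0 : H 0 = u₀ := by
    change Φ.invFun (W 0) = u₀
    rw [hW0]
    exact Φ.left_inv' hΦ
  have htarget : ∀ᶠ t in 𝓝 0, W t ∈ Φ.target := by
    refine hWc.self_of_nhds.eventually (Φ.open_target.mem_nhds ?_)
    rw [hW0]
    exact Φ.map_source' hΦ
  have hHc : ∀ᶠ t in 𝓝 0, ContinuousAt H t := by
    filter_upwards [hWc, htarget] with t h1 h2
    exact ContinuousAt.comp (g := Φ.invFun)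
      (Φ.contMDiffOn_invFun.continuousOn.continuousAt (Φ.open_target.mem_nhds h2)) h1
  have hHproj : ∀ᶠ t in 𝓝 0, c.toFun (H t) = cubicProj (doubleRootPoint 1 t) := by
    filter_upwards [htarget, hgW] with t h1 h2
    rw [← h2, cubicProj_smul, ← hcomm (H t) (Φ.map_target' h1)]
    exact congrArg (sliceProj cusp) (Φ.right_inv' h1)
  obtain ⟨δ, hδ, hball⟩ := Metric.eventually_nhds_iff_ball.1 (hHc.and hHproj)
  set Ω : Set ℂ := {t : ℂ | 0 < ‖t‖ ∧ ‖t‖ < δ} with hΩ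
  have hΩne : ∀ t ∈ Ω, t ≠ 0 := fun t ht => norm_pos_iff.1 ht.1
  have hΩball : ∀ t ∈ Ω, t ∈ ball (0 : ℂ) δ := fun t ht => mem_ball_zero_iff.2 ht.2
  have hparam : ∀ t ∈ Ω, p (F (cuspParam t)) = c.toFun (H t) := by
    intro t ht
    rw [hF, cubicProj_cuspParam (hΩne t ht), (hball t (hΩball t ht)).2]
  obtain ⟨t₀, ht₀⟩ : ∃ t₀, t₀ ∈ Ω := by
    refine ⟨((δ / 2 : ℝ) : ℂ), ?_⟩
    change 0 < ‖_‖ ∧ ‖_‖ < δ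
    rw [Complex.norm_real, Real.norm_of_nonneg (by positivity)]
    exact ⟨by positivity, by linarith⟩
  obtain ⟨Γ', ψ, hψ, hle, hchart, hrange, hpψ⟩ := hlift (F (cuspParam t₀)) ⟨_, (hparam t₀ ht₀).symm⟩
  obtain ⟨v, hv⟩ : F (cuspParam t₀) ∈ range ψ := by
    rw [hrange]
    exact mem_connectedComponentIn ⟨_, (hparam t₀ ht₀).symm⟩
  obtain ⟨γ, hγ, rfl⟩ := (c.isChart.fibers (H t₀) v).1 (by rw [← hparam t₀ ht₀, ← hv, hpψ])
  -- On the punctured disc, the lift of the line is the path `t ↦ ψ (γ (H t))`.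
  have heq : EqOn (fun t => F (cuspParam t)) (fun t => ψ (γ (H t))) Ω := by
    refine eqOn_of_locallyInjective (p := p) (isPreconnected_punctured_ball δ) ?_ ?_ ?_ ?_ ht₀ hv.symm
    · refine hFc.comp_continuousOn ?_
      refine ContinuousOn.div (by fun_prop) (by fun_prop) fun t ht => pow_ne_zero 3 (hΩne t ht)
    · exact (hψ.continuous.comp γ.continuous).comp_continuousOn fun t ht =>
        (hball t (hΩball t ht)).1.continuousWithinAt
    · intro t ht
      obtain ⟨e, he, hpe⟩ := hcov.isLocalHomeomorphOn (F (cuspParam t)) (by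
        change p (F (cuspParam t)) ∈ regularSet
        rw [hF]
        exact ⟨_, stabilizer_doubleRootPoint one_ne_zero, rfl⟩)
      exact ⟨e.source, e.open_source.mem_nhds he, hpe ▸ e.injOn⟩
    · intro t ht
      rw [hparam t ht, hpψ]
      exact (c.isChart.fibers _ _).2 ⟨γ, hγ, rfl⟩
  obtain ⟨N, hN, hinj⟩ := OrbifoldChart.exists_injOn _ (hmfd ⟨c.dom, Γ', ψ, hψ⟩ hchart (γ u₀))
  have hrot : Tendsto (fun t : ℂ => (cubeRoot : ℂ) * t) (𝓝 0) (𝓝 0) := by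
    have h1 : Continuous fun t : ℂ => (cubeRoot : ℂ) * t := by fun_prop
    simpa using h1.tendsto 0
  have hmem : ∀ᶠ t in 𝓝 0, γ (H t) ∈ N := by
    have h1 : ContinuousAt (fun t => γ (H t)) 0 :=
      γ.continuous.continuousAt.comp hHc.self_of_nhds
    refine h1.preimage_mem_nhds ?_
    rw [hH0]
    exact hN
  have hsmall : ∀ᶠ t : ℂ in 𝓝 0, ‖t‖ < δ :=
    Filter.mem_of_superset (ball_mem_nhds (0 : ℂ) hδ) fun t ht => mem_ball_zero_iff.1 ht
  -- The parameters `t` and `ω t` give the same point of the line, hence the same slice coordinates.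
  have hconst : ∀ᶠ t in 𝓝[≠] (0 : ℂ), g (cubeRoot * t) * (g t)⁻¹ = SU2.torus cubeRoot := by
    filter_upwards [nhdsWithin_le_nhds (hmem.and (hrot.eventually hmem)),
      nhdsWithin_le_nhds (htarget.and (hrot.eventually htarget)),
      nhdsWithin_le_nhds (hgW.and (hrot.eventually hgW)), nhdsWithin_le_nhds hsmall,
      self_mem_nhdsWithin] with t h1 h2 h3 h4 h5
    have h6 : t ∈ Ω := ⟨norm_pos_iff.2 h5, h4⟩
    have h7 : (cubeRoot : ℂ) * t ∈ Ω := by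
      have h : ‖(cubeRoot : ℂ) * t‖ = ‖t‖ := by rw [norm_mul, Circle.norm_coe, one_mul]
      change 0 < ‖_‖ ∧ ‖_‖ < δ
      rw [h]
      exact h6
    have h8 : ψ (γ (H (cubeRoot * t))) = ψ (γ (H t)) := by
      refine ((heq h7).symm.trans ?_).trans (heq h6)
      simp only [cuspParam_cubeRoot_mul]
    have h9 : H (cubeRoot * t) = H t := γ.injective (hinj h1.2 h1.1 h8)
    have h10 : W (cubeRoot * t) = W t := by
      have := congrArg Φ.toFun h9
      rw [hH] at this
      simp only [Φ.right_inv' h2.1, Φ.right_inv' h2.2] at this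
      exact this
    have h11 : (g (cubeRoot * t) * (g t)⁻¹) • doubleRootPoint 1 t =
        SU2.torus cubeRoot • doubleRootPoint 1 t := by
      rw [torus_cubeRoot_smul, ← h3.2, h10, ← h3.1, mul_smul, inv_smul_smul]
    have h12 : (SU2.torus cubeRoot)⁻¹ * (g (cubeRoot * t) * (g t)⁻¹) ∈
        MulAction.stabilizer SU2 (doubleRootPoint 1 t) := by
      rw [MulAction.mem_stabilizer_iff, mul_smul, h11, inv_smul_smul]
    rw [stabilizer_doubleRootPoint h5, Subgroup.mem_bot] at h12
    exact (inv_mul_eq_one.1 h12).symm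
  have hlim : Tendsto (fun t : ℂ => g (cubeRoot * t) * (g t)⁻¹) (𝓝[≠] 0) (𝓝 1) := by
    have h1 := ((hg.tendsto.comp hrot).mul hg.tendsto.inv).mono_left
      (nhdsWithin_le_nhds (s := {0}ᶜ))
    rwa [hg0, inv_one, mul_one] at h1
  exact torus_cubeRoot_ne_one
    (tendsto_nhds_unique (tendsto_const_nhds.congr' (hconst.mono fun t ht => ht.symm)) hlim)

end Bad

theorem mainTheorem6 :
    ∃ ρ : SU2 →* (Cn 4 ≃ₗᵢ[ℂ] Cn 4),
      -- `ρ` is a continuous irreducible representation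
      Continuous (fun z : SU2 × Cn 4 => ρ z.1 z.2) ∧
      (∀ W : Submodule ℂ (Cn 4), (∀ g : SU2, ∀ w ∈ W, ρ g w ∈ W) → W = ⊥ ∨ W = ⊤) ∧
      -- the action on the unit sphere is almost free but not free
      (∀ x : RepSphere ρ, Finite (MulAction.stabilizer SU2 x)) ∧
      (∃ x : RepSphere ρ, MulAction.stabilizer SU2 x ≠ ⊥) ∧
      -- the quotient is a compact, 3-connected, bad 4-orbifold
      ∃ (O : Orbifold 4) (q : RepSphere ρ → O),
        IsAlmostFreeQuotient 3 7 SU2 (RepSphere ρ) O q ∧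
        CompactSpace O ∧
        IsKConnectedSpace 3 (BorelConstruction SU2 (RepSphere ρ)) ∧
        O.IsKConnected 3 ∧
        O.IsBad := by
  refine ⟨cubicRep, continuous_cubicRep, cubicRep_irreducible, finite_stabilizer, ⟨cusp, ?_⟩,
    cubicOrbifold, cubicProj, isAlmostFreeQuotient_cubicOrbifold, inferInstance,
    isKConnectedSpace_borelConstruction, ?_, isBad_cubicOrbifold⟩
  · intro h
    have h1 : SU2.torus cubeRoot ∈ MulAction.stabilizer SU2 cusp := torus_cubeRoot_smul_cusp
    rw [h, Subgroup.mem_bot] at h1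
    exact torus_cubeRoot_ne_one h1
  · exact ⟨3, 7, SU2, S7, _, _, _, _, _, _, _, isAlmostFreeQuotient_cubicOrbifold,
      isKConnectedSpace_borelConstruction⟩
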